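/- Let $N\ge 1$ be an integer, let $\hbar,m,\omega>0$ be real, and let $\mathfrak{gl}(1|3N)$ be the complex Lie superalgebra with basis $e_{ij}$ ($0\le i,j\le 3N$), where $e_{ij}$ is odd if exactly one of $i,j$ is $0$ and even otherwise, and $$e_{ij}e_{kl}-(-1)^{\deg e_{ij}\deg e_{kl}}e_{kl}e_{ij}=\delta_{jk}e_{il}-(-1)^{\deg e_{ij}\deg e_{kl}}\delta_{il}e_{kj}.$$ Let $\epsilon,\delta_1,\dots,\delta_{3N}$ be the basis dual to $e_{00},e_{11},\dots,e_{3N,3N}$. There is a finite-dimensional simple ($\mathbb Z_2$-graded) $\mathfrak{gl}(1|3N)$-module $W$ with highest weight $2\epsilon+\delta_1$ (i.e. containing a nonzero vector killed by all $e_{ij}$, $i<j$, on which $e_{00},e_{11},\dots$ act by $2,1,0,\dots,0$), and for every such $W$ the following holds. For $\alpha=1,\dots,N$ and $k=1,2,3$ put $A^+_{\alpha k}=e_{j0}$, $A^-_{\alpha k}=e_{0j}$ with $j=3(\alpha-1)+k$, and $$\hat R_{\alpha k}=\sqrt{\tfrac{\hbar}{(3N-1)m\omega}}\,(A^+_{\alpha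 k}+A^-_{\alpha k}),\qquad \hat P_{\alpha k}=-i\sqrt{\tfrac{m\omega\hbar}{3N-1}}\,(A^+_{\alpha k}-A^-_{\alpha k}),$$ $$\hat H=\sum_{\alpha,k}\Big(\frac{\hat P_{\alpha k}^2}{2m}+\frac{m\omega^2}{2}\hat R_{\alpha k}^2\Big),\qquad \hat J_j=-\frac{3N-1}{2\hbar}\sum_{\alpha,k,l}\epsilon_{jkl}\,\{\hat R_{\alpha k},\hat P_{\alpha l}\}.$$ Put $E_q=\hbar\omega\big(\frac{6N+1}{3N-1}-q\big)$ for $q=0,1,2,\dots$ 1. (Energy levels.) $\hat H$ is diagonalizable and has exactly the three distinct eigenvalues $$E_0=\hbar\omega\frac{6N+1}{3N-1},\quad E_1=\hbar\omega\frac{3N+2}{3N-1},\quad E_2=\hbar\omega\frac{3}{3N-1},$$ with eigenspaces of dimension $3N$, $9N^2$ and $N(9N^2-1)$ respectively. 2. (Positions.) For all $\alpha,i$, the operator $\hat R_{\alpha i}^2$ maps each $E_q$-eigenspace of $\hat H$ into itself, and its spectrum there is the set of all $\frac{\hbar\, r}{(3N-1)m\omega}$ with $r\in\{2,3\}$ for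 $q=0$, $r\in\{1,2,3\}$ for $q=1$, $r\in\{0,1,2\}$ for $q=2$. 3. (Angular momentum.) For every $q\geq 0$ the $E_q$-eigenspace of $\hat H$ is a direct sum of irreducible subspaces for $\hat J_1,\hat J_2,\hat J_3$, of which exactly $n_{q,j}$ have angular momentum $j$ (dimension $2j+1$), $j=0,1,2,\dots$, where $$G(Q,J)_N=\sum_{q,j\ge 0}n_{q,j}Q^qJ^j=NJ+N^2(1+J+J^2)Q+\Big(\tfrac13N(N^2-1)+N^3J+\tfrac13N(2N^2+1)J^2+\tfrac13N(N^2-1)J^3\Big)Q^2 .$$ In particular $G(1,J)_{N=1}=1+3J+2J^2$ and $G(1,J)_{N=2}=6+14J+10J^2+2J^3$. -/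

import Mathlib

noncomputable section

namespace WQO

/-- The degree of the Weyl matrix `e i j` of `gl(1|n)`, whose rows and columns are labelled by
`0, 1, …, n`: it is odd exactly when one of `i`, `j` is `0` and the other one is not. -/
def weylDeg {n : ℕ} (i j : Fin (n + 1)) : ℕ := if (i = 0 ↔ j = 0) then 0 else 1

/-- The sign `(-1) ^ (deg (e i j) * deg (e k l))`. -/
def weylSign {n : ℕ} (i j k l : Fin (n + 1)) : ℂ := (-1) ^ (weylDeg i j * weylDeg k l)

/-- A module of the complex Lie superalgebra `gl(1|n)` on the space `W`: a `ℤ/2`-grading of `W`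
and operators representing the basis `e i j` (the Weyl matrices), homogeneous of the degree of
`e i j`, that satisfy the defining super-bracket relations of `gl(1|n)`. -/
structure GLModule (n : ℕ) (W : Type*) [AddCommGroup W] [Module ℂ W] where
  gr : ZMod 2 → Submodule ℂ W
  isCompl_gr : IsCompl (gr 0) (gr 1)
  e : Fin (n + 1) → Fin (n + 1) → Module.End ℂ W
  e_mem_gr : ∀ (i j : Fin (n + 1)) (a : ZMod 2), ∀ v ∈ gr a, e i j v ∈ gr (a + weylDeg i j)
  bracket : ∀ i j k l : Fin (n + 1),
    e i j * e k l - weylSign i j k l • (e k l * e i j) =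
      (if j = k then e i l else 0) - weylSign i j k l • (if i = l then e k j else 0)

namespace GLModule

variable {n : ℕ} {W : Type*} [AddCommGroup W] [Module ℂ W]

/-- Simple: nonzero, and without graded submodules other than zero and the whole space. -/
def IsSimple (ρ : GLModule n W) : Prop :=
  Nontrivial W ∧ ∀ U : Submodule ℂ W,
    (∀ (i j : Fin (n + 1)), ∀ u ∈ U, ρ.e i j u ∈ U) →
    U = (U ⊓ ρ.gr 0) ⊔ (U ⊓ ρ.gr 1) → U = ⊥ ∨ U = ⊤

/-- There is a highest weight vector of weight `Λ 0 • ε + ∑ Λ i • δ_i`: a nonzero vector that is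
annihilated by all `e i j` with `i < j`, and on which `e i i` is multiplication by `Λ i`. -/
def HasHighestWeight (ρ : GLModule n W) (Λ : Fin (n + 1) → ℂ) : Prop :=
  ∃ v : W, v ≠ 0 ∧ (∀ i j : Fin (n + 1), i < j → ρ.e i j v = 0) ∧
    ∀ i : Fin (n + 1), ρ.e i i v = Λ i • v

end GLModule

/-- The highest weight `2 ε + δ_1`, that is `[2, 1, 0, …, 0]`. -/
def weight21 (n : ℕ) (i : Fin (n + 1)) : ℂ :=
  if (i : ℕ) = 0 then 2 else if (i : ℕ) = 1 then 1 else 0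

/-- The label in `1, …, 3N` of component `k` of particle `α` (both counted from `0` here). -/
def label {N : ℕ} (α : Fin N) (k : Fin 3) : Fin (3 * N + 1) :=
  ⟨3 * (α : ℕ) + (k : ℕ) + 1, by have := α.isLt; have := k.isLt; omega⟩

/-- The Levi-Civita symbol on three indices. -/
def levi (j k l : Fin 3) : ℂ :=
  if k = j + 1 ∧ l = j + 2 then 1 else if k = j + 2 ∧ l = j + 1 then -1 else 0

/-- The anticommutator of two operators. -/
def anticomm {W : Type*} [AddCommGroup W] [Module ℂ W] (S T : Module.End ℂ W) :
    Module.End ℂ W := S * T + T * S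

section Operators

variable {N : ℕ} {W : Type*} [AddCommGroup W] [Module ℂ W] (ρ : GLModule (3 * N) W)

/-- `A⁺ = e_{j0}` for the label `j` of component `k` of particle `α`. -/
def aPlus (α : Fin N) (k : Fin 3) : Module.End ℂ W := ρ.e (label α k) 0

/-- `A⁻ = e_{0j}` for the label `j` of component `k` of particle `α`. -/
def aMinus (α : Fin N) (k : Fin 3) : Module.End ℂ W := ρ.e 0 (label α k)

/-- The position operator. Together with `mom` it is the solution `R`, `P` of
`A^± = √((3N-1) m ω / (4 ħ)) R ± i √((3N-1) / (4 m ω ħ)) P`. -/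
def pos (hbar m ω : ℝ) (α : Fin N) (k : Fin 3) : Module.End ℂ W :=
  (Real.sqrt (hbar / ((3 * (N : ℝ) - 1) * m * ω)) : ℂ) • (aPlus ρ α k + aMinus ρ α k)

/-- The momentum operator. -/
def mom (hbar m ω : ℝ) (α : Fin N) (k : Fin 3) : Module.End ℂ W :=
  (-Complex.I * (Real.sqrt (m * ω * hbar / (3 * (N : ℝ) - 1)) : ℂ)) •
    (aPlus ρ α k - aMinus ρ α k)

/-- The Hamiltonian `∑_α (P_α² / (2m) + (m ω² / 2) R_α²)`. -/
def hamiltonian (hbar m ω : ℝ) : Module.End ℂ W :=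
  ∑ α : Fin N, ∑ k : Fin 3,
    ((1 / (2 * (m : ℂ))) • (mom ρ hbar m ω α k) ^ 2 +
      ((m : ℂ) * (ω : ℂ) ^ 2 / 2) • (pos ρ hbar m ω α k) ^ 2)

/-- The components of the total angular momentum operator, the sum over all particles `α` of
`-((3N-1) / (2ħ)) ∑_{k,l} ε_{jkl} {R_{αk}, P_{αl}}`. -/
def angMom (hbar m ω : ℝ) (j : Fin 3) : Module.End ℂ W :=
  ∑ α : Fin N, (-((3 * (N : ℂ) - 1) / (2 * (hbar : ℂ)))) •
    ∑ k : Fin 3, ∑ l : Fin 3,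
      levi j k l • anticomm (pos ρ hbar m ω α k) (mom ρ hbar m ω α l)

end Operators

/-- `E_q = ħ ω ((6N+1)/(3N-1) - q)`. -/
def energy (N : ℕ) (hbar ω : ℝ) (q : ℕ) : ℝ :=
  hbar * ω * ((6 * (N : ℝ) + 1) / (3 * (N : ℝ) - 1) - (q : ℝ))

section AngularMomentum

variable {W : Type*} [AddCommGroup W] [Module ℂ W]

/-- `U` is an irreducible `so(3)`-submodule, of angular momentum `j`, for the action of the
angular momentum operators `J`: it is invariant, has no invariant subspaces other than zero and
itself, and has dimension `2j+1`. -/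
def IsMultiplet (J : Fin 3 → Module.End ℂ W) (j : ℕ) (U : Submodule ℂ W) : Prop :=
  (∀ k : Fin 3, ∀ u ∈ U, J k u ∈ U) ∧
    (∀ U' : Submodule ℂ W, U' ≤ U → (∀ k : Fin 3, ∀ u ∈ U', J k u ∈ U') → U' = ⊥ ∨ U' = U) ∧
    Module.finrank ℂ U = 2 * j + 1

/-- The subspace `E` is a direct sum of irreducible `so(3)`-submodules, exactly `mult j` of which
have angular momentum `j`, for `j = 0, 1, 2, …` -/
def HasAngularContent (J : Fin 3 → Module.End ℂ W) (E : Submodule ℂ W) (mult : ℕ → ℕ) : Prop :=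
  ∃ U : (j : ℕ) → Fin (mult j) → Submodule ℂ W,
    (∀ (j : ℕ) (a : Fin (mult j)), IsMultiplet J j (U j a)) ∧
    iSupIndep (fun p : Σ j : ℕ, Fin (mult j) => U p.1 p.2) ∧
    (⨆ p : Σ j : ℕ, Fin (mult j), U p.1 p.2) = E

end AngularMomentum

end WQO

end

/-!
Write `V = ℂ^{1|3N}` for the defining representation of `gl(1|3N)`. The module of highest weight
`2 ε + δ_1` is the Schur functor of the partition `(2,1)` applied to `V`, and it is realized here as
the eigenspace `WQO.twisted` of the cyclic permutation of `V ⊗ V ⊗ V`, taken with Koszul signs, for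
a primitive cube root of unity `ζ`. In coordinates its elements are functions on triples of basis
labels, so that all dimensions become counts of triples: the cyclic group acts freely on the
nonconstant triples and the eigenvalue `ζ` does not occur on the constant ones
(`WQO.finrank_twistedOn`).

The eigenspace is irreducible (`WQO.twisted_irreducible`): a vector annihilated by all raising
operators is a multiple of the highest weight vector, and since the adjoint of `e i j` is `e j i`,
the orthogonal complement of an invariant subspace is invariant. This gives existence. Conversely
every simple module of the same highest weight is isomorphic to it
(`WQO.GLModule.IsSimple.exists_intertwiner`): in the product of the two modules the pair of highest
weight vectors generates the graph of an isomorphism. All claims can therefore be checked in the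
model.

The relations of `gl(1|3N)` give `R_{αk}² = ħ / ((3N-1) m ω) (e_jj + e_00)`, and since the sum of
all `e_ii` is `3`, the Hamiltonian is an affine function of `e_00`
(`WQO.IsModel.hamiltonian_apply`). On functions on triples `e_ii` counts the labels equal to `i`.
Hence the level `q` consists of the functions supported on the triples with `2 - q` even labels,
and the spectra of `H` and of `R_{αk}²` are, up to these affine maps, the values of counting
functions on nonconstant triples (`WQO.IsModel.exists_eigenvector_iff`).

The angular momentum operators are the natural action of `so(3)` on the three components of every
particle (`WQO.angMom_eq`). In spherical coordinates the third component becomes diagonal, which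
yields the dimensions of its weight spaces on every level (`WQO.finrank_weightSpace`,
`WQO.finrank_levelSpin_values`). The decomposition into irreducible subspaces follows from these
(`WQO.IsAngular.hasAngularContent`): the raising operator maps the weight space of weight `j` to the
one of weight `j + 1`, its kernel provides at least `n_{q,j}` independent highest weight vectors,
each of them generates a multiplet of dimension `2j + 1`, the sum of these multiplets is direct, and
the dimension of the level leaves room for nothing else.
-/

namespace WQO

open Module
open scoped Kronecker

set_option linter.unusedSectionVars false

/-! ### Angular momentum content from weight multiplicities -/

section Ladder

variable {W : Type*} [AddCommGroup W] [Module ℂ W]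

/-- Operators `h`, `e`, `f` satisfying the commutation relations of `J₃`, `J₊`, `J₋`. -/
structure IsLadder (h e f : End ℂ W) : Prop where
  h_e : h * e - e * h = e
  h_f : h * f - f * h = -f
  e_f : e * f - f * e = (2 : ℂ) • h

/-- A vector of weight `μ` for `h` that is annihilated by the raising operator `e`. -/
structure IsHighest (h e : End ℂ W) (μ : ℂ) (v : W) : Prop where
  h_apply : h v = μ • v
  e_apply : e v = 0

variable {h e f : End ℂ W}

theorem IsLadder.h_pow_f (L : IsLadder h e f) {μ : ℂ} {v : W} (hv : h v = μ • v) (k : ℕ) :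
    h ((f ^ k) v) = (μ - k) • (f ^ k) v := by
  induction k with
  | zero => simpa using hv
  | succ k ih =>
    have := congrArg (fun T : End ℂ W => T ((f ^ k) v)) L.h_f
    simp only [LinearMap.sub_apply, End.mul_apply, LinearMap.neg_apply, ih, map_smul] at this
    rw [pow_succ', End.mul_apply, eq_add_of_sub_eq this]
    push_cast
    module

theorem IsLadder.e_pow_f (L : IsLadder h e f) {μ : ℂ} {v : W} (hv : IsHighest h e μ v) (k : ℕ) :
    e ((f ^ (k + 1)) v) = ((k + 1) * (2 * μ - k)) • (f ^ k) v := by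
  induction k with
  | zero =>
    have := congrArg (fun T : End ℂ W => T v) L.e_f
    simp only [LinearMap.sub_apply, End.mul_apply, LinearMap.smul_apply, hv.h_apply, hv.e_apply,
      map_zero, sub_zero] at this
    simp [this, smul_smul]
  | succ k ih =>
    have := congrArg (fun T : End ℂ W => T ((f ^ (k + 1)) v)) L.e_f
    simp only [LinearMap.sub_apply, End.mul_apply, LinearMap.smul_apply, ih, map_smul,
      L.h_pow_f hv.h_apply] at this
    rw [pow_succ' f (k + 1), End.mul_apply, eq_add_of_sub_eq this, ← End.mul_apply, ← pow_succ']
    push_cast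
    module

theorem IsLadder.pow_e_pow_f_of_lt (L : IsLadder h e f) {μ : ℂ} {v : W} (hv : IsHighest h e μ v)
    {k K : ℕ} (hk : k < K) : (e ^ K) ((f ^ k) v) = 0 := by
  induction k generalizing K with
  | zero =>
    obtain ⟨K, rfl⟩ := Nat.exists_eq_add_of_lt hk
    rw [pow_succ, End.mul_apply]
    simp [hv.e_apply]
  | succ k ih =>
    obtain ⟨K, rfl⟩ : ∃ K', K = K' + 1 := ⟨K - 1, by omega⟩
    rw [pow_succ e, End.mul_apply, L.e_pow_f hv, map_smul, ih (by omega), smul_zero]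

theorem IsLadder.exists_pow_e_pow_f (L : IsLadder h e f) (j k : ℕ) (hk : k ≤ 2 * j) :
    ∃ c : ℂ, c ≠ 0 ∧ ∀ v, IsHighest h e j v → (e ^ k) ((f ^ k) v) = c • v := by
  induction k with
  | zero => exact ⟨1, one_ne_zero, fun v _ => by simp⟩
  | succ k ih =>
    obtain ⟨c, hc, H⟩ := ih (by omega)
    refine ⟨((k + 1) * (2 * j - k)) * c,
      mul_ne_zero (mul_ne_zero (Nat.cast_add_one_ne_zero k) ?_) hc, ?_⟩
    · rw [sub_ne_zero]
      exact_mod_cast (show 2 * j ≠ k by omega)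
    · intro v hv
      rw [pow_succ e, End.mul_apply, L.e_pow_f hv, map_smul, H v hv, smul_smul]

/-- The lowering operator annihilates the bottom of the string: otherwise its iterates would be
infinitely many eigenvectors of `h` with distinct eigenvalues. -/
theorem IsLadder.pow_f_eq_zero [FiniteDimensional ℂ W] (L : IsLadder h e f) {j : ℕ} {v : W}
    (hv : IsHighest h e j v) : (f ^ (2 * j + 1)) v = 0 := by
  by_contra hne
  set w := (f ^ (2 * j + 1)) v with hw
  have hwh : IsHighest h e (-(j + 1)) w := by
    constructor
    · rw [hw, L.h_pow_f hv.h_apply]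
      push_cast
      module
    · rw [hw, L.e_pow_f hv]
      simp
  have hnz : ∀ k : ℕ, (f ^ k) w ≠ 0 := by
    intro k
    induction k with
    | zero => simpa using hne
    | succ k ih =>
      intro h0
      have := L.e_pow_f hwh k
      rw [h0, map_zero, eq_comm, smul_eq_zero_iff_left ih] at this
      have h1 : (((k + 1) * (2 * (j + 1) + k) : ℕ) : ℂ) = 0 := by
        push_cast
        linear_combination -this
      exact (by positivity : ((k + 1) * (2 * (j + 1) + k) : ℕ) ≠ 0) (by exact_mod_cast h1)
  have hli : LinearIndependent ℂ (fun k : ℕ => (f ^ k) w) := by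
    refine End.eigenvectors_linearIndependent' h (fun k : ℕ => (-(j + 1 : ℂ)) - k) ?_ _ ?_
    · intro a b hab
      simpa using hab
    · intro k
      exact ⟨End.mem_eigenspace_iff.mpr (L.h_pow_f hwh.h_apply k), hnz k⟩
  exact not_finite_iff_infinite.mpr inferInstance (hli.finite : Finite ℕ)

/-- The strings generated by linearly independent highest weight vectors are jointly
independent: apply the power of `e` that matches the longest occurring power of `f`. -/
theorem IsLadder.linearIndependent_strings (L : IsLadder h e f) {B : Type*} [Finite B]
    (j : B → ℕ) (v : B → W) (hv : ∀ b, IsHighest h e (j b) (v b)) (hli : LinearIndependent ℂ v) :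
    LinearIndependent ℂ (fun p : Σ b : B, Fin (2 * j b + 1) => (f ^ (p.2 : ℕ)) (v p.1)) := by
  classical
  have := Fintype.ofFinite B
  rw [Fintype.linearIndependent_iff]
  intro g hg
  -- downward induction on the power of `f`
  obtain ⟨K₀, hK₀⟩ : ∃ K₀, ∀ b, 2 * j b < K₀ :=
    ⟨∑ b, (2 * j b + 1), fun b => by
      have := Finset.single_le_sum (f := fun b => 2 * j b + 1) (s := Finset.univ)
        (fun _ _ => Nat.zero_le _) (Finset.mem_univ b)
      omega⟩
  suffices H : ∀ d K, K + d = K₀ → ∀ p : Σ b : B, Fin (2 * j b + 1), K ≤ p.2 → g p = 0 from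
    fun p => H K₀ 0 (by omega) p (Nat.zero_le _)
  intro d
  induction d with
  | zero =>
    intro K hK p hp
    have := hK₀ p.1
    have := p.2.isLt
    omega
  | succ d ih =>
    intro K hK
    have ih' := ih (K + 1) (by omega)
    have key : ∑ b, (if hb : K < 2 * j b + 1 then
        g ⟨b, ⟨K, hb⟩⟩ • (e ^ K) ((f ^ K) (v b)) else 0) = 0 := by
      have h1 := congrArg (e ^ K) hg
      rw [map_zero, map_sum, Fintype.sum_sigma] at h1
      refine Eq.trans ?_ h1
      refine Finset.sum_congr rfl fun b _ => ?_
      split_ifs with hb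
      · rw [Finset.sum_eq_single (⟨K, hb⟩ : Fin (2 * j b + 1))]
        · simp
        · intro k _ hk
          have hk' : (k : ℕ) ≠ K := fun h => hk (Fin.ext h)
          rcases lt_or_gt_of_ne hk' with hlt | hgt
          · rw [map_smul, L.pow_e_pow_f_of_lt (hv b) hlt, smul_zero]
          · rw [ih' ⟨b, k⟩ hgt, zero_smul, map_zero]
        · simp
      · symm
        refine Finset.sum_eq_zero fun k _ => ?_
        have := k.isLt
        rw [map_smul, L.pow_e_pow_f_of_lt (hv b) (show (k : ℕ) < K by omega), smul_zero]
    have key2 : ∀ b, ∃ c : ℂ, (K < 2 * j b + 1 → c ≠ 0) ∧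
        (K < 2 * j b + 1 → (e ^ K) ((f ^ K) (v b)) = c • v b) := by
      intro b
      by_cases hb : K < 2 * j b + 1
      · obtain ⟨c, hc, H⟩ := L.exists_pow_e_pow_f (j b) K (by omega)
        exact ⟨c, fun _ => hc, fun _ => H _ (hv b)⟩
      · exact ⟨0, fun h => absurd h hb, fun h => absurd h hb⟩
    choose c hc hcv using key2
    have key3 : ∑ b, (if hb : K < 2 * j b + 1 then g ⟨b, ⟨K, hb⟩⟩ * c b else 0) • v b = 0 := by
      refine Eq.trans ?_ key
      refine Finset.sum_congr rfl fun b _ => ?_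
      split_ifs with hb
      · rw [hcv b hb, smul_smul]
      · simp
    rw [Fintype.linearIndependent_iff] at hli
    have key4 := hli _ key3
    rintro ⟨b, k⟩ hp
    rcases eq_or_lt_of_le hp with heq | hlt
    · have hb : K < 2 * j b + 1 := by
        have := k.isLt
        simp only at heq
        omega
      have := key4 b
      rw [dif_pos hb, mul_eq_zero] at this
      have hk : k = ⟨K, hb⟩ := Fin.ext heq.symm
      rw [hk]
      exact this.resolve_right (hc b hb)
    · exact ih' ⟨b, k⟩ hlt

end Ladder

section Content

variable {W : Type*} [AddCommGroup W] [Module ℂ W] {J : Fin 3 → End ℂ W}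

/-- The commutation relations `[J_k, J_{k+1}] = i J_{k+2}` of angular momentum operators. -/
def IsAngular (J : Fin 3 → End ℂ W) : Prop :=
  ∀ k : Fin 3, J k * J (k + 1) - J (k + 1) * J k = Complex.I • J (k + 2)

theorem IsAngular.isLadder (hJ : IsAngular J) :
    IsLadder (J 2) (J 0 + Complex.I • J 1) (J 0 - Complex.I • J 1) := by
  have h0 : J 0 * J 1 - J 1 * J 0 = Complex.I • J 2 := hJ 0
  have h1 : J 1 * J 2 - J 2 * J 1 = Complex.I • J 0 := hJ 1
  have h2 : J 2 * J 0 - J 0 * J 2 = Complex.I • J 1 := hJ 2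
  have hI : ∀ T : End ℂ W, Complex.I • Complex.I • T = -T := fun T => by
    rw [smul_smul, Complex.I_mul_I, neg_one_smul]
  constructor
  · have : J 2 * (J 0 + Complex.I • J 1) - (J 0 + Complex.I • J 1) * J 2 =
        (J 2 * J 0 - J 0 * J 2) - Complex.I • (J 1 * J 2 - J 2 * J 1) := by
      simp only [mul_add, add_mul, mul_smul_comm, smul_mul_assoc, smul_sub]
      abel
    rw [this, h1, h2, hI]
    abel
  · have : J 2 * (J 0 - Complex.I • J 1) - (J 0 - Complex.I • J 1) * J 2 =
        (J 2 * J 0 - J 0 * J 2) + Complex.I • (J 1 * J 2 - J 2 * J 1) := by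
      simp only [mul_sub, sub_mul, mul_smul_comm, smul_mul_assoc, smul_sub]
      abel
    rw [this, h1, h2, hI]
    abel
  · have : (J 0 + Complex.I • J 1) * (J 0 - Complex.I • J 1) -
        (J 0 - Complex.I • J 1) * (J 0 + Complex.I • J 1) =
        -(2 : ℂ) • Complex.I • (J 0 * J 1 - J 1 * J 0) := by
      simp only [mul_sub, sub_mul, mul_add, add_mul, mul_smul_comm, smul_mul_assoc, smul_sub]
      module
    rw [this, h0, hI]
    module

/-- A nonzero highest weight vector of weight `j` spans, together with its images under the
powers of the lowering operator, a multiplet of angular momentum `j`. -/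
theorem IsAngular.isMultiplet_span [FiniteDimensional ℂ W] (hJ : IsAngular J) {j : ℕ} {v : W}
    (hv0 : v ≠ 0) (hv : IsHighest (J 2) (J 0 + Complex.I • J 1) j v) :
    IsMultiplet J j (Submodule.span ℂ
      (Set.range fun k : Fin (2 * j + 1) => ((J 0 - Complex.I • J 1) ^ (k : ℕ)) v)) := by
  classical
  have L := hJ.isLadder
  set e := J 0 + Complex.I • J 1 with he
  set f := J 0 - Complex.I • J 1 with hf
  set U := Submodule.span ℂ (Set.range fun k : Fin (2 * j + 1) => (f ^ (k : ℕ)) v) with hU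
  have hmem : ∀ k : ℕ, (f ^ k) v ∈ U := by
    intro k
    by_cases hk : k < 2 * j + 1
    · exact Submodule.subset_span ⟨⟨k, hk⟩, rfl⟩
    · obtain ⟨d, rfl⟩ : ∃ d, k = d + (2 * j + 1) := ⟨k - (2 * j + 1), by omega⟩
      rw [pow_add, End.mul_apply, L.pow_f_eq_zero hv, map_zero]
      exact U.zero_mem
  have hstab : ∀ T : End ℂ W, (∀ k : ℕ, T ((f ^ k) v) ∈ U) → ∀ u ∈ U, T u ∈ U := by
    intro T hT u hu
    have : U ≤ U.comap T := by
      rw [hU, Submodule.span_le, ← hU]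
      rintro _ ⟨k, rfl⟩
      exact hT k
    exact this hu
  have hhU : ∀ u ∈ U, J 2 u ∈ U := hstab _ fun k => by
    rw [L.h_pow_f hv.h_apply]
    exact U.smul_mem _ (hmem k)
  have heU : ∀ u ∈ U, e u ∈ U := hstab _ fun k => by
    cases k with
    | zero => simp [hv.e_apply]
    | succ k =>
      rw [L.e_pow_f hv]
      exact U.smul_mem _ (hmem k)
  have hfU : ∀ u ∈ U, f u ∈ U := hstab _ fun k => by
    rw [← End.mul_apply, ← pow_succ']
    exact hmem _
  have hI : Complex.I * Complex.I = -1 := Complex.I_mul_I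
  have hJ0 : J 0 = (1 / 2 : ℂ) • (e + f) := by rw [he, hf]; module
  have hJ1 : J 1 = (-Complex.I / 2) • (e - f) := by
    have : (-Complex.I / 2) • (e - f) = (-(Complex.I * Complex.I)) • J 1 := by
      rw [he, hf]
      module
    rw [this, hI, neg_neg, one_smul]
  have hli := L.linearIndependent_strings (B := Unit) (fun _ => j) (fun _ => v) (fun _ => hv)
    (LinearIndependent.of_subsingleton () hv0)
  have hli' : LinearIndependent ℂ (fun k : Fin (2 * j + 1) => (f ^ (k : ℕ)) v) :=
    hli.comp (fun k => ⟨(), k⟩) (fun a b hab => by simpa using hab)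
  refine ⟨?_, ?_, ?_⟩
  · intro k u hu
    fin_cases k
    · change J 0 u ∈ U
      rw [hJ0]
      exact U.smul_mem _ (U.add_mem (heU u hu) (hfU u hu))
    · change J 1 u ∈ U
      rw [hJ1]
      exact U.smul_mem _ (U.sub_mem (heU u hu) (hfU u hu))
    · exact hhU u hu
  · intro U' hle hinv
    by_cases hbot : U' = ⊥
    · exact Or.inl hbot
    right
    have heU' : ∀ (k : ℕ), ∀ u ∈ U', (e ^ k) u ∈ U' := by
      intro k
      induction k with
      | zero => simp
      | succ k ih =>
        intro u hu
        rw [pow_succ', End.mul_apply]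
        exact U'.add_mem (hinv 0 _ (ih u hu)) (U'.smul_mem _ (hinv 1 _ (ih u hu)))
    have hfU' : ∀ (k : ℕ), ∀ u ∈ U', (f ^ k) u ∈ U' := by
      intro k
      induction k with
      | zero => simp
      | succ k ih =>
        intro u hu
        rw [pow_succ', End.mul_apply]
        exact U'.sub_mem (hinv 0 _ (ih u hu)) (U'.smul_mem _ (hinv 1 _ (ih u hu)))
    suffices hvU : v ∈ U' by
      refine le_antisymm hle ?_
      rw [hU, Submodule.span_le]
      rintro _ ⟨k, rfl⟩
      exact hfU' _ v hvU
    obtain ⟨u, hu, hu0⟩ := U'.ne_bot_iff.mp hbot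
    obtain ⟨g, hg⟩ := (Submodule.mem_span_range_iff_exists_fun ℂ).mp (hle hu)
    have hex : ∃ K : Fin (2 * j + 1), g K ≠ 0 ∧ ∀ k, K < k → g k = 0 := by
      have hne : (Finset.univ.filter fun k => g k ≠ 0).Nonempty := by
        rw [Finset.nonempty_iff_ne_empty]
        intro hemp
        apply hu0
        rw [← hg]
        refine Finset.sum_eq_zero fun k _ => ?_
        have : k ∉ Finset.univ.filter fun k => g k ≠ 0 := by rw [hemp]; simp
        simp only [Finset.mem_filter, Finset.mem_univ, true_and, not_not] at this
        rw [this, zero_smul]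
      refine ⟨_, (Finset.mem_filter.mp (Finset.max'_mem _ hne)).2, fun k hk => ?_⟩
      by_contra hgk
      exact absurd (Finset.le_max' _ k (by simpa using hgk)) (not_le.mpr hk)
    obtain ⟨K, hK, hK'⟩ := hex
    obtain ⟨c, hc, H⟩ := L.exists_pow_e_pow_f j K (by have := K.isLt; omega)
    have h1 : (e ^ (K : ℕ)) u = (g K * c) • v := by
      rw [← hg, map_sum, Finset.sum_eq_single K]
      · rw [map_smul, H v hv, smul_smul]
      · intro k _ hk
        rcases lt_or_gt_of_ne hk with hlt | hgt
        · rw [map_smul, L.pow_e_pow_f_of_lt hv hlt, smul_zero]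
        · rw [hK' k hgt, zero_smul, map_zero]
      · simp
    have h2 := heU' K u hu
    rw [h1] at h2
    exact (U'.smul_mem_iff (mul_ne_zero hK hc)).mp h2
  · rw [hU, finrank_span_eq_card hli', Fintype.card_fin]

/-- The angular momentum content of an invariant subspace `E` can be read off from the dimensions
of its weight spaces for `J₃`. Only lower bounds for the numbers of highest weight vectors are
needed, because the total dimension is exhausted by the multiplets they generate. -/
theorem IsAngular.hasAngularContent [FiniteDimensional ℂ W] (hJ : IsAngular J)
    (E : Submodule ℂ W) (hE : ∀ k, ∀ u ∈ E, J k u ∈ E) (mult : ℕ → ℕ) (n : ℕ)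
    (hn : ∀ j, n ≤ j → mult j = 0)
    (hmult : ∀ j, j < n →
      mult j + finrank ℂ (E ⊓ (J 2).eigenspace ((j + 1 : ℕ) : ℂ) : Submodule ℂ W) ≤
        finrank ℂ (E ⊓ (J 2).eigenspace (j : ℂ) : Submodule ℂ W))
    (hdim : finrank ℂ E = ∑ j ∈ Finset.range n, mult j * (2 * j + 1)) :
    HasAngularContent J E mult := by
  classical
  have L := hJ.isLadder
  set e := J 0 + Complex.I • J 1 with he
  set f := J 0 - Complex.I • J 1 with hf
  have heE : ∀ u ∈ E, e u ∈ E := fun u hu =>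
    E.add_mem (hE 0 u hu) (E.smul_mem _ (hE 1 u hu))
  have hfE : ∀ k : ℕ, ∀ u ∈ E, (f ^ k) u ∈ E := by
    intro k
    induction k with
    | zero => simp
    | succ k ih =>
      intro u hu
      rw [pow_succ', End.mul_apply]
      exact E.sub_mem (hE 0 _ (ih u hu)) (E.smul_mem _ (hE 1 _ (ih u hu)))
  -- the highest weight vectors of weight `j`: the kernel of `e` between consecutive weight spaces
  have hker : ∀ j, ∃ v : Fin (mult j) → W, LinearIndependent ℂ v ∧
      ∀ a, v a ∈ E ∧ IsHighest (J 2) e j (v a) := by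
    intro j
    rcases lt_or_ge j n with hjn | hjn
    · set A : Submodule ℂ W := E ⊓ (J 2).eigenspace (j : ℂ) with hA
      set B : Submodule ℂ W := E ⊓ (J 2).eigenspace ((j + 1 : ℕ) : ℂ) with hB
      have hAB : ∀ u ∈ A, e u ∈ B := by
        rintro u ⟨hu1, hu2⟩
        refine ⟨heE u hu1, ?_⟩
        rw [SetLike.mem_coe, End.mem_eigenspace_iff] at hu2 ⊢
        have := congrArg (fun T : End ℂ W => T u) L.h_e
        simp only [LinearMap.sub_apply, End.mul_apply, hu2, map_smul] at this
        rw [eq_add_of_sub_eq this]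
        push_cast
        module
      let T : A →ₗ[ℂ] B := e.restrict hAB
      have h1 := T.finrank_range_add_finrank_ker
      have h2 := Submodule.finrank_le (LinearMap.range T)
      have h3 : mult j + finrank ℂ B ≤ finrank ℂ A := hmult j hjn
      obtain ⟨v, hv⟩ := exists_linearIndependent_of_le_finrank (R := ℂ)
        (M := LinearMap.ker T) (n := mult j) (by omega)
      refine ⟨fun a => ((v a : A) : W), ?_, fun a => ⟨(v a : A).2.1, ?_, ?_⟩⟩
      · exact (hv.map' (LinearMap.ker T).subtype (Submodule.ker_subtype _)).map' A.subtype
          (Submodule.ker_subtype _)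
      · exact End.mem_eigenspace_iff.mp (v a : A).2.2
      · have := LinearMap.mem_ker.mp (v a).2
        exact congrArg (fun x : B => (x : W)) this
    · refine ⟨fun _ => 0, ?_, fun a => ?_⟩
      · have : IsEmpty (Fin (mult j)) := by rw [hn j hjn]; infer_instance
        exact linearIndependent_empty_type
      · exact absurd a.isLt (by have := hn j hjn; omega)
  choose v hvli hv using hker
  let w : (Σ j : ℕ, Fin (mult j)) → W := fun p => v p.1 p.2
  have hwv : ∀ p, IsHighest (J 2) e (p.1 : ℕ) (w p) := fun p => (hv p.1 p.2).2
  let i : (Σ j : ℕ, Fin (mult j)) → (Σ j : Fin n, Fin (mult j)) := fun p =>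
    ⟨⟨p.1, by
      by_contra hlt
      exact absurd p.2.isLt (by have := hn p.1 (by omega); omega)⟩, p.2⟩
  have hi : Function.Bijective i := by
    constructor
    · rintro ⟨a, b⟩ ⟨c, d⟩ h
      simp only [i, Sigma.mk.injEq, Fin.mk.injEq] at h
      obtain ⟨rfl, h⟩ := h
      simpa using h
    · rintro ⟨a, b⟩
      exact ⟨⟨a, b⟩, rfl⟩
  have hfin : Finite (Σ j : ℕ, Fin (mult j)) := Finite.of_injective i hi.1
  have hft := Fintype.ofFinite (Σ j : ℕ, Fin (mult j))
  have hwli : LinearIndependent ℂ w := by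
    rw [Fintype.linearIndependent_iff]
    intro g hg p
    let iE := Equiv.ofBijective i hi
    have h1 : ∑ j : Fin n, (∑ a : Fin (mult j), g ⟨j, a⟩ • v j a) = 0 := by
      rw [← hg, ← Fintype.sum_sigma (f := fun q : Σ j : Fin n, Fin (mult j) =>
        g ⟨q.1, q.2⟩ • v q.1 q.2)]
      exact (Fintype.sum_equiv iE _ _ fun q => rfl).symm
    have hind : iSupIndep fun j : Fin n => (J 2).eigenspace ((j : ℕ) : ℂ) :=
      (End.eigenspaces_iSupIndep (J 2)).comp
        (f := fun j : Fin n => ((j : ℕ) : ℂ)) (fun a b hab => Fin.ext (Nat.cast_injective hab))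
    have h2 := ((iSupIndep_iff_finsetSum_eq_zero_imp_eq_zero _).mp hind)
      Finset.univ
      (fun j => ∑ a : Fin (mult j), g ⟨j, a⟩ • v j a) (fun j _ => by
        refine Submodule.sum_mem _ fun a _ => Submodule.smul_mem _ _ ?_
        exact End.mem_eigenspace_iff.mpr (hv j a).2.h_apply) h1
    have h3 := h2 (i p).1 (Finset.mem_univ _)
    exact Fintype.linearIndependent_iff.mp (hvli _) _ h3 p.2
  have hS := L.linearIndependent_strings (fun p => p.1) w hwv hwli
  set s := fun p : Σ b : (Σ j : ℕ, Fin (mult j)), Fin (2 * b.1 + 1) => (f ^ (p.2 : ℕ)) (w p.1)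
    with hs
  let U : (j : ℕ) → Fin (mult j) → Submodule ℂ W := fun j a => Submodule.span ℂ
    (Set.range fun k : Fin (2 * j + 1) => (f ^ (k : ℕ)) (v j a))
  have himg : ∀ p : Σ j : ℕ, Fin (mult j),
      (Set.range fun k : Fin (2 * p.1 + 1) => (f ^ (k : ℕ)) (v p.1 p.2)) =
        s '' {q | q.1 = p} := by
    intro p
    ext x
    constructor
    · rintro ⟨k, rfl⟩
      exact ⟨⟨p, k⟩, rfl, rfl⟩
    · rintro ⟨⟨q, k⟩, rfl, rfl⟩
      exact ⟨k, rfl⟩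
  have hUs : ∀ p : Σ j : ℕ, Fin (mult j), U p.1 p.2 = Submodule.span ℂ (s '' {q | q.1 = p}) :=
    fun p => by rw [← himg p]
  refine ⟨U, ?_, ?_, ?_⟩
  · intro j a
    exact hJ.isMultiplet_span ((hvli j).ne_zero a) (hv j a).2
  · intro p
    simp only [hUs]
    have : (⨆ q, ⨆ (_ : q ≠ p), Submodule.span ℂ (s '' {r | r.1 = q})) =
        Submodule.span ℂ (s '' {r | r.1 ≠ p}) := by
      simp only [← Submodule.span_iUnion, ← Set.image_iUnion]
      congr 2
      ext r
      simp
    rw [this]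
    refine hS.disjoint_span_image ?_
    rw [Set.disjoint_left]
    intro r hr hr'
    exact hr' hr
  · have h1 : (⨆ p : Σ j : ℕ, Fin (mult j), U p.1 p.2) = Submodule.span ℂ (Set.range s) := by
      simp only [hUs, ← Submodule.span_iUnion, ← Set.image_iUnion]
      rw [← Set.image_univ]
      congr 2
      ext r
      simp
    rw [h1]
    refine Submodule.eq_of_le_of_finrank_eq ?_ ?_
    · rw [Submodule.span_le]
      rintro _ ⟨p, rfl⟩
      exact hfE _ _ (hv p.1.1 p.1.2).1
    · rw [finrank_span_eq_card hS, hdim, Fintype.card_sigma]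
      simp only [Fintype.card_fin]
      have h4 : ∑ x : (Σ j : ℕ, Fin (mult j)), (2 * x.1 + 1) =
          ∑ x : (Σ j : Fin n, Fin (mult j)), (2 * (x.1 : ℕ) + 1) :=
        Fintype.sum_equiv (Equiv.ofBijective i hi) _ _ fun q => rfl
      rw [h4, Fintype.sum_sigma, Finset.sum_range]
      simp

end Content

/-! ### Uniqueness of simple highest weight modules -/

section HighestWeight

variable {n : ℕ} {X Y : Type*} [AddCommGroup X] [Module ℂ X] [AddCommGroup Y] [Module ℂ Y]

/-- The super-bracket relations of `gl(1|n)` for a family of operators, without a grading of the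
space on which they act. -/
def IsBracket (e : Fin (n + 1) → Fin (n + 1) → End ℂ X) : Prop :=
  ∀ i j k l : Fin (n + 1),
    e i j * e k l - weylSign i j k l • (e k l * e i j) =
      (if j = k then e i l else 0) - weylSign i j k l • (if i = l then e k j else 0)

/-- A vector of weight `Λ` that is annihilated by all `e i j` with `i < j`. -/
def IsHighestWeightVector (e : Fin (n + 1) → Fin (n + 1) → End ℂ X) (Λ : Fin (n + 1) → ℂ)
    (x : X) : Prop :=
  (∀ i j, i < j → e i j x = 0) ∧ ∀ i, e i i x = Λ i • x

/-- A subspace that is mapped into itself by all `e i j`. -/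
def IsInvariant (e : Fin (n + 1) → Fin (n + 1) → End ℂ X) (U : Submodule ℂ X) : Prop :=
  ∀ i j, ∀ u ∈ U, e i j u ∈ U

theorem weylSign_self (i k l : Fin (n + 1)) : weylSign i i k l = 1 := by
  simp [weylSign, weylDeg]

/-- The height operator `-∑ i • e i i`: it commutes with the diagonal operators, and `e k l` shifts
its eigenvalues by `l - k`. -/
def heightOp (e : Fin (n + 1) → Fin (n + 1) → End ℂ X) : End ℂ X :=
  ∑ i : Fin (n + 1), (-((i : ℕ) : ℂ)) • e i i

variable {e : Fin (n + 1) → Fin (n + 1) → End ℂ X} {Λ : Fin (n + 1) → ℂ} {x : X}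

theorem IsBracket.heightOp_apply (he : IsBracket e) (k l : Fin (n + 1)) (y : X) :
    heightOp e (e k l y) =
      e k l (heightOp e y) + (((l : ℕ) : ℂ) - ((k : ℕ) : ℂ)) • e k l y := by
  have h1 : ∀ i, e i i (e k l y) = e k l (e i i y) + (if i = k then e i l y else 0) -
      (if i = l then e k i y else 0) := by
    intro i
    have := congrArg (fun T : End ℂ X => T y) (he i i k l)
    simp only [weylSign_self, one_smul, LinearMap.sub_apply, End.mul_apply] at this
    rw [eq_add_of_sub_eq this]
    split_ifs <;> (try simp only [LinearMap.zero_apply]) <;> abel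
  simp only [heightOp, LinearMap.sum_apply, LinearMap.smul_apply, h1, map_sum, map_smul]
  simp only [smul_sub, smul_add, Finset.sum_sub_distrib, Finset.sum_add_distrib, smul_ite,
    smul_zero, Finset.sum_ite_eq', Finset.mem_univ, if_true]
  module

theorem IsBracket.map_mem_eigenspace (he : IsBracket e) {c : ℂ} {y : X}
    (hy : y ∈ (heightOp e).eigenspace c) {k l : Fin (n + 1)} :
    e k l y ∈ (heightOp e).eigenspace (c + (((l : ℕ) : ℂ) - ((k : ℕ) : ℂ))) := by
  rw [End.mem_eigenspace_iff] at hy ⊢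
  rw [he.heightOp_apply, hy, map_smul]
  module

theorem IsHighestWeightVector.heightOp_apply (hx : IsHighestWeightVector e Λ x) :
    heightOp e x = (∑ i : Fin (n + 1), (-((i : ℕ) : ℂ)) * Λ i) • x := by
  simp only [heightOp, LinearMap.sum_apply, LinearMap.smul_apply, hx.2, smul_smul,
    Finset.sum_smul]

/-- The span of the images of `x` under products of at most `m` lowering operators. -/
def lowerings (e : Fin (n + 1) → Fin (n + 1) → End ℂ X) (x : X) : ℕ → Submodule ℂ X
  | 0 => Submodule.span ℂ {x}
  | m + 1 => lowerings e x m ⊔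
      ⨆ p : {p : Fin (n + 1) × Fin (n + 1) // p.2 < p.1}, (lowerings e x m).map (e p.1.1 p.1.2)

theorem lowerings_le_succ (m : ℕ) : lowerings e x m ≤ lowerings e x (m + 1) := le_sup_left

theorem map_mem_lowerings_succ {m : ℕ} {y : X} (hy : y ∈ lowerings e x m) {k l : Fin (n + 1)}
    (hkl : l < k) : e k l y ∈ lowerings e x (m + 1) :=
  le_sup_right (a := lowerings e x m) (Submodule.mem_iSup_of_mem
    (p := fun p : {p : Fin (n + 1) × Fin (n + 1) // p.2 < p.1} =>
      (lowerings e x m).map (e p.1.1 p.1.2)) ⟨(k, l), hkl⟩ (Submodule.mem_map_of_mem hy))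

/-- To control a subspace containing the successor stage it suffices to control the images under
single lowering operators. -/
theorem lowerings_succ_le {m : ℕ} {S : Submodule ℂ X} (h : lowerings e x m ≤ S)
    (h' : ∀ k l, l < k → ∀ y ∈ lowerings e x m, e k l y ∈ S) : lowerings e x (m + 1) ≤ S := by
  refine sup_le h (iSup_le fun p => ?_)
  rintro _ ⟨y, hy, rfl⟩
  exact h' _ _ p.2 y hy

/-- Raising and diagonal operators do not lengthen words in the lowering operators. -/
theorem IsHighestWeightVector.map_mem_lowerings (hx : IsHighestWeightVector e Λ x)
    (he : IsBracket e) (m : ℕ) :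
    ∀ i j, i ≤ j → ∀ y ∈ lowerings e x m, e i j y ∈ lowerings e x m := by
  induction m with
  | zero =>
    intro i j hij y hy
    obtain ⟨c, rfl⟩ := Submodule.mem_span_singleton.mp hy
    rw [map_smul]
    refine Submodule.smul_mem _ _ ?_
    rcases eq_or_lt_of_le hij with rfl | hlt
    · rw [hx.2]
      exact Submodule.smul_mem _ _ (Submodule.mem_span_singleton_self x)
    · rw [hx.1 _ _ hlt]
      exact Submodule.zero_mem _
  | succ m ih =>
    have hall : ∀ i j, ∀ y ∈ lowerings e x m, e i j y ∈ lowerings e x (m + 1) := by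
      intro i j y hy
      rcases le_or_gt i j with hij | hij
      · exact lowerings_le_succ m (ih i j hij y hy)
      · exact map_mem_lowerings_succ hy hij
    intro i j hij
    have : lowerings e x (m + 1) ≤ (lowerings e x (m + 1)).comap (e i j) := by
      refine lowerings_succ_le (fun y hy => hall i j y hy) fun k l hkl y hy => ?_
      rw [Submodule.mem_comap]
      have hb := congrArg (fun T : End ℂ X => T y) (he i j k l)
      simp only [LinearMap.sub_apply, End.mul_apply, LinearMap.smul_apply] at hb
      rw [eq_add_of_sub_eq hb]
      refine Submodule.add_mem _ (Submodule.sub_mem _ ?_ (Submodule.smul_mem _ _ ?_))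
        (Submodule.smul_mem _ _ (map_mem_lowerings_succ (ih i j hij y hy) hkl))
      · split_ifs
        · exact hall _ _ y hy
        · simp
      · split_ifs
        · exact hall _ _ y hy
        · simp
    exact fun y hy => this hy

/-- The submodule generated by a highest weight vector. -/
def cyclic (e : Fin (n + 1) → Fin (n + 1) → End ℂ X) (x : X) : Submodule ℂ X :=
  ⨆ m, lowerings e x m

theorem mem_cyclic_iff {y : X} : y ∈ cyclic e x ↔ ∃ m, y ∈ lowerings e x m :=
  Submodule.mem_iSup_of_directed _ (monotone_nat_of_le_succ lowerings_le_succ).directed_le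

theorem mem_cyclic_self : x ∈ cyclic e x :=
  mem_cyclic_iff.mpr ⟨0, Submodule.mem_span_singleton_self x⟩

theorem IsHighestWeightVector.isInvariant_cyclic (hx : IsHighestWeightVector e Λ x)
    (he : IsBracket e) : IsInvariant e (cyclic e x) := by
  intro i j y hy
  obtain ⟨m, hm⟩ := mem_cyclic_iff.mp hy
  rw [mem_cyclic_iff]
  rcases le_or_gt i j with hij | hij
  · exact ⟨m, hx.map_mem_lowerings he m i j hij y hm⟩
  · exact ⟨m + 1, map_mem_lowerings_succ hm hij⟩

theorem cyclic_le {U : Submodule ℂ X} (hU : IsInvariant e U) (hx : x ∈ U) : cyclic e x ≤ U := by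
  refine iSup_le fun m => ?_
  induction m with
  | zero => exact (Submodule.span_singleton_le_iff_mem x U).mpr hx
  | succ m ih => exact lowerings_succ_le ih fun k l _ y hy => hU k l y (ih hy)

/-- The sum of the eigenspaces of the height operator strictly below height `c`. -/
def below (e : Fin (n + 1) → Fin (n + 1) → End ℂ X) (c : ℂ) : Submodule ℂ X :=
  ⨆ k : ℕ, (heightOp e).eigenspace (c - (k + 1))

theorem disjoint_below (c : ℂ) : Disjoint ((heightOp e).eigenspace c) (below e c) := by
  refine ((heightOp e).eigenspaces_iSupIndep c).mono_right (iSup_le fun k => ?_)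
  refine le_iSup₂_of_le (c - (k + 1)) ?_ le_rfl
  rw [Ne, sub_eq_self]
  exact Nat.cast_add_one_ne_zero k

theorem IsHighestWeightVector.eq_zero_of_mem_below (hx : IsHighestWeightVector e Λ x)
    (hx0 : x ≠ 0) {a : ℂ} {w : X}
    (hw : w ∈ below e (∑ i : Fin (n + 1), (-((i : ℕ) : ℂ)) * Λ i)) (h0 : a • x + w = 0) :
    a = 0 := by
  have h1 : a • x ∈ (heightOp e).eigenspace (∑ i : Fin (n + 1), (-((i : ℕ) : ℂ)) * Λ i) :=
    Submodule.smul_mem _ _ (End.mem_eigenspace_iff.mpr hx.heightOp_apply)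
  have h2 : a • x ∈ below e (∑ i : Fin (n + 1), (-((i : ℕ) : ℂ)) * Λ i) := by
    rw [eq_neg_of_add_eq_zero_left h0]
    exact Submodule.neg_mem _ hw
  have h3 := (disjoint_below (e := e) _).le_bot ⟨h1, h2⟩
  exact (smul_eq_zero.mp ((Submodule.mem_bot ℂ).mp h3)).resolve_right hx0

/-- Up to multiples of the highest weight vector itself, the generated submodule lies strictly
below the highest weight. -/
theorem IsHighestWeightVector.cyclic_le_sup (hx : IsHighestWeightVector e Λ x)
    (he : IsBracket e) :
    cyclic e x ≤ Submodule.span ℂ {x} ⊔ below e (∑ i : Fin (n + 1), (-((i : ℕ) : ℂ)) * Λ i) := by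
  set c := ∑ i : Fin (n + 1), (-((i : ℕ) : ℂ)) * Λ i with hc
  refine iSup_le fun m => ?_
  induction m with
  | zero => exact le_sup_left
  | succ m ih =>
    refine lowerings_succ_le ih fun k l hkl y hy => ?_
    obtain ⟨d, hd⟩ : ∃ d : ℕ, (k : ℕ) = l + (d + 1) := ⟨k - l - 1, by
      have : (l : ℕ) < k := hkl
      omega⟩
    obtain ⟨_, hu, z, hz, rfl⟩ := Submodule.mem_sup.mp (ih hy)
    obtain ⟨a, rfl⟩ := Submodule.mem_span_singleton.mp hu
    rw [map_add, map_smul]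
    refine le_sup_right (a := Submodule.span ℂ {x})
      (Submodule.add_mem _ (Submodule.smul_mem _ a ?_) ?_)
    · have h1 := he.map_mem_eigenspace (k := k) (l := l)
        (End.mem_eigenspace_iff.mpr hx.heightOp_apply)
      refine Submodule.mem_iSup_of_mem d ?_
      convert h1 using 2
      rw [hd]
      push_cast
      ring
    · have : below e c ≤ (below e c).comap (e k l) := by
        refine iSup_le fun r w hw => ?_
        refine Submodule.mem_iSup_of_mem (r + (d + 1)) ?_
        convert he.map_mem_eigenspace (k := k) (l := l) hw using 2
        rw [hd]
        push_cast
        ring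
      exact this hz

end HighestWeight

section Grading

variable {n : ℕ} {W : Type*} [AddCommGroup W] [Module ℂ W]

/-- The grading involution: `1` on even vectors and `-1` on odd vectors. -/
noncomputable def GLModule.invol (ρ : GLModule n W) : End ℂ W :=
  LinearMap.ofIsCompl ρ.isCompl_gr (ρ.gr 0).subtype (-(ρ.gr 1).subtype)

theorem GLModule.invol_zero (ρ : GLModule n W) {v : W} (hv : v ∈ ρ.gr 0) : ρ.invol v = v :=
  LinearMap.ofIsCompl_apply_left ρ.isCompl_gr ⟨v, hv⟩

theorem GLModule.invol_one (ρ : GLModule n W) {v : W} (hv : v ∈ ρ.gr 1) : ρ.invol v = -v :=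
  LinearMap.ofIsCompl_apply_right ρ.isCompl_gr ⟨v, hv⟩

theorem GLModule.exists_add (ρ : GLModule n W) (v : W) :
    ∃ a ∈ ρ.gr 0, ∃ b ∈ ρ.gr 1, a + b = v :=
  Submodule.mem_sup.mp (ρ.isCompl_gr.sup_eq_top ▸ Submodule.mem_top)

theorem GLModule.invol_invol (ρ : GLModule n W) (v : W) : ρ.invol (ρ.invol v) = v := by
  obtain ⟨a, ha, b, hb, rfl⟩ := ρ.exists_add v
  simp [ρ.invol_zero ha, ρ.invol_one hb]

/-- The involution commutes or anticommutes with each `e i j`. -/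
theorem GLModule.exists_invol_e (ρ : GLModule n W) (i j : Fin (n + 1)) :
    ∃ s : ℂ, ∀ v, ρ.invol (ρ.e i j v) = s • ρ.e i j (ρ.invol v) := by
  have h0 := ρ.e_mem_gr i j 0
  have h1 := ρ.e_mem_gr i j 1
  by_cases hd : (i = 0 ↔ j = 0)
  · simp only [weylDeg, hd, if_true, Nat.cast_zero, add_zero] at h0 h1
    refine ⟨1, fun v => ?_⟩
    obtain ⟨a, ha, b, hb, rfl⟩ := ρ.exists_add v
    simp [ρ.invol_zero ha, ρ.invol_one hb, ρ.invol_zero (h0 a ha), ρ.invol_one (h1 b hb)]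
  · simp only [weylDeg, hd, if_false, Nat.cast_one, zero_add] at h0 h1
    have h11 : (1 + 1 : ZMod 2) = 0 := by decide
    rw [h11] at h1
    refine ⟨-1, fun v => ?_⟩
    obtain ⟨a, ha, b, hb, rfl⟩ := ρ.exists_add v
    simp [ρ.invol_zero ha, ρ.invol_one hb, ρ.invol_one (h0 a ha), ρ.invol_zero (h1 b hb)]

theorem GLModule.eq_sup_of_invol (ρ : GLModule n W) (U : Submodule ℂ W)
    (hU : ∀ u ∈ U, ρ.invol u ∈ U) : U = (U ⊓ ρ.gr 0) ⊔ (U ⊓ ρ.gr 1) := by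
  refine le_antisymm (fun u hu => ?_) (sup_le inf_le_left inf_le_left)
  obtain ⟨a, ha, b, hb, rfl⟩ := ρ.exists_add u
  have h := hU _ hu
  rw [map_add, ρ.invol_zero ha, ρ.invol_one hb] at h
  have haU : a ∈ U := by
    have := U.smul_mem (1 / 2 : ℂ) (U.add_mem hu h)
    convert this using 1
    module
  have hbU : b ∈ U := by
    have := U.sub_mem hu haU
    rwa [add_sub_cancel_left] at this
  exact Submodule.add_mem_sup ⟨haU, ha⟩ ⟨hbU, hb⟩

/-- A highest weight vector may be taken homogeneous: if `σ` is the grading involution, one of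
`v + σ v` and `v - σ v` is nonzero. -/
theorem GLModule.HasHighestWeight.exists_homogeneous {ρ : GLModule n W} {Λ : Fin (n + 1) → ℂ}
    (h : ρ.HasHighestWeight Λ) :
    ∃ v : W, v ≠ 0 ∧ IsHighestWeightVector ρ.e Λ v ∧ ∃ s : ℂ, ρ.invol v = s • v := by
  obtain ⟨v, hv0, hv1, hv2⟩ := h
  have hσ : ∀ i j, i < j → ρ.e i j (ρ.invol v) = 0 := by
    intro i j hij
    obtain ⟨s, hs⟩ := ρ.exists_invol_e i j
    have h1 := congrArg ρ.invol (hs (ρ.invol v))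
    rw [ρ.invol_invol, ρ.invol_invol, hv1 i j hij, smul_zero, map_zero] at h1
    exact h1
  have hσ2 : ∀ i, ρ.e i i (ρ.invol v) = Λ i • ρ.invol v := by
    intro i
    obtain ⟨a, ha, b, hb, rfl⟩ := ρ.exists_add v
    have h0 : ρ.e i i a ∈ ρ.gr 0 := by simpa [weylDeg] using ρ.e_mem_gr i i 0 a ha
    have h1 : ρ.e i i b ∈ ρ.gr 1 := by simpa [weylDeg] using ρ.e_mem_gr i i 1 b hb
    have h2 := congrArg ρ.invol (hv2 i)
    rw [map_add, map_add, map_smul, ρ.invol_zero h0, ρ.invol_one h1] at h2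
    rw [← h2, map_add, ρ.invol_zero ha, ρ.invol_one hb, map_add, map_neg]
  have key : ∀ s : ℂ, s * s = 1 →
      IsHighestWeightVector ρ.e Λ (v + s • ρ.invol v) ∧
        ρ.invol (v + s • ρ.invol v) = s • (v + s • ρ.invol v) := by
    intro s hs
    refine ⟨⟨fun i j hij => ?_, fun i => ?_⟩, ?_⟩
    · rw [map_add, map_smul, hv1 i j hij, hσ i j hij, smul_zero, add_zero]
    · rw [map_add, map_smul, hv2, hσ2]
      module
    · rw [map_add, map_smul, ρ.invol_invol, smul_add, smul_smul, hs, one_smul, add_comm]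
  by_cases hp : v + (1 : ℂ) • ρ.invol v = 0
  · refine ⟨v + (-1 : ℂ) • ρ.invol v, fun hm => hv0 ?_, (key (-1) (by norm_num)).1, -1,
      (key (-1) (by norm_num)).2⟩
    have : v = (1 / 2 : ℂ) •
        ((v + (1 : ℂ) • ρ.invol v) + (v + (-1 : ℂ) • ρ.invol v)) := by module
    rw [this, hp, hm, add_zero, smul_zero]
  · exact ⟨_, hp, (key 1 (by norm_num)).1, 1, (key 1 (by norm_num)).2⟩

/-- A simple module is generated by any homogeneous highest weight vector. -/
theorem GLModule.IsSimple.cyclic_eq_top {ρ : GLModule n W} (hρ : ρ.IsSimple)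
    {Λ : Fin (n + 1) → ℂ} {v : W} (hv0 : v ≠ 0) (hv : IsHighestWeightVector ρ.e Λ v) {s : ℂ}
    (hs : ρ.invol v = s • v) : cyclic ρ.e v = ⊤ := by
  have hσ : ∀ m, lowerings ρ.e v m ≤ (lowerings ρ.e v m).comap ρ.invol := by
    intro m
    induction m with
    | zero =>
      refine (Submodule.span_singleton_le_iff_mem _ _).mpr ?_
      rw [Submodule.mem_comap, hs]
      exact Submodule.smul_mem _ _ (Submodule.mem_span_singleton_self v)
    | succ m ih =>
      refine lowerings_succ_le (fun y hy => lowerings_le_succ m (ih hy)) fun k l hkl y hy => ?_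
      obtain ⟨s, hs⟩ := ρ.exists_invol_e k l
      rw [Submodule.mem_comap, hs]
      exact Submodule.smul_mem _ _ (map_mem_lowerings_succ (ih hy) hkl)
  refine (hρ.2 _ (hv.isInvariant_cyclic ρ.bracket) (ρ.eq_sup_of_invol _ ?_)).resolve_left ?_
  · intro u hu
    obtain ⟨m, hm⟩ := mem_cyclic_iff.mp hu
    exact mem_cyclic_iff.mpr ⟨m, hσ m hm⟩
  · intro hbot
    have h1 : v ∈ cyclic ρ.e v := mem_cyclic_self
    rw [hbot] at h1
    exact hv0 ((Submodule.mem_bot ℂ).mp h1)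

/-- In a simple module, the only invariant subspace strictly below the highest weight is zero,
whether or not that subspace is graded: its sum with its mirror image is graded. -/
theorem GLModule.IsSimple.eq_bot_of_le_below {ρ : GLModule n W} (hρ : ρ.IsSimple) {c : ℂ} {v : W}
    (hv0 : v ≠ 0) (hvc : heightOp ρ.e v = c • v) {K : Submodule ℂ W} (hK : IsInvariant ρ.e K)
    (hKc : K ≤ below ρ.e c) : K = ⊥ := by
  have hcomm : ∀ y, ρ.invol (heightOp ρ.e y) = heightOp ρ.e (ρ.invol y) := by
    intro y
    simp only [heightOp, LinearMap.sum_apply, map_sum, LinearMap.smul_apply, map_smul]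
    refine Finset.sum_congr rfl fun i _ => ?_
    congr 1
    obtain ⟨a, ha, b, hb, rfl⟩ := ρ.exists_add y
    have h0 : ρ.e i i a ∈ ρ.gr 0 := by simpa [weylDeg] using ρ.e_mem_gr i i 0 a ha
    have h1 : ρ.e i i b ∈ ρ.gr 1 := by simpa [weylDeg] using ρ.e_mem_gr i i 1 b hb
    simp [ρ.invol_zero ha, ρ.invol_one hb, ρ.invol_zero h0, ρ.invol_one h1]
  have hbelow : below ρ.e c ≤ (below ρ.e c).comap ρ.invol := by
    refine iSup_le fun k y hy => Submodule.mem_iSup_of_mem k ?_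
    rw [End.mem_eigenspace_iff] at hy ⊢
    rw [← hcomm, hy, map_smul]
  have hKσ : K.map ρ.invol ≤ below ρ.e c := by
    rintro _ ⟨y, hy, rfl⟩
    exact hbelow (hKc hy)
  have hsup : K ⊔ K.map ρ.invol = ⊥ := by
    refine (hρ.2 _ ?_ (ρ.eq_sup_of_invol _ ?_)).resolve_right ?_
    · intro i j u hu
      obtain ⟨a, ha, _, ⟨b, hb, rfl⟩, rfl⟩ := Submodule.mem_sup.mp hu
      rw [map_add]
      refine Submodule.add_mem_sup (hK i j a ha) ?_
      obtain ⟨s, hs⟩ := ρ.exists_invol_e i j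
      have h1 := congrArg ρ.invol (hs (ρ.invol b))
      rw [ρ.invol_invol, ρ.invol_invol, map_smul] at h1
      rw [h1]
      exact Submodule.smul_mem _ _ (Submodule.mem_map_of_mem (hK i j b hb))
    · intro u hu
      obtain ⟨a, ha, _, ⟨b, hb, rfl⟩, rfl⟩ := Submodule.mem_sup.mp hu
      rw [map_add, ρ.invol_invol, add_comm]
      exact Submodule.add_mem_sup hb (Submodule.mem_map_of_mem ha)
    · intro htop
      have h1 : v ∈ below ρ.e c := sup_le hKc hKσ (htop ▸ Submodule.mem_top)
      exact hv0 ((disjoint_below (e := ρ.e) c).le_bot ⟨End.mem_eigenspace_iff.mpr hvc, h1⟩)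
  exact le_bot_iff.mp (hsup ▸ le_sup_left)

end Grading

section Uniqueness

variable {n : ℕ} {W T : Type*} [AddCommGroup W] [Module ℂ W] [AddCommGroup T] [Module ℂ T]

theorem mem_below_of_prodMap {e : Fin (n + 1) → Fin (n + 1) → End ℂ W}
    {e' : Fin (n + 1) → Fin (n + 1) → End ℂ T} {c : ℂ} {p : W × T}
    (hp : p ∈ below (fun i j => (e i j).prodMap (e' i j)) c) :
    p.1 ∈ below e c ∧ p.2 ∈ below e' c := by
  have hh : ∀ q : W × T, heightOp (fun i j => (e i j).prodMap (e' i j)) q =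
      (heightOp e q.1, heightOp e' q.2) := by
    intro q
    simp only [heightOp, LinearMap.sum_apply, LinearMap.smul_apply]
    ext
    · simp [Prod.fst_sum]
    · simp [Prod.snd_sum]
  have : below (fun i j => (e i j).prodMap (e' i j)) c ≤ (below e c).prod (below e' c) := by
    refine iSup_le fun k q hq => ?_
    rw [End.mem_eigenspace_iff, hh] at hq
    have h1 := congrArg Prod.fst hq
    have h2 := congrArg Prod.snd hq
    exact ⟨Submodule.mem_iSup_of_mem k (End.mem_eigenspace_iff.mpr h1),
      Submodule.mem_iSup_of_mem k (End.mem_eigenspace_iff.mpr h2)⟩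
  exact this hp

/-- Simple modules are determined by their highest weight: the submodule of the product generated
by the pair of highest weight vectors is the graph of an isomorphism. -/
theorem GLModule.IsSimple.exists_intertwiner {ρ : GLModule n W} (hρ : ρ.IsSimple)
    {Λ : Fin (n + 1) → ℂ} (hΛ : ρ.HasHighestWeight Λ)
    {e' : Fin (n + 1) → Fin (n + 1) → End ℂ T} (he' : IsBracket e') {M : Submodule ℂ T}
    (hM : IsInvariant e' M)
    (hirr : ∀ U : Submodule ℂ T, U ≤ M → IsInvariant e' U → U = ⊥ ∨ U = M)
    {t : T} (htM : t ∈ M) (ht0 : t ≠ 0) (ht : IsHighestWeightVector e' Λ t) :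
    ∃ φ : W →ₗ[ℂ] T, Function.Injective φ ∧ LinearMap.range φ = M ∧
      ∀ i j w, φ (ρ.e i j w) = e' i j (φ w) := by
  obtain ⟨v, hv0, hv, s, hs⟩ := hΛ.exists_homogeneous
  set E : Fin (n + 1) → Fin (n + 1) → End ℂ (W × T) := fun i j => (ρ.e i j).prodMap (e' i j)
    with hE
  have hEb : IsBracket E := by
    intro i j k l
    have h1 := ρ.bracket i j k l
    have h2 := he' i j k l
    refine LinearMap.ext fun p => ?_
    have h3 := congrArg (fun S : End ℂ W => S p.1) h1
    have h4 := congrArg (fun S : End ℂ T => S p.2) h2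
    ext
    · simp only [hE]
      refine Eq.trans ?_ (h3.trans ?_)
      · simp
      · split_ifs <;> simp
    · simp only [hE]
      refine Eq.trans ?_ (h4.trans ?_)
      · simp
      · split_ifs <;> simp
  have hx : IsHighestWeightVector E Λ (v, t) := by
    refine ⟨fun i j hij => ?_, fun i => ?_⟩
    · simp [hE, hv.1 i j hij, ht.1 i j hij]
    · simp [hE, hv.2 i, ht.2 i]
  set U := cyclic E (v, t) with hU
  have hUinv : IsInvariant E U := hx.isInvariant_cyclic hEb
  have hUM : ∀ p ∈ U, p.2 ∈ M := by
    have : U ≤ (⊤ : Submodule ℂ W).prod M :=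
      cyclic_le (fun i j p hp => ⟨trivial, hM i j _ hp.2⟩) ⟨trivial, htM⟩
    exact fun p hp => (this hp).2
  -- an element of `U` with a vanishing component has its other component below the top
  set c := ∑ i : Fin (n + 1), (-((i : ℕ) : ℂ)) * Λ i with hc
  have hsplit : ∀ p ∈ U, ∃ a : ℂ, ∃ w ∈ below ρ.e c, ∃ u ∈ below e' c,
      p = (a • v + w, a • t + u) := by
    intro p hp
    obtain ⟨_, hq, r, hr, rfl⟩ := Submodule.mem_sup.mp (hx.cyclic_le_sup hEb hp)
    obtain ⟨a, rfl⟩ := Submodule.mem_span_singleton.mp hq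
    exact ⟨a, r.1, (mem_below_of_prodMap hr).1, r.2, (mem_below_of_prodMap hr).2, rfl⟩
  have hker2 : ∀ w : W, (w, (0 : T)) ∈ U → w = 0 := by
    have : U.comap (LinearMap.inl ℂ W T) = ⊥ := by
      refine hρ.eq_bot_of_le_below hv0 hv.heightOp_apply ?_ ?_
      · intro i j w hw
        simpa [hE] using hUinv i j _ hw
      · intro w hw
        obtain ⟨a, y, hy, u, hu, hp⟩ := hsplit _ hw
        simp only [LinearMap.inl_apply, Prod.mk.injEq] at hp
        rw [hp.1, ht.eq_zero_of_mem_below ht0 hu hp.2.symm, zero_smul, zero_add]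
        exact hy
    intro w hw
    have h1 : w ∈ U.comap (LinearMap.inl ℂ W T) := hw
    rwa [this, Submodule.mem_bot] at h1
  have hker1 : ∀ u : T, ((0 : W), u) ∈ U → u = 0 := by
    have : U.comap (LinearMap.inr ℂ W T) = ⊥ := by
      refine (hirr _ (fun u hu => hUM _ hu) ?_).resolve_right ?_
      · intro i j w hw
        simpa [hE] using hUinv i j _ hw
      · intro hMeq
        have h1 : t ∈ U.comap (LinearMap.inr ℂ W T) := hMeq ▸ htM
        obtain ⟨a, y, hy, u, hu, hp⟩ := hsplit _ h1
        simp only [LinearMap.inr_apply, Prod.mk.injEq] at hp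
        have ha : a = 0 := hv.eq_zero_of_mem_below hv0 hy hp.1.symm
        simp only [ha, zero_smul, zero_add] at hp
        have := ht.eq_zero_of_mem_below ht0 (a := -1) hu (by rw [neg_one_smul, ← hp.2]; simp)
        norm_num at this
    intro w hw
    have h1 : w ∈ U.comap (LinearMap.inr ℂ W T) := hw
    rwa [this, Submodule.mem_bot] at h1
  -- both projections of `U` are bijective onto the simple modules
  let p₁ : U →ₗ[ℂ] W := (LinearMap.fst ℂ W T).comp U.subtype
  let p₂ : U →ₗ[ℂ] T := (LinearMap.snd ℂ W T).comp U.subtype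
  have hp₁inj : Function.Injective p₁ := by
    rw [← LinearMap.ker_eq_bot, LinearMap.ker_eq_bot']
    rintro ⟨⟨w, u⟩, hm⟩ h0
    have hw : w = 0 := h0
    subst hw
    have := hker1 u hm
    subst this
    rfl
  have hp₂inj : Function.Injective p₂ := by
    rw [← LinearMap.ker_eq_bot, LinearMap.ker_eq_bot']
    rintro ⟨⟨w, u⟩, hm⟩ h0
    have hw : u = 0 := h0
    subst hw
    have := hker2 w hm
    subst this
    rfl
  have hmem : (v, t) ∈ U := mem_cyclic_self
  have hp₁surj : Function.Surjective p₁ := by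
    have h1 : cyclic ρ.e v ≤ U.map (LinearMap.fst ℂ W T) := by
      refine cyclic_le ?_ ⟨(v, t), hmem, rfl⟩
      rintro i j _ ⟨q, hq, rfl⟩
      exact ⟨E i j q, hUinv i j q hq, rfl⟩
    rw [hρ.cyclic_eq_top hv0 hv hs] at h1
    intro w
    obtain ⟨q, hq, rfl⟩ := h1 (x := w) trivial
    exact ⟨⟨q, hq⟩, rfl⟩
  let ψ := LinearEquiv.ofBijective p₁ ⟨hp₁inj, hp₁surj⟩
  refine ⟨p₂.comp (ψ.symm : W →ₗ[ℂ] U), ?_, ?_, ?_⟩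
  · exact hp₂inj.comp ψ.symm.injective
  · have h1 : LinearMap.range (p₂.comp (ψ.symm : W →ₗ[ℂ] U)) = U.map (LinearMap.snd ℂ W T) := by
      rw [LinearMap.range_comp, LinearEquiv.range, Submodule.map_top, LinearMap.range_comp,
        Submodule.range_subtype]
    rw [h1]
    refine (hirr _ ?_ ?_).resolve_left ?_
    · rintro _ ⟨q, hq, rfl⟩
      exact hUM q hq
    · rintro i j _ ⟨q, hq, rfl⟩
      exact ⟨E i j q, hUinv i j q hq, rfl⟩
    · intro hbot
      have h2 : t ∈ U.map (LinearMap.snd ℂ W T) := ⟨(v, t), hmem, rfl⟩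
      rw [hbot, Submodule.mem_bot] at h2
      exact ht0 h2
  · intro i j w
    obtain ⟨u, rfl⟩ := ψ.surjective w
    have h1 : ρ.e i j (ψ u) = ψ ⟨E i j u, hUinv i j u u.2⟩ := rfl
    rw [h1]
    simp only [LinearMap.comp_apply, LinearEquiv.coe_coe, LinearEquiv.symm_apply_apply]
    rfl

end Uniqueness

/-! ### The third tensor power of the defining superspace -/

section Model

variable {ι : Type} [Fintype ι] [DecidableEq ι]

/-- The scalar functions on triples of basis labels, that is the third tensor power of the
superspace `ℂ^{1|ι}` in coordinates. The label `none` is even, all others are odd. -/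
abbrev Cube (ι : Type) : Type := Option ι × Option ι × Option ι → ℂ

/-- The sign of a basis label. -/
def sgn (a : Option ι) : ℂ := if a = none then 1 else -1

/-- The degree of the matrix unit with labels `a`, `b`. -/
def deg (a b : Option ι) : ℕ := if (a = none ↔ b = none) then 0 else 1

/-- The `d`-th power of the parity operator. -/
def par (d : ℕ) : Matrix (Option ι) (Option ι) ℂ := Matrix.diagonal fun a => sgn a ^ d

/-- The tensor product of three operators. -/
def tri (A B C : Matrix (Option ι) (Option ι) ℂ) :
    Matrix (Option ι × Option ι × Option ι) (Option ι × Option ι × Option ι) ℂ :=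
  A ⊗ₖ (B ⊗ₖ C)

theorem tri_mul (A B C A' B' C' : Matrix (Option ι) (Option ι) ℂ) :
    tri A B C * tri A' B' C' = tri (A * A') (B * B') (C * C') := by
  simp [tri, Matrix.mul_kronecker_mul]

theorem tri_one : tri (1 : Matrix (Option ι) (Option ι) ℂ) 1 1 = 1 := by
  simp [tri]

theorem tri_smul₁ (r : ℂ) (A B C : Matrix (Option ι) (Option ι) ℂ) :
    tri (r • A) B C = r • tri A B C := by
  simp [tri, Matrix.smul_kronecker]

theorem tri_smul₂ (r : ℂ) (A B C : Matrix (Option ι) (Option ι) ℂ) :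
    tri A (r • B) C = r • tri A B C := by
  simp [tri, Matrix.smul_kronecker, Matrix.kronecker_smul]

theorem tri_smul₃ (r : ℂ) (A B C : Matrix (Option ι) (Option ι) ℂ) :
    tri A B (r • C) = r • tri A B C := by
  simp [tri, Matrix.kronecker_smul]

theorem tri_conjTranspose (A B C : Matrix (Option ι) (Option ι) ℂ) :
    (tri A B C).conjTranspose = tri A.conjTranspose B.conjTranspose C.conjTranspose := by
  simp [tri, Matrix.conjTranspose_kronecker]

theorem tri_mulVec (A B C : Matrix (Option ι) (Option ι) ℂ) (f : Cube ι)
    (a b c : Option ι) :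
    (tri A B C).mulVec f (a, b, c) =
      ∑ a', ∑ b', ∑ c', A a a' * (B b b' * C c c') * f (a', b', c') := by
  simp only [tri, Matrix.mulVec, dotProduct, Fintype.sum_prod_type, Matrix.kroneckerMap_apply]

/-- The matrix unit with labels `i`, `j` acting on the third tensor power by the graded Leibniz
rule. -/
def superUnit (i j : Option ι) :
    Matrix (Option ι × Option ι × Option ι) (Option ι × Option ι × Option ι) ℂ :=
  tri (Matrix.single i j 1) 1 1 + tri (par (deg i j)) (Matrix.single i j 1) 1 +
    tri (par (deg i j)) (par (deg i j)) (Matrix.single i j 1)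

theorem superUnit_mulVec (i j : Option ι) (f : Cube ι) (a b c : Option ι) :
    (superUnit i j).mulVec f (a, b, c) =
      (if a = i then f (j, b, c) else 0) + (if b = i then sgn a ^ deg i j * f (a, j, c) else 0) +
        (if c = i then sgn a ^ deg i j * sgn b ^ deg i j * f (a, b, j) else 0) := by
  simp only [superUnit, Matrix.add_mulVec, Pi.add_apply, tri_mulVec, par]
  congr 1
  · congr 1
    · rw [Finset.sum_eq_single j, Finset.sum_eq_single b, Finset.sum_eq_single c] <;>
        simp +contextual [Matrix.single_apply, Matrix.one_apply, eq_comm]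
    · rw [Finset.sum_eq_single a, Finset.sum_eq_single j, Finset.sum_eq_single c] <;>
        simp +contextual [Matrix.single_apply, Matrix.one_apply, eq_comm]
  · rw [Finset.sum_eq_single a, Finset.sum_eq_single b, Finset.sum_eq_single j] <;>
      simp +contextual [Matrix.single_apply, Matrix.diagonal_apply, eq_comm]

theorem sgn_mul_self (a : Option ι) : sgn a * sgn a = 1 := by
  unfold sgn; split_ifs <;> norm_num

theorem sgn_eq (a b : Option ι) : sgn a = (-1) ^ deg a b * sgn b := by
  rcases a with _ | a <;> rcases b with _ | b <;> simp [sgn, deg]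

theorem deg_comm (a b : Option ι) : deg a b = deg b a := by
  unfold deg; simp only [iff_comm]

theorem par_mul (d d' : ℕ) : (par d * par d' : Matrix (Option ι) (Option ι) ℂ) = par (d + d') := by
  simp [par, Matrix.diagonal_mul_diagonal, pow_add]

theorem par_deg (a b c : Option ι) :
    (par (deg a b + deg b c) : Matrix (Option ι) (Option ι) ℂ) = par (deg a c) := by
  have h2 : ∀ x : Option ι, sgn x ^ 2 = 1 := fun x => by rw [pow_two, sgn_mul_self]
  rcases a with _ | a <;> rcases b with _ | b <;> rcases c with _ | c <;> simp [par, deg, h2]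

theorem par_mul_single (d : ℕ) (i j : Option ι) :
    par d * Matrix.single i j 1 =
      ((-1 : ℂ) ^ (deg i j * d)) • (Matrix.single i j 1 * par d) := by
  ext a b
  simp only [par, Matrix.diagonal_mul, Matrix.mul_diagonal, Matrix.smul_apply, smul_eq_mul,
    Matrix.single_apply]
  split_ifs with h
  · rw [← h.1, ← h.2, sgn_eq i j, mul_pow, ← pow_mul]
    ring
  · simp

theorem superUnit_bracket (i j k l : Option ι) :
    superUnit i j * superUnit k l -
        ((-1 : ℂ) ^ (deg i j * deg k l)) • (superUnit k l * superUnit i j) =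
      (if j = k then superUnit i l else 0) -
        ((-1 : ℂ) ^ (deg i j * deg k l)) • (if i = l then superUnit k j else 0) := by
  set s : ℂ := (-1 : ℂ) ^ (deg i j * deg k l) with hs
  have hss : s * s = 1 := by rw [hs, ← pow_add, ← two_mul, pow_mul]; norm_num
  set E : Matrix (Option ι) (Option ι) ℂ := Matrix.single i j 1 with hE
  set F : Matrix (Option ι) (Option ι) ℂ := Matrix.single k l 1 with hF
  set P : Matrix (Option ι) (Option ι) ℂ := par (deg i j) with hP
  set Q : Matrix (Option ι) (Option ι) ℂ := par (deg k l) with hQ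
  have hPF : P * F = s • (F * P) := by rw [hP, hF, par_mul_single, mul_comm (deg k l)]
  have hQE : Q * E = s • (E * Q) := by rw [hQ, hE, par_mul_single]
  have hQP : Q * P = P * Q := by rw [hP, hQ, par_mul, par_mul, add_comm]
  have hEF : E * F = if j = k then Matrix.single i l 1 else 0 := by
    split_ifs with h
    · rw [hE, hF, h, Matrix.single_mul_single_same, mul_one]
    · exact Matrix.single_mul_single_of_ne (h := h) ..
  have hFE : F * E = if i = l then Matrix.single k j 1 else 0 := by
    split_ifs with h
    · rw [hE, hF, h, Matrix.single_mul_single_same, mul_one]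
    · exact Matrix.single_mul_single_of_ne (h := Ne.symm h) ..
  have hz₁ : ∀ B C : Matrix (Option ι) (Option ι) ℂ, tri 0 B C = 0 := fun B C => by simp [tri]
  have hz₂ : ∀ B C : Matrix (Option ι) (Option ι) ℂ, tri B 0 C = 0 := fun B C => by simp [tri]
  have hz₃ : ∀ B C : Matrix (Option ι) (Option ι) ℂ, tri B C 0 = 0 := fun B C => by simp [tri]
  -- the mixed terms cancel because odd operators in different factors anticommute
  have h1 : superUnit i j * superUnit k l - s • (superUnit k l * superUnit i j) =
      (tri (E * F) 1 1 + tri (P * Q) (E * F) 1 + tri (P * Q) (P * Q) (E * F)) -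
        s • (tri (F * E) 1 1 + tri (P * Q) (F * E) 1 + tri (P * Q) (P * Q) (F * E)) := by
    simp only [superUnit, ← hE, ← hF, ← hP, ← hQ, mul_add, add_mul, tri_mul, one_mul, mul_one,
      hPF, hQE, hQP, tri_smul₁, tri_smul₂, smul_add, smul_smul, hss, one_smul]
    abel
  rw [h1, hEF, hFE]
  congr 1
  · split_ifs with h
    · subst h
      rw [superUnit, hP, hQ, par_mul, par_deg]
    · simp [hz₁, hz₂, hz₃]
  · congr 1
    split_ifs with h
    · subst h
      rw [superUnit, hP, hQ, par_mul, add_comm (deg i j), par_deg]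
    · simp [hz₁, hz₂, hz₃]

theorem superUnit_conjTranspose (i j : Option ι) :
    (superUnit i j).conjTranspose = superUnit j i := by
  have hp : ∀ d, (par d : Matrix (Option ι) (Option ι) ℂ).conjTranspose = par d := by
    intro d
    rw [par, Matrix.diagonal_conjTranspose]
    congr 1
    ext a
    simp only [Pi.star_apply, star_pow]
    congr 1
    unfold sgn
    split_ifs <;> simp
  simp [superUnit, tri_conjTranspose, hp, Matrix.conjTranspose_single, deg_comm i j]

/-- The Koszul sign of moving the factor labelled `c` past the factors labelled `a` and `b`. -/
def koszul (c a b : Option ι) : ℂ := if c ≠ none ∧ ¬(a = none ↔ b = none) then -1 else 1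

/-- The cyclic permutation of the three tensor factors, with its Koszul signs. -/
def shift : End ℂ (Cube ι) where
  toFun f := fun x => koszul x.2.2 x.1 x.2.1 * f (x.2.2, x.1, x.2.1)
  map_add' f g := by ext; simp [mul_add]
  map_smul' r f := by ext; simp [mul_left_comm]

@[simp]
theorem shift_apply (f : Cube ι) (a b c : Option ι) :
    shift f (a, b, c) = koszul c a b * f (c, a, b) := rfl

theorem shift_superUnit (i j : Option ι) (f : Cube ι) :
    shift ((superUnit i j).mulVec f) = (superUnit i j).mulVec (shift f) := by
  ext ⟨a, b, c⟩
  simp only [shift_apply, superUnit_mulVec]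
  have h1 : a = i → koszul c a b * sgn c ^ deg i j = koszul c j b := by
    rintro rfl
    rcases a with _ | a <;> rcases j with _ | j <;> rcases b with _ | b <;>
      rcases c with _ | c <;> simp [koszul, sgn, deg]
  have h2 : b = i → koszul c a b * (sgn c ^ deg i j * sgn a ^ deg i j) =
      sgn a ^ deg i j * koszul c a j := by
    rintro rfl
    rcases a with _ | a <;> rcases j with _ | j <;> rcases b with _ | b <;>
      rcases c with _ | c <;> simp [koszul, sgn, deg]
  have h3 : c = i → koszul c a b = sgn a ^ deg i j * sgn b ^ deg i j * koszul j a b := by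
    rintro rfl
    rcases a with _ | a <;> rcases j with _ | j <;> rcases b with _ | b <;>
      rcases c with _ | c <;> simp [koszul, sgn, deg]
  have t1 : koszul c a b * (if c = i then f (j, a, b) else 0) =
      if c = i then sgn a ^ deg i j * sgn b ^ deg i j * (koszul j a b * f (j, a, b)) else 0 := by
    split_ifs with h
    · rw [h3 h]; ring
    · simp
  have t2 : koszul c a b * (if a = i then sgn c ^ deg i j * f (c, j, b) else 0) =
      if a = i then koszul c j b * f (c, j, b) else 0 := by
    split_ifs with h
    · rw [← h1 h]; ring
    · simp
  have t3 : koszul c a b * (if b = i then sgn c ^ deg i j * sgn a ^ deg i j * f (c, a, j) else 0) =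
      if b = i then sgn a ^ deg i j * (koszul c a j * f (c, a, j)) else 0 := by
    split_ifs with h
    · rw [← mul_assoc, h2 h]; ring
    · simp
  rw [mul_add, mul_add, t1, t2, t3]
  ring

end Model

/-! ### The twisted part of the third tensor power -/

section Twisted

variable {ι : Type} [Fintype ι] [DecidableEq ι] {ζ : ℂ}

/-- The operator of the matrix unit with labels `i`, `j` on the third tensor power. -/
def unitOp (i j : Option ι) : End ℂ (Cube ι) := Matrix.toLinAlgEquiv' (superUnit i j)

theorem unitOp_apply (i j : Option ι) (f : Cube ι) : unitOp i j f = (superUnit i j).mulVec f := by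
  simp [unitOp]

theorem unitOp_diag (i : Option ι) (f : Cube ι) (a b c : Option ι) :
    unitOp i i f (a, b, c) =
      ((if a = i then 1 else 0) + (if b = i then 1 else 0) + (if c = i then 1 else 0)) *
        f (a, b, c) := by
  simp only [unitOp_apply, superUnit_mulVec, deg, if_true, pow_zero, one_mul, add_mul, ite_mul,
    zero_mul]
  congr 1
  · congr 1 <;> split_ifs with h <;> simp [h]
  · split_ifs with h <;> simp [h]

/-- The eigenspace of the signed cyclic permutation for the eigenvalue `ζ`. For a primitive cube
root of unity `ζ` this is the Schur functor of the partition `(2,1)`: the cyclic permutation has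
eigenvalue `1` on the symmetric and antisymmetric parts and each primitive cube root of unity is
an eigenvalue of multiplicity one on the Specht module of `(2,1)`. -/
def twisted (ι : Type) (ζ : ℂ) : Submodule ℂ (Cube ι) := End.eigenspace shift ζ

theorem mem_twisted_iff {f : Cube ι} :
    f ∈ twisted ι ζ ↔ ∀ a b c, koszul c a b * f (c, a, b) = ζ * f (a, b, c) := by
  rw [twisted, End.mem_eigenspace_iff]
  constructor
  · intro h a b c
    exact congrFun h (a, b, c)
  · intro h
    ext ⟨a, b, c⟩
    exact h a b c

theorem unitOp_mem_twisted (i j : Option ι) {f : Cube ι} (hf : f ∈ twisted ι ζ) :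
    unitOp i j f ∈ twisted ι ζ := by
  rw [twisted, End.mem_eigenspace_iff] at hf ⊢
  rw [unitOp_apply, shift_superUnit, hf, Matrix.mulVec_smul]

theorem koszul_ne_zero (c a b : Option ι) : koszul c a b ≠ 0 := by
  unfold koszul; split_ifs <;> norm_num

theorem apply_rotate_eq_zero {f : Cube ι} (hf : f ∈ twisted ι ζ) {a b c : Option ι}
    (h : f (a, b, c) = 0) : f (c, a, b) = 0 := by
  have := mem_twisted_iff.mp hf a b c
  rw [h, mul_zero] at this
  exact (mul_eq_zero.mp this).resolve_left (koszul_ne_zero c a b)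

theorem apply_diag_eq_zero (hζ : ζ ≠ 1) {f : Cube ι} (hf : f ∈ twisted ι ζ) (a : Option ι) :
    f (a, a, a) = 0 := by
  have := mem_twisted_iff.mp hf a a a
  simp only [koszul, not_true, and_false, if_false, one_mul] at this
  have h2 : (1 - ζ) * f (a, a, a) = 0 := by linear_combination this
  exact (mul_eq_zero.mp h2).resolve_left (sub_ne_zero.mpr (Ne.symm hζ))

theorem ne_one_of_root (hζ : ζ ^ 2 + ζ + 1 = 0) : ζ ≠ 1 := by
  rintro rfl; norm_num at hζ

theorem cube_of_root (hζ : ζ ^ 2 + ζ + 1 = 0) : ζ ^ 3 = 1 := by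
  linear_combination (ζ - 1) * hζ

theorem shift_cubed (f : Cube ι) : shift (shift (shift f)) = f := by
  ext ⟨a, b, c⟩
  simp only [shift_apply, ← mul_assoc]
  have : koszul c a b * koszul b c a * koszul a b c = 1 := by
    rcases a with _ | a <;> rcases b with _ | b <;> rcases c with _ | c <;> simp [koszul]
  rw [this, one_mul]

/-- The projector onto the `ζ`-eigenspace of the cyclic permutation. -/
noncomputable def twistProj (ι : Type) (ζ : ℂ) : End ℂ (Cube ι) :=
  (1 / 3 : ℂ) • (1 + ζ ^ 2 • shift + ζ • shift * shift)

theorem twistProj_mem (hζ : ζ ^ 2 + ζ + 1 = 0) (f : Cube ι) : twistProj ι ζ f ∈ twisted ι ζ := by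
  rw [twisted, End.mem_eigenspace_iff]
  simp only [twistProj, LinearMap.smul_apply, LinearMap.add_apply, End.one_apply, End.mul_apply,
    map_smul, map_add, shift_cubed, smul_add, smul_smul]
  have h1 : ζ * (1 / 3 * ζ ^ 2) = 1 / 3 := by linear_combination (1 / 3) * cube_of_root hζ
  have h2 : ζ * (1 / 3 * ζ) = 1 / 3 * ζ ^ 2 := by ring
  have h3 : ζ * (1 / 3) = 1 / 3 * ζ := by ring
  rw [h1, h2, h3]
  abel

theorem twistProj_eq (hζ : ζ ^ 2 + ζ + 1 = 0) {f : Cube ι} (hf : f ∈ twisted ι ζ) :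
    twistProj ι ζ f = f := by
  rw [twisted, End.mem_eigenspace_iff] at hf
  simp only [twistProj, LinearMap.smul_apply, LinearMap.add_apply, End.one_apply, End.mul_apply,
    map_smul, hf, smul_add, smul_smul]
  rw [← add_smul, ← add_smul]
  convert one_smul ℂ f using 2
  linear_combination (2 / 3 : ℂ) * cube_of_root hζ

/-- Invariance of a property of triples under rotation. -/
def RotInvariant (X : Option ι × Option ι × Option ι → Prop) : Prop :=
  ∀ a b c, X (c, a, b) ↔ X (a, b, c)

/-- The functions in the twisted part that are supported on `X`. -/
def twistedOn (ζ : ℂ) (X : Option ι × Option ι × Option ι → Prop) : Submodule ℂ (Cube ι) where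
  carrier := {f | f ∈ twisted ι ζ ∧ ∀ x, ¬ X x → f x = 0}
  add_mem' := fun {f g} hf hg => ⟨Submodule.add_mem _ hf.1 hg.1, fun x hx => by
    simp [hf.2 x hx, hg.2 x hx]⟩
  zero_mem' := ⟨Submodule.zero_mem _, fun _ _ => rfl⟩
  smul_mem' := fun r f hf => ⟨Submodule.smul_mem _ r hf.1, fun x hx => by simp [hf.2 x hx]⟩

open Classical in
/-- Cutting off a function outside `X`. -/
noncomputable def cutoff (X : Option ι × Option ι × Option ι → Prop) : End ℂ (Cube ι) where
  toFun f := fun x => if X x then f x else 0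
  map_add' f g := by ext x; by_cases h : X x <;> simp [h]
  map_smul' r f := by ext x; by_cases h : X x <;> simp [h]

open Classical in
theorem cutoff_apply (X : Option ι × Option ι × Option ι → Prop) (f : Cube ι)
    (x : Option ι × Option ι × Option ι) : cutoff X f x = if X x then f x else 0 := rfl

theorem cutoff_mem_twistedOn {X : Option ι × Option ι × Option ι → Prop} (hX : RotInvariant X)
    {f : Cube ι} (hf : f ∈ twisted ι ζ) : cutoff X f ∈ twistedOn ζ X := by
  refine ⟨mem_twisted_iff.mpr fun a b c => ?_, fun x hx => by simp [cutoff_apply, hx]⟩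
  by_cases h : X (a, b, c)
  · simpa [cutoff_apply, hX a b c, h] using mem_twisted_iff.mp hf a b c
  · simp [cutoff_apply, hX a b c, h]

theorem shift_apply_eq_zero {X : Option ι × Option ι × Option ι → Prop} (hX : RotInvariant X)
    {f : Cube ι} (hf : ∀ x, ¬ X x → f x = 0) : ∀ x, ¬ X x → shift f x = 0 := by
  rintro ⟨a, b, c⟩ hx
  rw [shift_apply, hf _ (by rwa [hX]), mul_zero]

theorem twistProj_mem_twistedOn (hζ : ζ ^ 2 + ζ + 1 = 0)
    {X : Option ι × Option ι × Option ι → Prop} (hX : RotInvariant X)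
    {f : Cube ι} (hf : ∀ x, ¬ X x → f x = 0) : twistProj ι ζ f ∈ twistedOn ζ X := by
  refine ⟨twistProj_mem hζ f, fun x hx => ?_⟩
  have h1 := shift_apply_eq_zero hX hf
  have h2 := shift_apply_eq_zero hX h1
  simp [twistProj, hf x hx, h1 x hx, h2 x hx]

/-- The cyclic group of order three acts freely off the diagonal, and on the constant triples the
eigenvalue `ζ` does not occur. So the dimension is a third of the number of nonconstant
triples; it is computed as the trace of a projector. -/
theorem finrank_twistedOn (hζ : ζ ^ 2 + ζ + 1 = 0) (X : Option ι × Option ι × Option ι → Prop)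
    [DecidablePred X] (hX : RotInvariant X) :
    3 * finrank ℂ (twistedOn ζ X) + (Finset.univ.filter fun a : Option ι => X (a, a, a)).card =
      (Finset.univ.filter X).card := by
  classical
  set p : End ℂ (Cube ι) := twistProj ι ζ * cutoff X with hp
  have hproj : LinearMap.IsProj (twistedOn ζ X) p := by
    refine ⟨fun f => ?_, fun f hf => ?_⟩
    · exact twistProj_mem_twistedOn hζ hX fun x hx => by simp [cutoff_apply, hx]
    · have h1 : cutoff X f = f := by
        ext x
        rw [cutoff_apply]
        split_ifs with h
        · rfl
        · exact (hf.2 x h).symm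
      rw [hp, End.mul_apply, h1, twistProj_eq hζ hf.1]
  have h1 := hproj.trace
  rw [LinearMap.trace_eq_matrix_trace ℂ (Pi.basisFun ℂ _), Matrix.trace] at h1
  have h2 : ∀ x : Option ι × Option ι × Option ι,
      (LinearMap.toMatrix (Pi.basisFun ℂ _) (Pi.basisFun ℂ _) p).diag x =
        (1 / 3 : ℂ) * (if X x then 1 else 0) +
          (1 / 3 : ℂ) * (ζ ^ 2 + ζ) * (if X x ∧ x.2.2 = x.1 ∧ x.1 = x.2.1 then 1 else 0) := by
    rintro ⟨a, b, c⟩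
    rw [Matrix.diag_apply, LinearMap.toMatrix_apply, Pi.basisFun_repr, Pi.basisFun_apply]
    have h3 : cutoff X (Pi.single (a, b, c) 1) =
        if X (a, b, c) then Pi.single (a, b, c) 1 else 0 := by
      ext x
      rw [cutoff_apply]
      by_cases hx : x = (a, b, c)
      · subst hx
        split_ifs <;> simp
      · split_ifs <;> simp [hx]
    rw [hp, End.mul_apply, h3]
    by_cases hXx : X (a, b, c)
    · simp only [hXx, if_true, true_and, twistProj, LinearMap.smul_apply, LinearMap.add_apply,
        End.one_apply, End.mul_apply, Pi.smul_apply, Pi.add_apply, shift_apply, smul_eq_mul,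
        Pi.single_eq_same, Pi.single_apply, Prod.mk.injEq]
      by_cases hd : c = a ∧ a = b
      · obtain ⟨rfl, rfl⟩ := hd
        simp [koszul]
        ring
      · have e1 : ¬ (c = a ∧ a = b ∧ b = c) := fun h => hd ⟨h.1, h.2.1⟩
        have e2 : ¬ (b = a ∧ c = b ∧ a = c) := fun h => hd ⟨h.2.2.symm, h.1.symm⟩
        simp [e1, e2, hd]
    · simp [hXx]
  rw [Finset.sum_congr rfl fun x _ => h2 x, Finset.sum_add_distrib, ← Finset.mul_sum,
    ← Finset.mul_sum, Finset.sum_boole, Finset.sum_boole] at h1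
  have h4 : (Finset.univ.filter fun x : Option ι × Option ι × Option ι =>
      X x ∧ x.2.2 = x.1 ∧ x.1 = x.2.1).card =
      (Finset.univ.filter fun a : Option ι => X (a, a, a)).card := by
    refine (Finset.card_bij (fun a _ => (a, a, a)) ?_ ?_ ?_).symm
    · intro a ha
      simpa using ha
    · intro a _ b _ h
      exact (Prod.mk.inj h).1
    · rintro ⟨a, b, c⟩ h
      simp only [Finset.mem_filter, Finset.mem_univ, true_and] at h
      obtain ⟨hx, rfl, rfl⟩ := h
      exact ⟨_, by simpa using hx, rfl⟩
  rw [h4] at h1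
  have h5 : ((3 * finrank ℂ (twistedOn ζ X) +
      (Finset.univ.filter fun a : Option ι => X (a, a, a)).card : ℕ) : ℂ) =
      ((Finset.univ.filter X).card : ℂ) := by
    push_cast
    linear_combination (-3 : ℂ) * h1 +
      (((Finset.univ.filter fun a : Option ι => X (a, a, a)).card : ℕ) : ℂ) * hζ
  exact_mod_cast h5

/-- For every nonconstant triple there is a function in the twisted part that is supported on its
orbit and has value `1` at the triple. -/
noncomputable def orbitVec (ζ : ℂ) (a b c : Option ι) : Cube ι :=
  (3 : ℂ) • twistProj ι ζ (Pi.single (a, b, c) 1)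

theorem orbitVec_mem (hζ : ζ ^ 2 + ζ + 1 = 0) (a b c : Option ι) :
    orbitVec ζ a b c ∈ twisted ι ζ :=
  Submodule.smul_mem _ _ (twistProj_mem hζ _)

theorem orbitVec_self (a b c : Option ι) (h : ¬ (c = a ∧ a = b)) :
    orbitVec ζ a b c (a, b, c) = 1 := by
  have e1 : ¬ (c = a ∧ a = b ∧ b = c) := fun h' => h ⟨h'.1, h'.2.1⟩
  have e2 : ¬ (b = a ∧ c = b ∧ a = c) := fun h' => h ⟨h'.2.2.symm, h'.1.symm⟩
  simp [orbitVec, twistProj, e1, e2]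

theorem orbitVec_support {a b c : Option ι} {x : Option ι × Option ι × Option ι}
    (h : orbitVec ζ a b c x ≠ 0) : x = (a, b, c) ∨ x = (b, c, a) ∨ x = (c, a, b) := by
  by_contra hx
  push Not at hx
  obtain ⟨h1, h2, h3⟩ := hx
  apply h
  obtain ⟨u, v, w⟩ := x
  simp only [ne_eq, Prod.mk.injEq] at h1 h2 h3
  have e2 : ¬ (w = a ∧ u = b ∧ v = c) := fun h => h2 ⟨h.2.1, h.2.2, h.1⟩
  have e3 : ¬ (v = a ∧ w = b ∧ u = c) := fun h => h3 ⟨h.2.2, h.1, h.2.1⟩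
  simp [orbitVec, twistProj, h1, e2, e3]

end Twisted

section Irreducible

variable {ι : Type} [Fintype ι] [DecidableEq ι] {ζ : ℂ} {n : ℕ}

/-- The operators `e i j` of `gl(1|n)` on the third tensor power, for a labelling of the basis. -/
def cubeOp (φ : Fin (n + 1) ≃ Option ι) (i j : Fin (n + 1)) : End ℂ (Cube ι) :=
  unitOp (φ i) (φ j)

theorem weylDeg_eq {φ : Fin (n + 1) ≃ Option ι} (hφ : φ 0 = none) (i j : Fin (n + 1)) :
    weylDeg i j = deg (φ i) (φ j) := by
  simp only [weylDeg, deg, ← hφ, φ.injective.eq_iff]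

theorem isBracket_cubeOp {φ : Fin (n + 1) ≃ Option ι} (hφ : φ 0 = none) :
    IsBracket (cubeOp φ) := by
  intro i j k l
  have h := congrArg Matrix.toLinAlgEquiv' (superUnit_bracket (φ i) (φ j) (φ k) (φ l))
  simp only [map_sub, map_mul, map_smul, apply_ite Matrix.toLinAlgEquiv', map_zero,
    φ.injective.eq_iff] at h
  simp only [weylSign, weylDeg_eq hφ]
  exact h

theorem isInvariant_twisted (φ : Fin (n + 1) ≃ Option ι) :
    IsInvariant (cubeOp φ) (twisted ι ζ) :=
  fun _ _ _ hu => unitOp_mem_twisted _ _ hu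

/-- The highest weight vector of the twisted part. -/
noncomputable def topVec (φ : Fin (n + 1) ≃ Option ι) (ζ : ℂ) : Cube ι := orbitVec ζ none none (φ 1)

theorem one_ne_zero_fin (hn : 1 ≤ n) : (1 : Fin (n + 1)) ≠ 0 := by
  intro h
  have := congrArg Fin.val h
  rw [Fin.val_one', Fin.val_zero, Nat.mod_eq_of_lt (by omega)] at this
  omega

theorem topVec_apply {φ : Fin (n + 1) ≃ Option ι} (hφ : φ 0 = none) (hn : 1 ≤ n) :
    topVec φ ζ (none, none, φ 1) = 1 := by
  refine orbitVec_self _ _ _ fun h => one_ne_zero_fin hn (φ.injective ?_)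
  rw [h.1, hφ]

theorem topVec_isHighestWeightVector {φ : Fin (n + 1) ≃ Option ι} (hφ : φ 0 = none)
    (hζ : ζ ^ 2 + ζ + 1 = 0) (hn : 1 ≤ n) :
    IsHighestWeightVector (cubeOp φ) (weight21 n) (topVec φ ζ) := by
  have h10 := one_ne_zero_fin hn
  refine ⟨fun i j hij => ?_, fun i => ?_⟩
  · -- raising can only produce the constant triple of even labels, where twisted functions vanish
    have hmem : cubeOp φ i j (topVec φ ζ) ∈ twisted ι ζ :=
      unitOp_mem_twisted _ _ (orbitVec_mem hζ _ _ _)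
    have hj0 : φ j ≠ none := by
      rw [← hφ, Ne, φ.injective.eq_iff]
      rintro rfl
      exact absurd hij (Fin.not_lt_zero i)
    have hj1 : φ j = φ 1 → φ i = none := by
      intro h
      rw [φ.injective.eq_iff] at h
      subst h
      rw [← hφ]
      congr 1
      apply Fin.ext
      have : (i : ℕ) < (1 : Fin (n + 1)) := hij
      rw [Fin.val_one', Nat.mod_eq_of_lt (by omega)] at this
      simpa using this
    ext ⟨a, b, c⟩
    by_cases hd : a = none ∧ b = none ∧ c = none
    · obtain ⟨rfl, rfl, rfl⟩ := hd
      exact apply_diag_eq_zero (ne_one_of_root hζ) hmem none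
    · have hT : ∀ x, topVec φ ζ x ≠ 0 → x = (none, none, φ 1) ∨ x = (none, φ 1, none) ∨
          x = (φ 1, none, none) := fun x hx => orbitVec_support hx
      have t1 : a = φ i → topVec φ ζ (φ j, b, c) = 0 := by
        intro ha
        by_contra hne
        have := hT _ hne
        simp only [Prod.mk.injEq, hj0, false_and, false_or] at this
        exact hd ⟨by rw [ha, hj1 this.1], this.2.1, this.2.2⟩
      have t2 : b = φ i → topVec φ ζ (a, φ j, c) = 0 := by
        intro ha
        by_contra hne
        have := hT _ hne
        simp only [Prod.mk.injEq, hj0, false_and, and_false, false_or, or_false] at this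
        exact hd ⟨this.1, by rw [ha, hj1 this.2.1], this.2.2⟩
      have t3 : c = φ i → topVec φ ζ (a, b, φ j) = 0 := by
        intro ha
        by_contra hne
        have := hT _ hne
        simp only [Prod.mk.injEq, hj0, and_false, or_false] at this
        exact hd ⟨this.1, this.2.1, by rw [ha, hj1 this.2.2]⟩
      rw [cubeOp, unitOp_apply, superUnit_mulVec]
      have s1 : (if a = φ i then topVec φ ζ (φ j, b, c) else 0) = 0 := by
        split_ifs with h
        · exact t1 h
        · rfl
      have s2 : (if b = φ i then sgn a ^ deg (φ i) (φ j) * topVec φ ζ (a, φ j, c) else 0) = 0 := by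
        split_ifs with h
        · rw [t2 h, mul_zero]
        · rfl
      have s3 : (if c = φ i then sgn a ^ deg (φ i) (φ j) * sgn b ^ deg (φ i) (φ j) *
          topVec φ ζ (a, b, φ j) else 0) = 0 := by
        split_ifs with h
        · rw [t3 h, mul_zero]
        · rfl
      rw [s1, s2, s3]
      simp
  · ext ⟨a, b, c⟩
    rw [cubeOp, unitOp_diag, Pi.smul_apply, smul_eq_mul]
    by_cases h0 : topVec φ ζ (a, b, c) = 0
    · rw [h0, mul_zero, mul_zero]
    · congr 1
      have hi0 : (none = φ i) ↔ i = 0 := by rw [← hφ, φ.injective.eq_iff, eq_comm]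
      have hi1 : (φ 1 = φ i) ↔ i = 1 := by rw [φ.injective.eq_iff, eq_comm]
      have hw : weight21 n i = (if i = 0 then 2 else if i = 1 then 1 else 0) := by
        have e0 : ((i : ℕ) = 0) ↔ i = 0 := by rw [Fin.ext_iff]; simp
        have e1 : ((i : ℕ) = 1) ↔ i = 1 := by
          rw [Fin.ext_iff, Fin.val_one', Nat.mod_eq_of_lt (by omega)]
        simp only [weight21, e0, e1]
      rw [hw]
      have hsplit : i = 0 ∨ i = 1 ∨ (i ≠ 0 ∧ i ≠ 1) := by tauto
      rcases orbitVec_support h0 with h | h | h <;>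
        simp only [Prod.mk.injEq] at h <;> obtain ⟨rfl, rfl, rfl⟩ := h <;>
        simp only [hi0, hi1] <;>
        rcases hsplit with rfl | rfl | ⟨h2, h3⟩ <;> simp_all <;> norm_num

/-- A vector of the twisted part that is annihilated by all raising operators is determined by its
coefficient at the leading triple. -/
theorem eq_zero_of_raising {φ : Fin (n + 1) ≃ Option ι} (hφ : φ 0 = none)
    (hζ : ζ ^ 2 + ζ + 1 = 0) (hn : 1 ≤ n) {f : Cube ι} (hf : f ∈ twisted ι ζ)
    (hr : ∀ i j, i < j → cubeOp φ i j f = 0) (h1 : f (none, none, φ 1) = 0) : f = 0 := by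
  have hpos : ∀ s : ι, 0 < φ.symm (some s) := by
    intro s
    rw [Fin.pos_iff_ne_zero]
    intro h
    have := congrArg φ h
    simp [hφ] at this
  -- the raising operators from odd labels to the even one
  have e0 : ∀ (s : ι) (b c : Option ι), f (some s, b, c) + (if b = none then f (none, some s, c)
      else 0) + (if c = none then sgn b * f (none, b, some s) else 0) = 0 := by
    intro s b c
    have := congrFun (hr 0 (φ.symm (some s)) (hpos s)) (none, b, c)
    rw [cubeOp, unitOp_apply, superUnit_mulVec] at this
    simpa [hφ, deg, sgn] using this
  -- the coefficients at triples with three, no, one and two even labels, in this order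
  have v3 : f (none, none, none) = 0 := apply_diag_eq_zero (ne_one_of_root hζ) hf none
  have v2 : ∀ s t u, f (some s, some t, some u) = 0 := fun s t u => by
    simpa using e0 s (some t) (some u)
  have v1 : ∀ s t, f (none, some s, some t) = 0 := by
    -- applied twice, this exchange multiplies by `ζ ^ 2`, which is not `1`
    have key : ∀ s t, f (none, some s, some t) = ζ * f (none, some t, some s) := by
      intro s t
      have r1 := e0 s none (some t)
      have r2 := mem_twisted_iff.mp hf none (some t) (some s)
      simp [koszul] at r1 r2
      linear_combination r1 + r2
    intro s t
    have k1 := key s t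
    rw [key t s] at k1
    have k2 : (ζ - 1) * f (none, some s, some t) = 0 := by
      linear_combination ζ * k1 + f (none, some s, some t) * cube_of_root hζ
    exact (mul_eq_zero.mp k2).resolve_left (sub_ne_zero.mpr (ne_one_of_root hζ))
  have v0 : ∀ s, f (none, none, some s) = 0 := by
    intro s
    by_cases hs : φ 1 = some s
    · rw [← hs, h1]
    · have hlt : 1 < φ.symm (some s) := by
        have h2 : φ.symm (some s) ≠ 1 := fun h => hs (by rw [← h]; simp)
        have h3 := hpos s
        have h4 : (φ.symm (some s) : ℕ) ≠ 1 := fun h => h2 (Fin.ext (by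
          rw [h, Fin.val_one', Nat.mod_eq_of_lt (by omega)]))
        have h5 : (0 : ℕ) < φ.symm (some s) := h3
        change ((1 : Fin (n + 1)) : ℕ) < _
        rw [Fin.val_one', Nat.mod_eq_of_lt (by omega)]
        omega
      have := congrFun (hr 1 _ hlt) (none, none, φ 1)
      rw [cubeOp, unitOp_apply, superUnit_mulVec] at this
      have h6 : none ≠ φ 1 := by
        rw [← hφ, Ne, φ.injective.eq_iff]
        exact (one_ne_zero_fin hn).symm
      simpa [h6, sgn] using this
  ext ⟨a, b, c⟩
  rcases a with _ | a <;> rcases b with _ | b <;> rcases c with _ | c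
  · exact v3
  · exact v0 c
  · exact apply_rotate_eq_zero hf (apply_rotate_eq_zero hf (v0 b))
  · exact v1 b c
  · exact apply_rotate_eq_zero hf (v0 a)
  · exact apply_rotate_eq_zero hf (v1 c a)
  · exact apply_rotate_eq_zero hf (apply_rotate_eq_zero hf (v1 a b))
  · exact v2 a b c

/-- Every nonzero invariant subspace contains a nonzero vector annihilated by all raising
operators, because these lower the sum of the indices of a triple. -/
theorem exists_raising_eq_zero (φ : Fin (n + 1) ≃ Option ι) {U : Submodule ℂ (Cube ι)}
    (hU : IsInvariant (cubeOp φ) U) (hne : U ≠ ⊥) :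
    ∃ f ∈ U, f ≠ 0 ∧ ∀ i j, i < j → cubeOp φ i j f = 0 := by
  let ht : Option ι → ℕ := fun a => φ.symm a
  suffices H : ∀ m : ℕ, ∀ f ∈ U, f ≠ 0 →
      (∀ a b c, m ≤ ht a + ht b + ht c → f (a, b, c) = 0) →
      ∃ f ∈ U, f ≠ 0 ∧ ∀ i j, i < j → cubeOp φ i j f = 0 by
    obtain ⟨f, hf, hf0⟩ := U.ne_bot_iff.mp hne
    refine H (3 * n + 1) f hf hf0 fun a b c h => ?_
    have h1 : ht a < n + 1 := (φ.symm a).isLt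
    have h2 : ht b < n + 1 := (φ.symm b).isLt
    have h3 : ht c < n + 1 := (φ.symm c).isLt
    omega
  intro m
  induction m with
  | zero =>
    intro f _ hf0 h
    exact absurd (funext fun ⟨a, b, c⟩ => h a b c (Nat.zero_le _)) hf0
  | succ m ih =>
    intro f hf hf0 h
    by_cases hr : ∀ i j, i < j → cubeOp φ i j f = 0
    · exact ⟨f, hf, hf0, hr⟩
    · push Not at hr
      obtain ⟨i, j, hij, hne'⟩ := hr
      refine ih _ (hU i j f hf) hne' fun a b c habc => ?_
      have hi : ht (φ i) = i := by simp [ht]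
      have hj : ht (φ j) = j := by simp [ht]
      have hij' : (i : ℕ) < j := hij
      rw [cubeOp, unitOp_apply, superUnit_mulVec]
      have s1 : (if a = φ i then f (φ j, b, c) else 0) = 0 := by
        split_ifs with h'
        · subst h'
          exact h _ _ _ (by omega)
        · rfl
      have s2 : (if b = φ i then sgn a ^ deg (φ i) (φ j) * f (a, φ j, c) else 0) = 0 := by
        split_ifs with h'
        · subst h'
          rw [h _ _ _ (by omega), mul_zero]
        · rfl
      have s3 : (if c = φ i then sgn a ^ deg (φ i) (φ j) * sgn b ^ deg (φ i) (φ j) *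
          f (a, b, φ j) else 0) = 0 := by
        split_ifs with h'
        · subst h'
          rw [h _ _ _ (by omega), mul_zero]
        · rfl
      rw [s1, s2, s3]
      simp

/-- Orthogonal projection onto a subspace for the standard Hermitian form, in coordinates. -/
theorem exists_orthogonal {κ : Type} [Fintype κ] (U : Submodule ℂ (κ → ℂ)) (m : κ → ℂ) :
    ∃ p ∈ U, ∀ u ∈ U, star u ⬝ᵥ (m - p) = 0 := by
  let L := WithLp.linearEquiv 2 ℂ (κ → ℂ)
  let U' : Submodule ℂ (EuclideanSpace ℂ κ) := U.comap (L : EuclideanSpace ℂ κ →ₗ[ℂ] (κ → ℂ))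
  obtain ⟨y, hy, z, hz, hyz⟩ := U'.exists_add_mem_mem_orthogonal (L.symm m)
  refine ⟨L y, hy, fun u hu => ?_⟩
  have h1 : m - L y = L z := by
    have := congrArg L hyz
    rw [LinearEquiv.apply_symm_apply, map_add] at this
    rw [this, add_sub_cancel_left]
  have h2 := (Submodule.mem_orthogonal U' z).mp hz (L.symm u) (by simpa [U'] using hu)
  rw [EuclideanSpace.inner_eq_star_dotProduct, dotProduct_comm] at h2
  rw [h1]
  exact h2

theorem star_dotProduct_unitOp (i j : Option ι) (u f : Cube ι) :
    star u ⬝ᵥ unitOp i j f = star (unitOp j i u) ⬝ᵥ f := by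
  rw [unitOp_apply, unitOp_apply, Matrix.star_mulVec, superUnit_conjTranspose,
    Matrix.dotProduct_mulVec]

open scoped ComplexOrder in
/-- The twisted part is irreducible. Every nonzero invariant subspace contains the highest weight
vector; since the adjoint of `e i j` is `e j i`, orthogonal complements of invariant subspaces are
invariant, and two orthogonal subspaces cannot both contain it. -/
theorem twisted_irreducible {φ : Fin (n + 1) ≃ Option ι} (hφ : φ 0 = none)
    (hζ : ζ ^ 2 + ζ + 1 = 0) (hn : 1 ≤ n) (U : Submodule ℂ (Cube ι)) (hle : U ≤ twisted ι ζ)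
    (hU : IsInvariant (cubeOp φ) U) : U = ⊥ ∨ U = twisted ι ζ := by
  have htop : ∀ V : Submodule ℂ (Cube ι), V ≤ twisted ι ζ → IsInvariant (cubeOp φ) V → V ≠ ⊥ →
      topVec φ ζ ∈ V := by
    intro V hV hVi hV0
    obtain ⟨f, hf, hf0, hr⟩ := exists_raising_eq_zero φ hVi hV0
    set r := f (none, none, φ 1) with hr_def
    have h1 : f - r • topVec φ ζ = 0 := by
      refine eq_zero_of_raising hφ hζ hn
        (Submodule.sub_mem _ (hV hf) (Submodule.smul_mem _ _ (orbitVec_mem hζ _ _ _))) ?_ ?_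
      · intro i j hij
        rw [map_sub, map_smul, hr i j hij,
          (topVec_isHighestWeightVector hφ hζ hn).1 i j hij, smul_zero, sub_zero]
      · rw [Pi.sub_apply, Pi.smul_apply, topVec_apply hφ hn]
        simp [hr_def]
    rw [sub_eq_zero] at h1
    have hr0 : r ≠ 0 := by
      intro h0
      rw [h0, zero_smul] at h1
      exact hf0 h1
    rw [h1] at hf
    exact (V.smul_mem_iff hr0).mp hf
  by_cases hbot : U = ⊥
  · exact Or.inl hbot
  right
  refine le_antisymm hle fun m hm => ?_
  obtain ⟨p, hp, horth⟩ := exists_orthogonal U m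
  let V : Submodule ℂ (Cube ι) :=
    { carrier := {f | f ∈ twisted ι ζ ∧ ∀ u ∈ U, star u ⬝ᵥ f = 0}
      add_mem' := fun {f g} hf hg => ⟨Submodule.add_mem _ hf.1 hg.1, fun u hu => by
        rw [dotProduct_add, hf.2 u hu, hg.2 u hu, add_zero]⟩
      zero_mem' := ⟨Submodule.zero_mem _, fun u _ => dotProduct_zero _⟩
      smul_mem' := fun r f hf => ⟨Submodule.smul_mem _ r hf.1, fun u hu => by
        rw [dotProduct_smul, hf.2 u hu, smul_zero]⟩ }
  have hV : IsInvariant (cubeOp φ) V := by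
    intro i j f hf
    refine ⟨unitOp_mem_twisted _ _ hf.1, fun u hu => ?_⟩
    rw [cubeOp, star_dotProduct_unitOp]
    exact hf.2 _ (hU j i u hu)
  have hVbot : V = ⊥ := by
    by_contra hVne
    have h1 := htop V (fun f hf => hf.1) hV hVne
    have h2 := htop U hle hU hbot
    have h3 : topVec φ ζ = 0 := dotProduct_star_self_eq_zero.mp
      (h1.2 _ h2)
    have h4 := topVec_apply (ζ := ζ) hφ hn
    rw [h3] at h4
    simp at h4
  have h5 : m - p ∈ V := ⟨Submodule.sub_mem _ hm (hle hp), horth⟩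
  rw [hVbot, Submodule.mem_bot, sub_eq_zero] at h5
  rw [h5]
  exact hp

/-- The parity of a triple of basis labels. -/
def tripleParity (x : Option ι × Option ι × Option ι) : ZMod 2 :=
  deg none x.1 + deg none x.2.1 + deg none x.2.2

theorem rotInvariant_tripleParity (a : ZMod 2) :
    RotInvariant fun x : Option ι × Option ι × Option ι => tripleParity x = a := by
  intro u v w
  have : tripleParity (w, u, v) = tripleParity (u, v, w) := by
    simp only [tripleParity]
    ring
  simp only [this]

/-- The twisted part of the third tensor power as a module of `gl(1|n)`. -/
noncomputable def twistedModule (φ : Fin (n + 1) ≃ Option ι) (hφ : φ 0 = none) (ζ : ℂ) :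
    GLModule n (twisted ι ζ) where
  gr a := (twistedOn ζ fun x => tripleParity x = a).comap (twisted ι ζ).subtype
  isCompl_gr := by
    refine ⟨Submodule.disjoint_def.mpr fun f h0 h1 => ?_,
      codisjoint_iff.mpr (eq_top_iff.mpr fun f _ => ?_)⟩
    · ext x
      by_cases h : tripleParity x = 0
      · exact h1.2 x (by simp [h])
      · exact h0.2 x h
    · have h0 := cutoff_mem_twistedOn (rotInvariant_tripleParity 0) f.2
      have h1 := cutoff_mem_twistedOn (rotInvariant_tripleParity 1) f.2
      refine Submodule.mem_sup.mpr ⟨⟨_, h0.1⟩, h0, ⟨_, h1.1⟩, h1, ?_⟩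
      ext x
      have h2 : ∀ z : ZMod 2, z = 0 ∨ z = 1 := by decide
      change cutoff _ (f : Cube ι) x + cutoff _ (f : Cube ι) x = (f : Cube ι) x
      rcases h2 (tripleParity x) with h | h <;> simp [cutoff_apply, h]
  e i j := (cubeOp φ i j).restrict (isInvariant_twisted φ i j)
  e_mem_gr := by
    intro i j a f hf
    refine ⟨((cubeOp φ i j).restrict (isInvariant_twisted φ i j) f).2, ?_⟩
    rintro ⟨u, v, w⟩ hx
    change cubeOp φ i j (f : Cube ι) (u, v, w) = 0
    rw [weylDeg_eq hφ] at hx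
    have hd : (deg none (φ i) : ZMod 2) = deg none (φ j) + deg (φ i) (φ j) := by
      rcases φ i with _ | s <;> rcases φ j with _ | t <;> simp [deg]
      decide
    have hz : ∀ x, tripleParity x ≠ a → (f : Cube ι) x = 0 := hf.2
    rw [cubeOp, unitOp_apply, superUnit_mulVec]
    have s1 : (if u = φ i then (f : Cube ι) (φ j, v, w) else 0) = 0 := by
      split_ifs with h
      · subst h
        refine hz _ fun h => hx ?_
        simp only [tripleParity] at h ⊢
        rw [← h, hd]
        ring
      · rfl
    have s2 : (if v = φ i then sgn u ^ deg (φ i) (φ j) * (f : Cube ι) (u, φ j, w) else 0) = 0 := by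
      split_ifs with h
      · subst h
        rw [hz _ fun h => hx ?_, mul_zero]
        simp only [tripleParity] at h ⊢
        rw [← h, hd]
        ring
      · rfl
    have s3 : (if w = φ i then sgn u ^ deg (φ i) (φ j) * sgn v ^ deg (φ i) (φ j) *
        (f : Cube ι) (u, v, φ j) else 0) = 0 := by
      split_ifs with h
      · subst h
        rw [hz _ fun h => hx ?_, mul_zero]
        simp only [tripleParity] at h ⊢
        rw [← h, hd]
        ring
      · rfl
    rw [s1, s2, s3]
    simp
  bracket := by
    intro i j k l
    refine LinearMap.ext fun f => Subtype.ext ?_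
    have h := congrArg (fun T : End ℂ (Cube ι) => T f) (isBracket_cubeOp hφ i j k l)
    refine Eq.trans ?_ (h.trans ?_)
    · rfl
    · split_ifs <;> rfl

theorem twistedModule_isSimple {φ : Fin (n + 1) ≃ Option ι} (hφ : φ 0 = none)
    (hζ : ζ ^ 2 + ζ + 1 = 0) (hn : 1 ≤ n) : (twistedModule φ hφ ζ).IsSimple := by
  refine ⟨⟨⟨⟨topVec φ ζ, orbitVec_mem hζ _ _ _⟩, 0, fun h => ?_⟩⟩, fun U hU _ => ?_⟩
  · have h1 := congrArg (fun f : twisted ι ζ => (f : Cube ι) (none, none, φ 1)) h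
    simp only [topVec_apply hφ hn] at h1
    simp at h1
  · rcases twisted_irreducible hφ hζ hn (U.map (twisted ι ζ).subtype)
      (Submodule.map_subtype_le _ _) (by
        rintro i j _ ⟨u, hu, rfl⟩
        exact ⟨_, hU i j u hu, rfl⟩) with h | h
    · left
      exact Submodule.map_injective_of_injective (Submodule.subtype_injective _)
        (h.trans (Submodule.map_bot _).symm)
    · right
      refine eq_top_iff.mpr fun f _ => ?_
      have h1 : (f : Cube ι) ∈ U.map (twisted ι ζ).subtype := by rw [h]; exact f.2
      obtain ⟨g, hg, hgf⟩ := h1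
      rwa [← Subtype.ext hgf]

theorem twistedModule_hasHighestWeight {φ : Fin (n + 1) ≃ Option ι} (hφ : φ 0 = none)
    (hζ : ζ ^ 2 + ζ + 1 = 0) (hn : 1 ≤ n) :
    (twistedModule φ hφ ζ).HasHighestWeight (weight21 n) := by
  have H := topVec_isHighestWeightVector hφ hζ hn
  refine ⟨⟨topVec φ ζ, orbitVec_mem hζ _ _ _⟩, fun h => ?_,
    fun i j hij => Subtype.ext (H.1 i j hij), fun i => Subtype.ext (H.2 i)⟩
  have h1 := congrArg (fun f : twisted ι ζ => (f : Cube ι) (none, none, φ 1)) h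
  simp only [topVec_apply hφ hn] at h1
  simp at h1

end Irreducible

/-! ### Levels and weights of the twisted part -/

section Weights

/-- The labels of the basis of `ℂ^{1|3N}`: one even label, and three odd labels per particle. -/
abbrev ParticleLabel (N : ℕ) : Type := Option (Fin N × Fin 3)

variable {N : ℕ} {ζ : ℂ}

/-- The block matrix that acts by `A` on the three-dimensional space of each particle and by `c` on
the even basis vector. -/
def blockMat (N : ℕ) (A : Matrix (Fin 3) (Fin 3) ℂ) (c : ℂ) :
    Matrix (ParticleLabel N) (ParticleLabel N) ℂ :=
  fun a b => match a, b with
  | none, none => c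
  | some p, some q => if p.1 = q.1 then A p.2 q.2 else 0
  | _, _ => 0

theorem blockMat_mul (A B : Matrix (Fin 3) (Fin 3) ℂ) (c d : ℂ) :
    blockMat N A c * blockMat N B d = blockMat N (A * B) (c * d) := by
  ext a b
  rw [Matrix.mul_apply, Fintype.sum_option]
  rcases a with _ | ⟨α, k⟩ <;> rcases b with _ | ⟨β, l⟩
  · simp [blockMat]
  · simp [blockMat]
  · simp [blockMat]
  · simp only [blockMat, zero_mul, zero_add, Fintype.sum_prod_type, Matrix.mul_apply]
    rw [Finset.sum_eq_single α]
    · by_cases h : α = β <;> simp [h]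
    · intro γ _ hγ
      simp [Ne.symm hγ]
    · simp

theorem blockMat_one : blockMat N 1 1 = 1 := by
  ext a b
  rcases a with _ | ⟨α, k⟩ <;> rcases b with _ | ⟨β, l⟩
  · simp [blockMat]
  · simp [blockMat]
  · simp [blockMat]
  · by_cases h : α = β <;> simp [blockMat, Matrix.one_apply, h]

theorem blockMat_even (A : Matrix (Fin 3) (Fin 3) ℂ) (c : ℂ) {a b : ParticleLabel N}
    (h : ¬ (a = none ↔ b = none)) : blockMat N A c a b = 0 := by
  rcases a with _ | a <;> rcases b with _ | b <;> simp_all [blockMat]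

/-- The derivation of the third tensor power induced by an even matrix. -/
def deriv₃ (X : Matrix (ParticleLabel N) (ParticleLabel N) ℂ) : End ℂ (Cube (Fin N × Fin 3)) :=
  Matrix.toLinAlgEquiv' (tri X 1 1 + tri 1 X 1 + tri 1 1 X)

theorem unitOp_eq_deriv₃ {i j : ParticleLabel N} (h : deg i j = 0) :
    unitOp i j = deriv₃ (Matrix.single i j 1) := by
  have hp : (par 0 : Matrix (ParticleLabel N) (ParticleLabel N) ℂ) = 1 := by
    simp [par]
  rw [unitOp, superUnit, h, hp, deriv₃]

theorem deriv₃_add (X Y : Matrix (ParticleLabel N) (ParticleLabel N) ℂ) :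
    deriv₃ (X + Y) = deriv₃ X + deriv₃ Y := by
  rw [deriv₃, deriv₃, deriv₃, ← map_add]
  congr 1
  simp only [tri, Matrix.add_kronecker, Matrix.kronecker_add]
  abel

theorem deriv₃_smul (r : ℂ) (X : Matrix (ParticleLabel N) (ParticleLabel N) ℂ) :
    deriv₃ (r • X) = r • deriv₃ X := by
  rw [deriv₃, deriv₃, ← map_smul, tri_smul₁, tri_smul₂, tri_smul₃, smul_add, smul_add]

/-- The map `X ↦ deriv₃ X` as a linear map. -/
def deriv₃Lin (N : ℕ) : Matrix (ParticleLabel N) (ParticleLabel N) ℂ →ₗ[ℂ]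
    End ℂ (Cube (Fin N × Fin 3)) where
  toFun := deriv₃
  map_add' := deriv₃_add
  map_smul' := deriv₃_smul

theorem deriv₃_diagonal_apply (w : ParticleLabel N → ℂ) (f : Cube (Fin N × Fin 3))
    (a b c : ParticleLabel N) :
    deriv₃ (Matrix.diagonal w) f (a, b, c) = (w a + w b + w c) * f (a, b, c) := by
  have h1 : ∀ u v t : ParticleLabel N → ℂ,
      tri (Matrix.diagonal u) (Matrix.diagonal v) (Matrix.diagonal t) =
        Matrix.diagonal fun x => u x.1 * (v x.2.1 * t x.2.2) := by
    intro u v t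
    simp [tri, Matrix.diagonal_kronecker_diagonal]
  rw [deriv₃, Matrix.toLinAlgEquiv'_apply, ← Matrix.diagonal_one, h1, h1, h1,
    Matrix.add_mulVec, Matrix.add_mulVec]
  simp only [Pi.add_apply, Matrix.mulVec_diagonal]
  ring

/-- The simultaneous action of a matrix on the three tensor factors. -/
def diagAct (g : Matrix (ParticleLabel N) (ParticleLabel N) ℂ) : End ℂ (Cube (Fin N × Fin 3)) :=
  Matrix.toLinAlgEquiv' (tri g g g)

theorem diagAct_mul (g g' : Matrix (ParticleLabel N) (ParticleLabel N) ℂ) :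
    diagAct g * diagAct g' = diagAct (g * g') := by
  rw [diagAct, diagAct, diagAct, ← map_mul, tri_mul]

theorem diagAct_one : diagAct (1 : Matrix (ParticleLabel N) (ParticleLabel N) ℂ) = 1 := by
  rw [diagAct, tri_one, map_one]

/-- Intertwining matrices intertwine the induced derivations. -/
theorem deriv₃_mul_diagAct {X Y g : Matrix (ParticleLabel N) (ParticleLabel N) ℂ}
    (h : X * g = g * Y) : deriv₃ X * diagAct g = diagAct g * deriv₃ Y := by
  rw [deriv₃, deriv₃, diagAct, ← map_mul, ← map_mul]
  simp only [add_mul, mul_add, tri_mul, one_mul, mul_one, h]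

theorem shift_diagAct (A : Matrix (Fin 3) (Fin 3) ℂ) (r : ℂ) (f : Cube (Fin N × Fin 3)) :
    shift (diagAct (blockMat N A r) f) = diagAct (blockMat N A r) (shift f) := by
  ext ⟨a, b, c⟩
  simp only [shift_apply, diagAct, Matrix.toLinAlgEquiv'_apply, tri_mulVec]
  set g := blockMat N A r with hg
  have key : ∀ x y z, koszul c a b * (g c x * (g a y * g b z) * f (x, y, z)) =
      g a y * (g b z * g c x) * (koszul x y z * f (x, y, z)) := by
    intro x y z
    by_cases h1 : (c = none ↔ x = none)
    · by_cases h2 : (a = none ↔ y = none)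
      · by_cases h3 : (b = none ↔ z = none)
        · have : koszul c a b = koszul x y z := by
            simp only [koszul, ne_eq, h1, h2, h3]
          rw [this]
          ring
        · rw [hg, blockMat_even A r h3]
          ring
      · rw [hg, blockMat_even A r h2]
        ring
    · rw [hg, blockMat_even A r h1]
      ring
  simp only [Finset.mul_sum, key]
  rw [Finset.sum_comm]
  refine Finset.sum_congr rfl fun y _ => ?_
  rw [Finset.sum_comm]

theorem diagAct_mem_twisted (A : Matrix (Fin 3) (Fin 3) ℂ) (r : ℂ) {f : Cube (Fin N × Fin 3)}
    (hf : f ∈ twisted (Fin N × Fin 3) ζ) :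
    diagAct (blockMat N A r) f ∈ twisted (Fin N × Fin 3) ζ := by
  rw [twisted, End.mem_eigenspace_iff] at hf ⊢
  rw [shift_diagAct, hf, map_smul]

/-- The matrix of the third component of a spin one particle in Cartesian coordinates. -/
def spinMat : Matrix (Fin 3) (Fin 3) ℂ := !![0, -Complex.I, 0; Complex.I, 0, 0; 0, 0, 0]

/-- The eigenvalues of `spinMat`. -/
def spinVal : Fin 3 → ℤ := ![1, -1, 0]

/-- The change from Cartesian to spherical coordinates: its columns are eigenvectors of
`spinMat`. -/
def sphMat : Matrix (Fin 3) (Fin 3) ℂ := !![1, 1, 0; Complex.I, -Complex.I, 0; 0, 0, 1]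

/-- The inverse of `sphMat`. -/
noncomputable def sphMatInv : Matrix (Fin 3) (Fin 3) ℂ :=
  !![1 / 2, -Complex.I / 2, 0; 1 / 2, Complex.I / 2, 0; 0, 0, 1]

theorem sphMat_mul_inv : sphMat * sphMatInv = 1 := by
  have hI : Complex.I ^ 2 = -1 := Complex.I_sq
  ext i j
  fin_cases i <;> fin_cases j <;>
    simp [sphMat, sphMatInv, Matrix.mul_apply, Fin.sum_univ_three] <;> ring_nf;
    simp [hI]

theorem sphMatInv_mul : sphMatInv * sphMat = 1 := mul_eq_one_comm.mp sphMat_mul_inv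

theorem spinMat_mul_sphMat :
    spinMat * sphMat = sphMat * Matrix.diagonal fun k => ((spinVal k : ℤ) : ℂ) := by
  ext i j
  fin_cases i <;> fin_cases j <;>
    simp [sphMat, spinMat, spinVal, Matrix.mul_apply, Fin.sum_univ_three, Matrix.diagonal]

/-- The spin of a basis label in spherical coordinates. -/
def spin {κ : Type} : Option (κ × Fin 3) → ℤ
  | none => 0
  | some p => spinVal p.2

theorem blockMat_diagonal :
    blockMat N (Matrix.diagonal fun k => ((spinVal k : ℤ) : ℂ)) 0 =
      Matrix.diagonal fun a => ((spin a : ℤ) : ℂ) := by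
  ext a b
  rcases a with _ | ⟨α, k⟩ <;> rcases b with _ | ⟨β, l⟩
  · simp [blockMat, spin]
  · simp [blockMat]
  · simp [blockMat]
  · by_cases h : α = β <;> by_cases h' : k = l <;>
      simp [blockMat, h, h', spin]

theorem blockMat_zero_one : blockMat N 0 1 = Matrix.single none none 1 := by
  ext a b
  rcases a with _ | ⟨α, k⟩ <;> rcases b with _ | ⟨β, l⟩ <;> simp [blockMat, Matrix.single]

/-- The number of even labels in a triple. -/
def evens {κ : Type} (x : Option κ × Option κ × Option κ) : ℕ :=
  (if x.1.isNone then 1 else 0) + (if x.2.1.isNone then 1 else 0) +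
    (if x.2.2.isNone then 1 else 0)

theorem unitOp_none (f : Cube (Fin N × Fin 3))
    (x : ParticleLabel N × ParticleLabel N × ParticleLabel N) :
    unitOp none none f x = (evens x : ℂ) * f x := by
  obtain ⟨a, b, c⟩ := x
  rw [unitOp_diag]
  simp [evens]

/-- The triples of level `q`. -/
def IsLevel {κ : Type} (q : ℕ) (x : Option κ × Option κ × Option κ) : Prop := evens x + q = 2

/-- The triples of level `q` and total spin `s`. -/
def IsLevelSpin {κ : Type} (q : ℕ) (s : ℤ)
    (x : Option (κ × Fin 3) × Option (κ × Fin 3) × Option (κ × Fin 3)) : Prop :=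
  evens x + q = 2 ∧ spin x.1 + spin x.2.1 + spin x.2.2 = s

instance {κ : Type} (q : ℕ) :
    DecidablePred (IsLevel q : Option κ × Option κ × Option κ → Prop) :=
  fun x => inferInstanceAs (Decidable (evens x + q = 2))

instance {κ : Type} (q : ℕ) (s : ℤ) : DecidablePred (IsLevelSpin (κ := κ) q s) :=
  fun _ => inferInstanceAs (Decidable (_ ∧ _))

theorem evens_rotate {κ : Type} (a b c : Option κ) : evens (c, a, b) = evens (a, b, c) := by
  simp only [evens]
  ring

theorem rotInvariant_isLevel {κ : Type} (q : ℕ) : RotInvariant (IsLevel (κ := κ) q) := by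
  intro a b c
  rw [IsLevel, IsLevel, evens_rotate]

theorem rotInvariant_isLevelSpin {κ : Type} (q : ℕ) (s : ℤ) :
    RotInvariant (IsLevelSpin (κ := κ) q s) := by
  intro a b c
  have : spin c + spin a + spin b = spin a + spin b + spin c := by ring
  simp only [IsLevelSpin, evens_rotate, this]

theorem evens_cast_eq {κ : Type} (q : ℕ) (x : Option κ × Option κ × Option κ) :
    (evens x : ℂ) = 2 - (q : ℂ) ↔ IsLevel q x := by
  rw [IsLevel, eq_sub_iff_add_eq]
  exact_mod_cast Iff.rfl

theorem eigen_iff_support {κ : Type} (w : κ → ℂ) (μ : ℂ) (f : κ → ℂ) :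
    (∀ x, w x * f x = μ * f x) ↔ ∀ x, w x ≠ μ → f x = 0 := by
  refine forall_congr' fun x => ?_
  constructor
  · intro h hne
    have : (w x - μ) * f x = 0 := by linear_combination h
    exact (mul_eq_zero.mp this).resolve_left (sub_ne_zero.mpr hne)
  · intro h
    by_cases hw : w x = μ
    · rw [hw]
    · rw [h hw, mul_zero, mul_zero]

theorem mem_eigenspace_unitOp_none {q : ℕ} {f : Cube (Fin N × Fin 3)} :
    f ∈ (unitOp none none : End ℂ (Cube (Fin N × Fin 3))).eigenspace (2 - (q : ℂ)) ↔
      ∀ x, ¬ IsLevel q x → f x = 0 := by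
  rw [End.mem_eigenspace_iff, funext_iff]
  simp only [unitOp_none, Pi.smul_apply, smul_eq_mul, eigen_iff_support, ne_eq, evens_cast_eq]

theorem twisted_inf_eigenspace (q : ℕ) :
    twisted (Fin N × Fin 3) ζ ⊓ (unitOp none none).eigenspace (2 - (q : ℂ)) =
      twistedOn ζ (IsLevel q) := by
  ext f
  rw [Submodule.mem_inf, mem_eigenspace_unitOp_none]
  rfl

/-- The change to spherical coordinates identifies the weight spaces of the third component of the
angular momentum with spaces of functions of prescribed support. -/
theorem finrank_weightSpace (q : ℕ) (s : ℤ) :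
    finrank ℂ (twisted (Fin N × Fin 3) ζ ⊓ (unitOp none none).eigenspace (2 - (q : ℂ)) ⊓
      (deriv₃ (blockMat N spinMat 0)).eigenspace (s : ℂ) :
        Submodule ℂ (Cube (Fin N × Fin 3))) = finrank ℂ (twistedOn (ι := Fin N × Fin 3) ζ
          (IsLevelSpin q s)) := by
  set G := diagAct (blockMat N sphMat 1) with hG
  set G' := diagAct (blockMat N sphMatInv 1) with hG'
  have hGG' : G * G' = 1 := by
    rw [hG, hG', diagAct_mul, blockMat_mul, sphMat_mul_inv, mul_one, blockMat_one, diagAct_one]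
  have hG'G : G' * G = 1 := by
    rw [hG, hG', diagAct_mul, blockMat_mul, sphMatInv_mul, mul_one, blockMat_one, diagAct_one]
  let Ge : Cube (Fin N × Fin 3) ≃ₗ[ℂ] Cube (Fin N × Fin 3) :=
    LinearEquiv.ofLinearMap G G' hGG' hG'G
  have hmem : ∀ f, G f ∈ twisted (Fin N × Fin 3) ζ ↔ f ∈ twisted (Fin N × Fin 3) ζ := by
    intro f
    refine ⟨fun h => ?_, fun h => diagAct_mem_twisted _ _ h⟩
    have h1 := diagAct_mem_twisted (ζ := ζ) sphMatInv 1 h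
    rw [← hG', ← End.mul_apply, hG'G] at h1
    exact h1
  have hcomm : ∀ (X Y : End ℂ (Cube (Fin N × Fin 3))), X * G = G * Y → ∀ (μ : ℂ) f,
      G f ∈ X.eigenspace μ ↔ f ∈ Y.eigenspace μ := by
    intro X Y h μ f
    rw [End.mem_eigenspace_iff, End.mem_eigenspace_iff, ← End.mul_apply, h, End.mul_apply,
      ← map_smul]
    exact Ge.injective.eq_iff
  have h0 : (unitOp none none : End ℂ (Cube (Fin N × Fin 3))) * G = G * unitOp none none := by
    rw [unitOp_eq_deriv₃ (by simp [deg]), ← blockMat_zero_one]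
    refine deriv₃_mul_diagAct ?_
    rw [blockMat_mul, blockMat_mul]
    simp
  have h3 : deriv₃ (blockMat N spinMat 0) * G =
      G * deriv₃ (Matrix.diagonal fun a => ((spin a : ℤ) : ℂ)) := by
    refine deriv₃_mul_diagAct ?_
    rw [← blockMat_diagonal, blockMat_mul, blockMat_mul, spinMat_mul_sphMat]
    simp
  have hD : ∀ f : Cube (Fin N × Fin 3),
      f ∈ (deriv₃ (Matrix.diagonal fun a => ((spin a : ℤ) : ℂ))).eigenspace (s : ℂ) ↔
        ∀ x : ParticleLabel N × ParticleLabel N × ParticleLabel N,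
          ¬ spin x.1 + spin x.2.1 + spin x.2.2 = s → f x = 0 := by
    intro f
    rw [End.mem_eigenspace_iff, funext_iff]
    have h1 := eigen_iff_support
      (fun x : ParticleLabel N × ParticleLabel N × ParticleLabel N =>
        (((spin x.1 + spin x.2.1 + spin x.2.2 : ℤ)) : ℂ)) (s : ℂ) f
    simp only [ne_eq, Int.cast_inj] at h1
    rw [← h1]
    refine forall_congr' fun x => ?_
    obtain ⟨a, b, c⟩ := x
    rw [deriv₃_diagonal_apply, Pi.smul_apply, smul_eq_mul]
    push_cast
    rfl
  have hmap : (twisted (Fin N × Fin 3) ζ ⊓ (unitOp none none).eigenspace (2 - (q : ℂ)) ⊓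
      (deriv₃ (blockMat N spinMat 0)).eigenspace (s : ℂ)) =
      (twistedOn (ι := Fin N × Fin 3) ζ (IsLevelSpin q s)).map
        (Ge : Cube (Fin N × Fin 3) →ₗ[ℂ] Cube (Fin N × Fin 3)) := by
    ext f
    obtain ⟨f, rfl⟩ := Ge.surjective f
    rw [Submodule.mem_map_equiv, LinearEquiv.symm_apply_apply]
    rw [Submodule.mem_inf, Submodule.mem_inf]
    change (G f ∈ twisted _ ζ ∧ G f ∈ End.eigenspace _ _) ∧ G f ∈ End.eigenspace _ _ ↔
      f ∈ twisted _ ζ ∧ _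
    rw [hmem, hcomm _ _ h0, hcomm _ _ h3, mem_eigenspace_unitOp_none, hD, and_assoc]
    refine and_congr_right fun _ => ?_
    constructor
    · rintro ⟨h1, h2⟩ x hx
      by_cases hl : IsLevel q x
      · exact h2 x fun hs => hx ⟨hl, hs⟩
      · exact h1 x hl
    · exact fun h => ⟨fun x hx => h x fun hl => hx hl.1, fun x hx => h x fun hl => hx hl.2⟩
  rw [hmap]
  exact LinearEquiv.finrank_map_eq Ge _

/-- Forgetting the particle of a basis label. -/
def forget (a : ParticleLabel N) : Option (Fin 1 × Fin 3) := a.map fun p => (0, p.2)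

theorem sum_forget (F : Option (Fin 1 × Fin 3) → ℕ) :
    ∑ a : ParticleLabel N, F (forget a) =
      ∑ u : Option (Fin 1 × Fin 3), (if u.isNone then 1 else N) * F u := by
  simp [Fintype.sum_option, Fintype.sum_prod_type, forget, Finset.mul_sum]

/-- A triple of level `q` has `q + 1` odd labels, so each triple of level `q` for a single particle
arises from `N ^ (q + 1)` triples of labels by forgetting the particles. -/
theorem card_filter_level (q : ℕ) (P : Option (Fin 1 × Fin 3) × Option (Fin 1 × Fin 3) ×
    Option (Fin 1 × Fin 3) → Prop) [DecidablePred P] (hP : ∀ x, P x → IsLevel q x) :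
    (Finset.univ.filter fun x : ParticleLabel N × ParticleLabel N × ParticleLabel N =>
      P (forget x.1, forget x.2.1, forget x.2.2)).card =
      N ^ (q + 1) * (Finset.univ.filter P).card := by
  rw [Finset.card_filter, Finset.card_filter, Finset.mul_sum]
  simp only [Fintype.sum_prod_type]
  rw [sum_forget (fun u => ∑ b : ParticleLabel N, ∑ c : ParticleLabel N,
    if P (u, forget b, forget c) then 1 else 0)]
  refine Finset.sum_congr rfl fun u _ => ?_
  rw [sum_forget (fun v => ∑ c : ParticleLabel N, if P (u, v, forget c) then 1 else 0),
    Finset.mul_sum]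
  refine Finset.sum_congr rfl fun v _ => ?_
  rw [sum_forget (fun w => if P (u, v, w) then 1 else 0), Finset.mul_sum, Finset.mul_sum]
  refine Finset.sum_congr rfl fun w _ => ?_
  by_cases h : P (u, v, w)
  · have hl := hP _ h
    simp only [IsLevel, evens] at hl
    rcases u with _ | u <;> rcases v with _ | v <;> rcases w with _ | w <;>
      simp only [h, if_true, Option.isNone_none, Option.isNone_some, Bool.false_eq_true, if_false,
        mul_one, one_mul] at hl ⊢ <;>
      first
      | (exfalso; omega)
      | (rw [show q = 0 by omega]; ring)
      | (rw [show q = 1 by omega]; ring)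
      | (rw [show q = 2 by omega]; ring)
  · simp [h]

theorem isLevel_forget {q : ℕ} {a b c : ParticleLabel N} :
    IsLevel q (forget a, forget b, forget c) ↔ IsLevel q (a, b, c) := by
  simp [IsLevel, evens, forget]

theorem isLevelSpin_forget {q : ℕ} {s : ℤ} {a b c : ParticleLabel N} :
    IsLevelSpin q s (forget a, forget b, forget c) ↔ IsLevelSpin q s (a, b, c) := by
  have : ∀ a : ParticleLabel N, spin (forget a) = spin a := by
    rintro (_ | a) <;> rfl
  simp only [IsLevelSpin, this]
  exact and_congr_left fun _ => isLevel_forget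

theorem finrank_level (hζ : ζ ^ 2 + ζ + 1 = 0) (q : ℕ) :
    3 * finrank ℂ (twistedOn (ι := Fin N × Fin 3) ζ (IsLevel q)) +
        (∑ u : Option (Fin 1 × Fin 3), (if u.isNone then 1 else N) *
          if IsLevel q (u, u, u) then 1 else 0) =
      N ^ (q + 1) * (Finset.univ.filter (IsLevel (κ := Fin 1 × Fin 3) q)).card := by
  rw [← card_filter_level q _ fun x h => h, ← sum_forget fun u => if IsLevel q (u, u, u) then 1
    else 0, ← Finset.card_filter]
  have := finrank_twistedOn hζ _ (rotInvariant_isLevel (κ := Fin N × Fin 3) q)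
  simpa only [isLevel_forget] using this

theorem finrank_levelSpin (hζ : ζ ^ 2 + ζ + 1 = 0) (q : ℕ) (s : ℤ) :
    3 * finrank ℂ (twistedOn (ι := Fin N × Fin 3) ζ (IsLevelSpin q s)) +
        (∑ u : Option (Fin 1 × Fin 3), (if u.isNone then 1 else N) *
          if IsLevelSpin q s (u, u, u) then 1 else 0) =
      N ^ (q + 1) * (Finset.univ.filter (IsLevelSpin (κ := Fin 1) q s)).card := by
  rw [← card_filter_level q _ fun x h => h.1,
    ← sum_forget fun u => if IsLevelSpin q s (u, u, u) then 1 else 0, ← Finset.card_filter]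
  have := finrank_twistedOn hζ _ (rotInvariant_isLevelSpin (κ := Fin N) q s)
  simpa only [isLevelSpin_forget] using this

theorem sum_diag (N : ℕ) (P : Option (Fin 1 × Fin 3) → Prop) [DecidablePred P]
    (h : ¬ P none) : (∑ u : Option (Fin 1 × Fin 3), (if u.isNone then 1 else N) *
          if P u then 1 else 0) = N * (Finset.univ.filter P).card := by
  rw [Finset.card_filter, Finset.mul_sum]
  refine Finset.sum_congr rfl fun u _ => ?_
  rcases u with _ | u <;> simp [h]

/-- The dimensions of the levels. -/
theorem finrank_level_values (hζ : ζ ^ 2 + ζ + 1 = 0) :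
    finrank ℂ (twistedOn (ι := Fin N × Fin 3) ζ (IsLevel 0)) = 3 * N ∧
    finrank ℂ (twistedOn (ι := Fin N × Fin 3) ζ (IsLevel 1)) = 9 * N ^ 2 ∧
    finrank ℂ (twistedOn (ι := Fin N × Fin 3) ζ (IsLevel 2)) + N = 9 * N ^ 3 := by
  have h0 := finrank_level (N := N) hζ 0
  have h1 := finrank_level (N := N) hζ 1
  have h2 := finrank_level (N := N) hζ 2
  rw [sum_diag N _ (by decide)] at h0 h1 h2
  rw [show (Finset.univ.filter fun u : Option (Fin 1 × Fin 3) => IsLevel 0 (u, u, u)).card = 0 by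
      decide, show (Finset.univ.filter (IsLevel (κ := Fin 1 × Fin 3) 0)).card = 9 by decide] at h0
  rw [show (Finset.univ.filter fun u : Option (Fin 1 × Fin 3) => IsLevel 1 (u, u, u)).card = 0 by
      decide, show (Finset.univ.filter (IsLevel (κ := Fin 1 × Fin 3) 1)).card = 27 by decide] at h1
  rw [show (Finset.univ.filter fun u : Option (Fin 1 × Fin 3) => IsLevel 2 (u, u, u)).card = 3 by
      decide, show (Finset.univ.filter (IsLevel (κ := Fin 1 × Fin 3) 2)).card = 27 by decide] at h2
  norm_num at h0 h1 h2
  refine ⟨by omega, by omega, by omega⟩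

/-- The numbers of triples of level `q` and spin `j`, and of the constant ones among them, when
there is a single particle. Rows of the tables belong to `q`, columns to `j`. -/
theorem card_isLevelSpin : ∀ q : Fin 3, ∀ j : Fin 5,
    (Finset.univ.filter (IsLevelSpin (κ := Fin 1) q (j : ℕ))).card =
      (![![3, 3, 0, 0, 0], ![9, 6, 3, 0, 0], ![7, 6, 3, 1, 0]] : Fin 3 → Fin 5 → ℕ) q j ∧
    (Finset.univ.filter fun u : Option (Fin 1 × Fin 3) =>
      IsLevelSpin (q : ℕ) (j : ℕ) (u, u, u)).card =
      (![![0, 0, 0, 0, 0], ![0, 0, 0, 0, 0], ![1, 0, 0, 1, 0]] : Fin 3 → Fin 5 → ℕ) q j := by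
  decide

/-- The dimensions of the weight spaces of the levels, for the weights `0, …, 4`. The particles can
be distributed independently over the `q + 1` odd labels of a triple of level `q`, except that a
constant triple carries a single particle. -/
theorem finrank_levelSpin_values (hζ : ζ ^ 2 + ζ + 1 = 0) (q : Fin 3) (j : Fin 5) :
    3 * finrank ℂ (twistedOn (ι := Fin N × Fin 3) ζ (IsLevelSpin (q : ℕ) ((j : ℕ) : ℤ))) +
      N * (![![0, 0, 0, 0, 0], ![0, 0, 0, 0, 0], ![1, 0, 0, 1, 0]] : Fin 3 → Fin 5 → ℕ) q j =
    N ^ ((q : ℕ) + 1) *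
      (![![3, 3, 0, 0, 0], ![9, 6, 3, 0, 0], ![7, 6, 3, 1, 0]] : Fin 3 → Fin 5 → ℕ) q j := by
  have h := finrank_levelSpin (N := N) hζ q ((j : ℕ) : ℤ)
  rw [sum_diag N _ (fun h => by
    have := h.1
    simp [evens] at this
    omega), (card_isLevelSpin q j).1, (card_isLevelSpin q j).2] at h
  exact h

end Weights

/-! ### The oscillator operators on a module -/

section Realization

variable {N : ℕ} {ζ : ℂ} {W : Type*} [AddCommGroup W] [Module ℂ W]

/-- The labelling of the basis of `ℂ^{1|3N}` by particles and components. -/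
def labelEquiv (N : ℕ) : Fin (3 * N + 1) ≃ ParticleLabel N :=
  (finSuccEquiv (3 * N)).trans
    (((finCongr (mul_comm 3 N)).trans finProdFinEquiv.symm).optionCongr)

theorem labelEquiv_zero : labelEquiv N 0 = none := by
  simp [labelEquiv]

theorem labelEquiv_label (α : Fin N) (k : Fin 3) : labelEquiv N (label α k) = some (α, k) := by
  have h : label α k = Fin.succ (Fin.cast (mul_comm N 3) (finProdFinEquiv (α, k))) := by
    apply Fin.ext
    simp [label]
    ring
  rw [h]
  simp only [labelEquiv, Equiv.trans_apply, finSuccEquiv_succ, Equiv.optionCongr_apply,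
    Option.map_some, Option.some.injEq]
  exact (Equiv.symm_apply_eq _).mpr rfl

/-- The family of matrix units of the particles, summed with the coefficients `A`. -/
def blockOp (ρ : GLModule (3 * N) W) (A : Matrix (Fin 3) (Fin 3) ℂ) : End ℂ W :=
  ∑ α : Fin N, ∑ k : Fin 3, ∑ l : Fin 3, A k l • ρ.e (label α k) (label α l)

/-- The matrices of the angular momentum of a spin one particle in Cartesian coordinates. -/
def spinMats (j : Fin 3) : Matrix (Fin 3) (Fin 3) ℂ := fun k l => -Complex.I * levi j k l

section Relations

variable (ρ : GLModule (3 * N) W)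

theorem label_ne_zero (α : Fin N) (k : Fin 3) : label α k ≠ 0 := by
  intro h
  have := congrArg Fin.val h
  simp [label] at this

theorem label_eq_iff {α : Fin N} {k l : Fin 3} : label α k = label α l ↔ k = l := by
  rw [← (labelEquiv N).injective.eq_iff, labelEquiv_label, labelEquiv_label]
  simp

theorem aPlus_aPlus (α : Fin N) (k l : Fin 3) :
    aPlus ρ α k * aPlus ρ α l + aPlus ρ α l * aPlus ρ α k = 0 := by
  have h := ρ.bracket (label α k) 0 (label α l) 0
  simpa [aPlus, aMinus, weylSign, weylDeg, label_ne_zero, (label_ne_zero _ _).symm] using h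

theorem aMinus_aMinus (α : Fin N) (k l : Fin 3) :
    aMinus ρ α k * aMinus ρ α l + aMinus ρ α l * aMinus ρ α k = 0 := by
  have h := ρ.bracket 0 (label α k) 0 (label α l)
  simpa [aPlus, aMinus, weylSign, weylDeg, label_ne_zero, (label_ne_zero _ _).symm] using h

theorem aPlus_aMinus (α : Fin N) (k l : Fin 3) :
    aPlus ρ α k * aMinus ρ α l + aMinus ρ α l * aPlus ρ α k =
      ρ.e (label α k) (label α l) + if k = l then ρ.e 0 0 else 0 := by
  have h := ρ.bracket (label α k) 0 0 (label α l)
  by_cases hkl : k = l <;>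
    simpa [aPlus, aMinus, weylSign, weylDeg, label_ne_zero, (label_ne_zero _ _).symm,
      label_eq_iff, hkl] using h

theorem sq_aPlus_add (α : Fin N) (k : Fin 3) :
    (aPlus ρ α k + aMinus ρ α k) ^ 2 = ρ.e (label α k) (label α k) + ρ.e 0 0 := by
  have h1 := aPlus_aPlus ρ α k k
  have h2 := aMinus_aMinus ρ α k k
  have h3 := aPlus_aMinus ρ α k k
  rw [← two_smul ℂ, smul_eq_zero_iff_right two_ne_zero] at h1 h2
  rw [if_pos rfl] at h3
  rw [← h3, pow_two, mul_add, add_mul, add_mul, h1, h2]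
  abel

theorem sq_aPlus_sub (α : Fin N) (k : Fin 3) :
    (aPlus ρ α k - aMinus ρ α k) ^ 2 = -(ρ.e (label α k) (label α k) + ρ.e 0 0) := by
  have h1 := aPlus_aPlus ρ α k k
  have h2 := aMinus_aMinus ρ α k k
  have h3 := aPlus_aMinus ρ α k k
  rw [← two_smul ℂ, smul_eq_zero_iff_right two_ne_zero] at h1 h2
  rw [if_pos rfl] at h3
  rw [← h3, pow_two, mul_sub, sub_mul, sub_mul, h1, h2]
  abel

variable {hbar m ω : ℝ}

theorem three_mul_sub_one_pos (hN : 1 ≤ N) : (0 : ℝ) < 3 * (N : ℝ) - 1 := by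
  have : (1 : ℝ) ≤ N := by exact_mod_cast hN
  linarith

theorem pos_sq (hN : 1 ≤ N) (hh : 0 < hbar) (hm : 0 < m) (hω : 0 < ω) (α : Fin N) (k : Fin 3) :
    pos ρ hbar m ω α k ^ 2 =
      ((hbar / ((3 * (N : ℝ) - 1) * m * ω) : ℝ) : ℂ) •
        (ρ.e (label α k) (label α k) + ρ.e 0 0) := by
  have h0 : 0 ≤ hbar / ((3 * (N : ℝ) - 1) * m * ω) := by
    have := three_mul_sub_one_pos hN
    positivity
  rw [pos, smul_pow, sq_aPlus_add, ← Complex.ofReal_pow, Real.sq_sqrt h0]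

theorem mom_sq (hN : 1 ≤ N) (hh : 0 < hbar) (hm : 0 < m) (hω : 0 < ω) (α : Fin N) (k : Fin 3) :
    mom ρ hbar m ω α k ^ 2 =
      ((m * ω * hbar / (3 * (N : ℝ) - 1) : ℝ) : ℂ) •
        (ρ.e (label α k) (label α k) + ρ.e 0 0) := by
  have h0 : 0 ≤ m * ω * hbar / (3 * (N : ℝ) - 1) := by
    have := three_mul_sub_one_pos hN
    positivity
  rw [mom, smul_pow, sq_aPlus_sub, mul_pow, ← Complex.ofReal_pow, Real.sq_sqrt h0, neg_sq,
    Complex.I_sq, smul_neg, neg_one_mul, neg_smul, neg_neg]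

theorem hamiltonian_eq (hN : 1 ≤ N) (hh : 0 < hbar) (hm : 0 < m) (hω : 0 < ω) :
    hamiltonian ρ hbar m ω = ((hbar * ω / (3 * (N : ℝ) - 1) : ℝ) : ℂ) •
      ∑ α : Fin N, ∑ k : Fin 3, (ρ.e (label α k) (label α k) + ρ.e 0 0) := by
  have hd := three_mul_sub_one_pos hN
  have hc : (1 / (2 * (m : ℂ))) * ((m * ω * hbar / (3 * (N : ℝ) - 1) : ℝ) : ℂ) +
      ((m : ℂ) * (ω : ℂ) ^ 2 / 2) * ((hbar / ((3 * (N : ℝ) - 1) * m * ω) : ℝ) : ℂ) =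
      ((hbar * ω / (3 * (N : ℝ) - 1) : ℝ) : ℂ) := by
    have : 1 / (2 * m) * (m * ω * hbar / (3 * (N : ℝ) - 1)) +
        (m * ω ^ 2 / 2) * (hbar / ((3 * (N : ℝ) - 1) * m * ω)) =
        hbar * ω / (3 * (N : ℝ) - 1) := by
      have := hd.ne'
      field_simp
      ring
    exact_mod_cast congrArg (fun x : ℝ => (x : ℂ)) this
  simp only [hamiltonian, pos_sq ρ hN hh hm hω, mom_sq ρ hN hh hm hω, smul_smul, ← add_smul, hc,
    Finset.smul_sum]

theorem anticomm_pos_mom (hN : 1 ≤ N) (hh : 0 < hbar) (hm : 0 < m) (hω : 0 < ω) (α : Fin N)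
    (k l : Fin 3) :
    anticomm (pos ρ hbar m ω α k) (mom ρ hbar m ω α l) =
      (-Complex.I * ((hbar / (3 * (N : ℝ) - 1) : ℝ) : ℂ)) •
        (ρ.e (label α l) (label α k) - ρ.e (label α k) (label α l)) := by
  have hd := three_mul_sub_one_pos hN
  have h1 := aPlus_aPlus ρ α k l
  have h2 := aMinus_aMinus ρ α k l
  have h3 := aPlus_aMinus ρ α k l
  have h4 := aPlus_aMinus ρ α l k
  have hc : Real.sqrt (hbar / ((3 * (N : ℝ) - 1) * m * ω)) *
      Real.sqrt (m * ω * hbar / (3 * (N : ℝ) - 1)) = hbar / (3 * (N : ℝ) - 1) := by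
    rw [← Real.sqrt_mul (by positivity), Real.sqrt_eq_iff_mul_self_eq_of_pos (by positivity)]
    field_simp
  have h5 : (aPlus ρ α k + aMinus ρ α k) * (aPlus ρ α l - aMinus ρ α l) +
      (aPlus ρ α l - aMinus ρ α l) * (aPlus ρ α k + aMinus ρ α k) =
      ρ.e (label α l) (label α k) - ρ.e (label α k) (label α l) := by
    have : (aPlus ρ α k + aMinus ρ α k) * (aPlus ρ α l - aMinus ρ α l) +
        (aPlus ρ α l - aMinus ρ α l) * (aPlus ρ α k + aMinus ρ α k) =
        (aPlus ρ α k * aPlus ρ α l + aPlus ρ α l * aPlus ρ α k) -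
        (aMinus ρ α k * aMinus ρ α l + aMinus ρ α l * aMinus ρ α k) +
        (aPlus ρ α l * aMinus ρ α k + aMinus ρ α k * aPlus ρ α l) -
        (aPlus ρ α k * aMinus ρ α l + aMinus ρ α l * aPlus ρ α k) := by
      simp only [mul_add, add_mul, mul_sub, sub_mul]
      abel
    rw [this, h1, h2, h3, h4]
    simp only [eq_comm (a := l) (b := k)]
    abel
  rw [anticomm, pos, mom, smul_mul_smul_comm, smul_mul_smul_comm,
    mul_comm (-Complex.I * _) (Complex.ofReal _), ← smul_add, h5, ← hc]
  congr 1
  push_cast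
  ring

theorem levi_swap (j k l : Fin 3) : levi j l k = -levi j k l := by
  fin_cases j <;> fin_cases k <;> fin_cases l <;> simp [levi]

/-- The angular momentum is the natural action of `so(3)` on every particle. -/
theorem angMom_eq (hN : 1 ≤ N) (hh : 0 < hbar) (hm : 0 < m) (hω : 0 < ω) (j : Fin 3) :
    angMom ρ hbar m ω j = blockOp ρ (spinMats j) := by
  have hd := three_mul_sub_one_pos hN
  have hc : (-((3 * (N : ℂ) - 1) / (2 * (hbar : ℂ)))) *
      (-Complex.I * ((hbar / (3 * (N : ℝ) - 1) : ℝ) : ℂ)) = Complex.I / 2 := by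
    have h1 : (hbar : ℂ) ≠ 0 := by exact_mod_cast hh.ne'
    have h2 : (3 * (N : ℂ) - 1) ≠ 0 := by exact_mod_cast hd.ne'
    push_cast
    field_simp
  simp only [angMom, blockOp]
  refine Finset.sum_congr rfl fun α _ => ?_
  have h1 : ∑ k : Fin 3, ∑ l : Fin 3, levi j k l • ρ.e (label α l) (label α k) =
      -∑ k : Fin 3, ∑ l : Fin 3, levi j k l • ρ.e (label α k) (label α l) := by
    rw [Finset.sum_comm, ← Finset.sum_neg_distrib]
    refine Finset.sum_congr rfl fun k _ => ?_
    rw [← Finset.sum_neg_distrib]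
    refine Finset.sum_congr rfl fun l _ => ?_
    rw [levi_swap, neg_smul]
  have h2 : ∑ k : Fin 3, ∑ l : Fin 3, spinMats j k l • ρ.e (label α k) (label α l) =
      (-Complex.I) • ∑ k : Fin 3, ∑ l : Fin 3, levi j k l • ρ.e (label α k) (label α l) := by
    simp only [spinMats, mul_smul, Finset.smul_sum]
  simp only [anticomm_pos_mom ρ hN hh hm hω]
  have h3 : ∑ k : Fin 3, ∑ l : Fin 3, levi j k l •
      (-Complex.I * ((hbar / (3 * (N : ℝ) - 1) : ℝ) : ℂ)) •
        (ρ.e (label α l) (label α k) - ρ.e (label α k) (label α l)) =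
      (-Complex.I * ((hbar / (3 * (N : ℝ) - 1) : ℝ) : ℂ)) •
        (∑ k : Fin 3, ∑ l : Fin 3, levi j k l • ρ.e (label α l) (label α k) -
          ∑ k : Fin 3, ∑ l : Fin 3, levi j k l • ρ.e (label α k) (label α l)) := by
    simp only [← Finset.sum_sub_distrib, Finset.smul_sum, ← smul_sub]
    refine Finset.sum_congr rfl fun k _ => Finset.sum_congr rfl fun l _ => ?_
    rw [smul_comm]
  rw [h3, h1, h2, smul_smul, hc]
  module

end Relations

section Transport

/-- An identification of a module with the twisted part of the third tensor power. -/
structure IsModel (ρ : GLModule (3 * N) W) (ζ : ℂ) (Φ : W →ₗ[ℂ] Cube (Fin N × Fin 3)) : Prop where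
  injective : Function.Injective Φ
  range_eq : LinearMap.range Φ = twisted (Fin N × Fin 3) ζ
  map_e : ∀ i j w, Φ (ρ.e i j w) = unitOp (labelEquiv N i) (labelEquiv N j) (Φ w)

variable {ρ : GLModule (3 * N) W} {Φ : W →ₗ[ℂ] Cube (Fin N × Fin 3)}

theorem IsModel.mem_twisted (h : IsModel ρ ζ Φ) (w : W) : Φ w ∈ twisted (Fin N × Fin 3) ζ :=
  h.range_eq ▸ LinearMap.mem_range_self Φ w

theorem IsModel.finrank_comap (h : IsModel ρ ζ Φ) (S : Submodule ℂ (Cube (Fin N × Fin 3))) :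
    finrank ℂ (S.comap Φ) =
      finrank ℂ (twisted (Fin N × Fin 3) ζ ⊓ S : Submodule ℂ (Cube (Fin N × Fin 3))) := by
  rw [← h.range_eq, ← Submodule.map_comap_eq]
  exact (Submodule.equivMapOfInjective Φ h.injective _).finrank_eq

theorem eigenspace_eq_comap {X : Type*} [AddCommGroup X] [Module ℂ X] {Φ : W →ₗ[ℂ] X}
    (hΦ : Function.Injective Φ) {S : End ℂ W} {T : End ℂ X} (h : ∀ w, Φ (S w) = T (Φ w)) (μ : ℂ) :
    S.eigenspace μ = (T.eigenspace μ).comap Φ := by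
  ext w
  rw [Submodule.mem_comap, End.mem_eigenspace_iff, End.mem_eigenspace_iff, ← h, ← map_smul,
    hΦ.eq_iff]

theorem IsModel.map_e_zero (h : IsModel ρ ζ Φ) (w : W) :
    Φ (ρ.e 0 0 w) = unitOp none none (Φ w) := by
  rw [h.map_e, labelEquiv_zero]

theorem IsModel.map_e_label (h : IsModel ρ ζ Φ) (α : Fin N) (k l : Fin 3) (w : W) :
    Φ (ρ.e (label α k) (label α l) w) = unitOp (some (α, k)) (some (α, l)) (Φ w) := by
  rw [h.map_e, labelEquiv_label, labelEquiv_label]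

theorem blockMat_eq_sum (A : Matrix (Fin 3) (Fin 3) ℂ) :
    blockMat N A 0 = ∑ α : Fin N, ∑ k : Fin 3, ∑ l : Fin 3,
      A k l • Matrix.single (some (α, k)) (some (α, l)) 1 := by
  ext a b
  simp only [Matrix.sum_apply, Matrix.smul_apply, Matrix.single_apply, smul_eq_mul]
  rcases a with _ | ⟨β, i⟩ <;> rcases b with _ | ⟨γ, j⟩
  · simp [blockMat]
  · simp [blockMat]
  · simp [blockMat]
  · rw [Finset.sum_eq_single β, Finset.sum_eq_single i, Finset.sum_eq_single j]
    · simp [blockMat]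
    · intro l _ hl
      simp [hl]
    · simp
    · intro k _ hk
      simp [hk]
    · simp
    · intro α _ hα
      simp [hα]
    · simp

theorem IsModel.map_blockOp (h : IsModel ρ ζ Φ) (A : Matrix (Fin 3) (Fin 3) ℂ) (w : W) :
    Φ (blockOp ρ A w) = deriv₃ (blockMat N A 0) (Φ w) := by
  have h1 : deriv₃ (blockMat N A 0) = deriv₃Lin N (blockMat N A 0) := rfl
  rw [h1, blockMat_eq_sum]
  simp only [blockOp, map_sum, map_smul, LinearMap.sum_apply, LinearMap.smul_apply, h.map_e_label]
  refine Finset.sum_congr rfl fun α _ => Finset.sum_congr rfl fun k _ =>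
    Finset.sum_congr rfl fun l _ => ?_
  rw [unitOp_eq_deriv₃ (by simp [deg])]
  rfl

theorem deriv₃_commutator (X Y : Matrix (ParticleLabel N) (ParticleLabel N) ℂ) :
    deriv₃ X * deriv₃ Y - deriv₃ Y * deriv₃ X = deriv₃ (X * Y - Y * X) := by
  have hs : deriv₃ (X * Y - Y * X) = deriv₃ (X * Y) - deriv₃ (Y * X) :=
    map_sub (deriv₃Lin N) _ _
  rw [hs]
  simp only [deriv₃, ← map_mul, ← map_sub]
  congr 1
  simp only [add_mul, mul_add, tri_mul, one_mul, mul_one]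
  abel

theorem spinMats_commutator (j : Fin 3) :
    spinMats j * spinMats (j + 1) - spinMats (j + 1) * spinMats j =
      Complex.I • spinMats (j + 2) := by
  have hI : Complex.I * Complex.I = -1 := Complex.I_mul_I
  ext k l
  fin_cases j <;> fin_cases k <;> fin_cases l <;>
    simp [spinMats, levi, Matrix.mul_apply, hI]

theorem blockMat_sub_smul (A B C : Matrix (Fin 3) (Fin 3) ℂ) (r : ℂ) (h : A - B = r • C) :
    blockMat N A 0 - blockMat N B 0 = r • blockMat N C 0 := by
  ext a b
  rcases a with _ | ⟨α, k⟩ <;> rcases b with _ | ⟨β, l⟩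
  · simp [blockMat]
  · simp [blockMat]
  · simp [blockMat]
  · have := congrFun (congrFun h k) l
    by_cases hαβ : α = β <;> simp_all [blockMat]

theorem IsModel.isAngular (h : IsModel ρ ζ Φ) : IsAngular fun j => blockOp ρ (spinMats j) := by
  intro j
  refine LinearMap.ext fun w => h.injective ?_
  have h1 := deriv₃_commutator (blockMat N (spinMats j) 0) (blockMat N (spinMats (j + 1)) 0)
  rw [blockMat_mul, blockMat_mul, mul_zero,
    blockMat_sub_smul _ _ _ _ (spinMats_commutator j), deriv₃_smul] at h1
  simp only [LinearMap.sub_apply, End.mul_apply, map_sub, h.map_blockOp, LinearMap.smul_apply,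
    map_smul]
  exact congrArg (fun T : End ℂ (Cube (Fin N × Fin 3)) => T (Φ w)) h1

theorem IsModel.blockOp_e_zero (h : IsModel ρ ζ Φ) (A : Matrix (Fin 3) (Fin 3) ℂ) (w : W) :
    ρ.e 0 0 (blockOp ρ A w) = blockOp ρ A (ρ.e 0 0 w) := by
  apply h.injective
  rw [h.map_e_zero, h.map_blockOp, h.map_blockOp, h.map_e_zero,
    unitOp_eq_deriv₃ (by simp [deg]), ← blockMat_zero_one]
  have h1 := deriv₃_commutator (blockMat N 0 1) (blockMat N A 0)
  rw [blockMat_mul, blockMat_mul, zero_mul, mul_zero, mul_zero, zero_mul, sub_self] at h1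
  have h2 : deriv₃ (0 : Matrix (ParticleLabel N) (ParticleLabel N) ℂ) = 0 := map_zero (deriv₃Lin N)
  rw [h2, sub_eq_zero] at h1
  exact congrArg (fun T : End ℂ (Cube (Fin N × Fin 3)) => T (Φ w)) h1

theorem spinMats_two : spinMats 2 = spinMat := by
  ext k l
  fin_cases k <;> fin_cases l <;> simp [spinMats, spinMat, levi]

/-- The level `q` of the module: the eigenspace of `e 0 0` for the eigenvalue `2 - q`. -/
def levelSpace (ρ : GLModule (3 * N) W) (q : ℕ) : Submodule ℂ W :=
  (ρ.e 0 0).eigenspace (2 - (q : ℂ))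

theorem IsModel.levelSpace_eq (h : IsModel ρ ζ Φ) (q : ℕ) :
    levelSpace ρ q =
      ((unitOp none none : End ℂ (Cube (Fin N × Fin 3))).eigenspace (2 - (q : ℂ))).comap Φ :=
  eigenspace_eq_comap h.injective h.map_e_zero _

theorem IsModel.finrank_levelSpace (h : IsModel ρ ζ Φ) (q : ℕ) :
    finrank ℂ (levelSpace ρ q) = finrank ℂ (twistedOn (ι := Fin N × Fin 3) ζ (IsLevel q)) := by
  rw [h.levelSpace_eq, h.finrank_comap, twisted_inf_eigenspace]

theorem IsModel.finrank_weight (h : IsModel ρ ζ Φ) (q j : ℕ) :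
    finrank ℂ (levelSpace ρ q ⊓ (blockOp ρ (spinMats 2)).eigenspace (j : ℂ) : Submodule ℂ W) =
      finrank ℂ (twistedOn (ι := Fin N × Fin 3) ζ (IsLevelSpin q ((j : ℕ) : ℤ))) := by
  rw [h.levelSpace_eq, eigenspace_eq_comap h.injective (h.map_blockOp _) _, ← Submodule.comap_inf,
    h.finrank_comap, ← inf_assoc, spinMats_two, ← finrank_weightSpace,
    Int.cast_natCast]

theorem IsModel.mem_levelSpace_iff (h : IsModel ρ ζ Φ) (q : ℕ) (w : W) :
    w ∈ levelSpace ρ q ↔ ∀ x, ¬ IsLevel q x → Φ w x = 0 := by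
  rw [h.levelSpace_eq, Submodule.mem_comap, mem_eigenspace_unitOp_none]

theorem IsModel.sum_e (h : IsModel ρ ζ Φ) : ∑ i, ρ.e i i = (3 : ℂ) • 1 := by
  refine LinearMap.ext fun w => h.injective ?_
  simp only [LinearMap.sum_apply, map_sum, h.map_e, LinearMap.smul_apply, End.one_apply, map_smul]
  rw [Equiv.sum_comp (labelEquiv N) fun a => unitOp a a (Φ w)]
  ext ⟨a, b, c⟩
  simp only [Finset.sum_apply, unitOp_diag, ← Finset.sum_mul, Finset.sum_add_distrib,
    Finset.sum_ite_eq, Finset.mem_univ, if_true, Pi.smul_apply, smul_eq_mul]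
  norm_num

/-- On the third tensor power `e 0 0` counts the even labels of a triple, and three of them occur
only in a constant triple, at which the functions in the twisted part vanish. -/
theorem IsModel.e_zero_cubic (hζ : ζ ^ 2 + ζ + 1 = 0) (h : IsModel ρ ζ Φ) (w : W) :
    ρ.e 0 0 (ρ.e 0 0 (ρ.e 0 0 w)) = (3 : ℂ) • ρ.e 0 0 (ρ.e 0 0 w) - (2 : ℂ) • ρ.e 0 0 w := by
  apply h.injective
  simp only [map_sub, map_smul, h.map_e_zero]
  ext x
  simp only [Pi.sub_apply, Pi.smul_apply, unitOp_none, smul_eq_mul]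
  have hx : evens x = 0 ∨ evens x = 1 ∨ evens x = 2 ∨ Φ w x = 0 := by
    obtain ⟨a, b, c⟩ := x
    rcases a with _ | a <;> rcases b with _ | b <;> rcases c with _ | c <;> simp [evens]
    exact apply_diag_eq_zero (ne_one_of_root hζ) (h.mem_twisted w) none
  rcases hx with hx | hx | hx | hx <;> rw [hx] <;> push_cast <;> ring

/-- The three levels span the module. -/
theorem IsModel.iSup_levelSpace (hζ : ζ ^ 2 + ζ + 1 = 0) (h : IsModel ρ ζ Φ) :
    (⨆ q : Fin 3, levelSpace ρ (q : ℕ)) = ⊤ := by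
  refine eq_top_iff.mpr fun w _ => ?_
  have hc := h.e_zero_cubic hζ w
  set E := ρ.e 0 0 with hE
  have h0 : (1 / 2 : ℂ) • (E (E w) - E w) ∈ levelSpace ρ 0 := by
    rw [levelSpace, End.mem_eigenspace_iff, ← hE]
    simp only [map_smul, map_sub, hc]
    push_cast
    module
  have h1 : (-1 : ℂ) • (E (E w) - (2 : ℂ) • E w) ∈ levelSpace ρ 1 := by
    rw [levelSpace, End.mem_eigenspace_iff, ← hE]
    simp only [map_smul, map_sub, hc]
    push_cast
    module
  have h2 : (1 / 2 : ℂ) • (E (E w) - (3 : ℂ) • E w + (2 : ℂ) • w) ∈ levelSpace ρ 2 := by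
    rw [levelSpace, End.mem_eigenspace_iff, ← hE]
    simp only [map_smul, map_sub, map_add, hc]
    push_cast
    module
  have hsum : w = (1 / 2 : ℂ) • (E (E w) - E w) + (-1 : ℂ) • (E (E w) - (2 : ℂ) • E w) +
      (1 / 2 : ℂ) • (E (E w) - (3 : ℂ) • E w + (2 : ℂ) • w) := by module
  rw [hsum]
  refine Submodule.add_mem _ (Submodule.add_mem _ ?_ ?_) ?_
  · exact Submodule.mem_iSup_of_mem (p := fun q : Fin 3 => levelSpace ρ (q : ℕ)) 0 h0
  · exact Submodule.mem_iSup_of_mem (p := fun q : Fin 3 => levelSpace ρ (q : ℕ)) 1 h1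
  · exact Submodule.mem_iSup_of_mem (p := fun q : Fin 3 => levelSpace ρ (q : ℕ)) 2 h2

end Transport

section Position

/-- The number of even labels and labels `p` in a triple. -/
def posCount {κ : Type} [DecidableEq κ] (p : κ) (x : Option κ × Option κ × Option κ) : ℕ :=
  evens x + ((if x.1 = some p then 1 else 0) + (if x.2.1 = some p then 1 else 0) +
    (if x.2.2 = some p then 1 else 0))

theorem posCount_rotate {κ : Type} [DecidableEq κ] (p : κ) (a b c : Option κ) :
    posCount p (c, a, b) = posCount p (a, b, c) := by
  simp only [posCount, evens_rotate]
  ring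

/-- The values of the counting function on the nonconstant triples of a given level. -/
theorem exists_posCount_iff (α : Fin N) (i : Fin 3) (q : Fin 3) (r : ℕ) :
    (∃ a b c : ParticleLabel N, IsLevel (q : ℕ) (a, b, c) ∧ ¬ (c = a ∧ a = b) ∧
      posCount (α, i) (a, b, c) = r) ↔
    r ∈ (![{2, 3}, {1, 2, 3}, {0, 1, 2}] : Fin 3 → Set ℕ) q := by
  constructor
  · rintro ⟨a, b, c, hl, hd, rfl⟩
    rcases a with _ | a <;> rcases b with _ | b <;> rcases c with _ | c <;>
      fin_cases q <;> simp [IsLevel, evens] at hl <;>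
      simp only [posCount, evens] <;> split_ifs <;> simp_all
  · have h1 : (i + 1 : Fin 3) ≠ i := by fin_cases i <;> decide
    have h2 : (i + 2 : Fin 3) ≠ i := by fin_cases i <;> decide
    have h3 : (i + 1 : Fin 3) ≠ i + 2 := by fin_cases i <;> decide
    intro hr
    fin_cases q
    · rcases hr with rfl | rfl
      · exact ⟨none, none, some (α, i + 1), by simp [IsLevel, evens], by simp,
          by simp [posCount, evens, h1]⟩
      · exact ⟨none, none, some (α, i), by simp [IsLevel, evens], by simp,
          by simp [posCount, evens]⟩
    · rcases hr with rfl | rfl | rfl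
      · exact ⟨none, some (α, i + 1), some (α, i + 1), by simp [IsLevel, evens], by simp,
          by simp [posCount, evens, h1]⟩
      · exact ⟨none, some (α, i), some (α, i + 1), by simp [IsLevel, evens], by simp,
          by simp [posCount, evens, h1]⟩
      · exact ⟨none, some (α, i), some (α, i), by simp [IsLevel, evens], by simp,
          by simp [posCount, evens]⟩
    · rcases hr with rfl | rfl | rfl
      · exact ⟨some (α, i + 1), some (α, i + 1), some (α, i + 2), by simp [IsLevel, evens],
          by simp, by simp [posCount, evens, h1, h2]⟩
      · exact ⟨some (α, i), some (α, i + 1), some (α, i + 1), by simp [IsLevel, evens],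
          by simp, by simp [posCount, evens, h1]⟩
      · exact ⟨some (α, i), some (α, i), some (α, i + 1), by simp [IsLevel, evens],
          by simp, by simp [posCount, evens, h1]⟩

variable {ρ : GLModule (3 * N) W} {Φ : W →ₗ[ℂ] Cube (Fin N × Fin 3)}

/-- The eigenvalues of `e j j + e 0 0` on a level. Eigenvectors for all admissible values are the
functions supported on a single orbit of the cyclic group. -/
theorem IsModel.exists_eigenvector_iff (hζ : ζ ^ 2 + ζ + 1 = 0) (h : IsModel ρ ζ Φ) (α : Fin N)
    (i : Fin 3) (q : Fin 3) (μ : ℂ) :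
    (∃ w ∈ levelSpace ρ (q : ℕ), w ≠ 0 ∧
      (ρ.e (label α i) (label α i) + ρ.e 0 0) w = μ • w) ↔
    ∃ r ∈ (![{2, 3}, {1, 2, 3}, {0, 1, 2}] : Fin 3 → Set ℕ) q, (r : ℂ) = μ := by
  have hop : ∀ w x, Φ ((ρ.e (label α i) (label α i) + ρ.e 0 0) w) x =
      (posCount (α, i) x : ℂ) * Φ w x := by
    rintro w ⟨a, b, c⟩
    rw [LinearMap.add_apply, map_add, h.map_e_label, h.map_e_zero, Pi.add_apply, unitOp_diag,
      unitOp_none]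
    simp only [posCount]
    push_cast
    ring
  constructor
  · rintro ⟨w, hw, hw0, hwμ⟩
    have hne : Φ w ≠ 0 := fun h0 => hw0 (h.injective (by rw [h0, map_zero]))
    obtain ⟨⟨a, b, c⟩, hx⟩ := Function.ne_iff.mp hne
    refine ⟨posCount (α, i) (a, b, c), ?_, ?_⟩
    · refine (exists_posCount_iff α i q _).mp ⟨a, b, c, ?_, ?_, rfl⟩
      · by_contra hl
        exact hx ((h.mem_levelSpace_iff _ _).mp hw _ hl)
      · rintro ⟨rfl, rfl⟩
        exact hx (apply_diag_eq_zero (ne_one_of_root hζ) (h.mem_twisted w) _)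
    · have h1 := hop w (a, b, c)
      rw [hwμ, map_smul, Pi.smul_apply, smul_eq_mul] at h1
      exact (mul_right_cancel₀ hx h1).symm
  · rintro ⟨r, hr, rfl⟩
    obtain ⟨a, b, c, hl, hd, hr⟩ := (exists_posCount_iff α i q r).mpr hr
    have hmem : orbitVec ζ a b c ∈ LinearMap.range Φ := by
      rw [h.range_eq]
      exact orbitVec_mem hζ a b c
    obtain ⟨w, hw⟩ := hmem
    have hsup : ∀ x, Φ w x ≠ 0 → IsLevel (q : ℕ) x ∧ posCount (α, i) x = r := by
      intro x hx
      rw [hw] at hx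
      rcases orbitVec_support hx with rfl | rfl | rfl
      · exact ⟨hl, hr⟩
      · exact ⟨(rotInvariant_isLevel _ _ _ _).mp hl, (posCount_rotate _ _ _ _).symm.trans hr⟩
      · exact ⟨(rotInvariant_isLevel _ _ _ _).mpr hl, (posCount_rotate _ _ _ _).trans hr⟩
    refine ⟨w, (h.mem_levelSpace_iff _ _).mpr fun x hx => ?_, ?_, h.injective ?_⟩
    · by_contra hne
      exact hx (hsup x hne).1
    · rintro rfl
      have h1 := orbitVec_self (ζ := ζ) a b c hd
      rw [← hw, map_zero] at h1
      simp at h1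
    · ext x
      rw [hop, map_smul, Pi.smul_apply, smul_eq_mul]
      by_cases hx : Φ w x = 0
      · rw [hx, mul_zero, mul_zero]
      · rw [(hsup x hx).2]

end Position

end Realization

/-! ### Spectra and multiplicities -/

section Final

theorem exists_cube_root : ∃ ζ : ℂ, ζ ^ 2 + ζ + 1 = 0 := by
  have h3 : ((Real.sqrt 3 : ℝ) : ℂ) ^ 2 = 3 := by
    rw [← Complex.ofReal_pow, Real.sq_sqrt (by norm_num)]
    norm_num
  refine ⟨(-1 + (Real.sqrt 3 : ℝ) * Complex.I) / 2, ?_⟩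
  linear_combination (1 / 4 * Complex.I ^ 2 : ℂ) * h3 + (3 / 4 : ℂ) * Complex.I_sq

variable {N : ℕ} {ζ : ℂ} {W : Type*} [AddCommGroup W] [Module ℂ W]
  {ρ : GLModule (3 * N) W} {Φ : W →ₗ[ℂ] Cube (Fin N × Fin 3)} {hbar m ω : ℝ}

/-- Every simple module with the highest weight in question is the twisted part of the third tensor
power. -/
theorem exists_isModel (hN : 1 ≤ N) (hζ : ζ ^ 2 + ζ + 1 = 0) (hs : ρ.IsSimple)
    (hw : ρ.HasHighestWeight (weight21 (3 * N))) :
    ∃ Φ : W →ₗ[ℂ] Cube (Fin N × Fin 3), IsModel ρ ζ Φ := by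
  have hn : 1 ≤ 3 * N := by omega
  have h0 := labelEquiv_zero (N := N)
  obtain ⟨Φ, h1, h2, h3⟩ := hs.exists_intertwiner hw (isBracket_cubeOp h0)
    (isInvariant_twisted (ζ := ζ) (labelEquiv N))
    (fun U hU hUi => twisted_irreducible h0 hζ hn U hU hUi)
    (t := topVec (labelEquiv N) ζ) (orbitVec_mem hζ _ _ _)
    (fun h => by
      have := topVec_apply (ζ := ζ) h0 hn
      rw [h] at this
      simp at this)
    (topVec_isHighestWeightVector h0 hζ hn)
  exact ⟨Φ, h1, h2, h3⟩

theorem sum_labels {X : Type*} [AddCommMonoid X] (F : Fin (3 * N + 1) → X) :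
    ∑ i, F i = F 0 + ∑ α : Fin N, ∑ k : Fin 3, F (label α k) := by
  have h1 : ∀ a, (labelEquiv N).symm (some a) = label a.1 a.2 := fun a => by
    rw [Equiv.symm_apply_eq, labelEquiv_label]
  have h0 : (labelEquiv N).symm none = 0 := by rw [Equiv.symm_apply_eq, labelEquiv_zero]
  rw [← Equiv.sum_comp (labelEquiv N).symm, Fintype.sum_option, h0, Fintype.sum_prod_type]
  simp only [h1]

/-- The Hamiltonian is an affine function of `e 0 0`, because the sum of all `e i i` is `3`. -/
theorem IsModel.hamiltonian_apply (h : IsModel ρ ζ Φ) (hN : 1 ≤ N) (hh : 0 < hbar) (hm : 0 < m)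
    (hω : 0 < ω) (w : W) :
    hamiltonian ρ hbar m ω w = ((hbar * ω : ℝ) : ℂ) • ρ.e 0 0 w +
      ((hbar * ω * (3 / (3 * (N : ℝ) - 1)) : ℝ) : ℂ) • w := by
  have hd := three_mul_sub_one_pos hN
  have hd' : (3 * (N : ℂ) - 1) ≠ 0 := by exact_mod_cast hd.ne'
  have h1 := h.sum_e
  rw [sum_labels (fun i => ρ.e i i)] at h1
  have h2 : ∑ α : Fin N, ∑ k : Fin 3, (ρ.e (label α k) (label α k) + ρ.e 0 0) =
      (3 : ℂ) • 1 + (3 * (N : ℂ) - 1) • ρ.e 0 0 := by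
    simp only [Finset.sum_add_distrib, Finset.sum_const, Finset.card_univ, Fintype.card_fin]
    rw [← h1, ← Nat.cast_smul_eq_nsmul ℂ, ← Nat.cast_smul_eq_nsmul ℂ]
    push_cast
    module
  rw [hamiltonian_eq ρ hN hh hm hω, h2]
  simp only [LinearMap.smul_apply, LinearMap.add_apply, End.one_apply, smul_add, smul_smul]
  rw [add_comm]
  congr 2
  · push_cast
    field_simp
  · push_cast
    field_simp

theorem energy_eq (hN : 1 ≤ N) (q : ℕ) :
    energy N hbar ω q = hbar * ω * (2 - q) + hbar * ω * (3 / (3 * (N : ℝ) - 1)) := by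
  have hd := (three_mul_sub_one_pos hN).ne'
  have h : (6 * (N : ℝ) + 1) / (3 * N - 1) = 2 + 3 / (3 * N - 1) := by
    rw [div_eq_iff hd, add_mul, div_mul_cancel₀ _ hd]
    ring
  rw [energy, h]
  ring

theorem IsModel.eigenspace_hamiltonian (h : IsModel ρ ζ Φ) (hN : 1 ≤ N) (hh : 0 < hbar)
    (hm : 0 < m) (hω : 0 < ω) (q : ℕ) :
    (hamiltonian ρ hbar m ω).eigenspace (energy N hbar ω q : ℂ) = levelSpace ρ q := by
  have hc : ((hbar * ω : ℝ) : ℂ) ≠ 0 := by exact_mod_cast (mul_pos hh hω).ne'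
  ext w
  rw [levelSpace, End.mem_eigenspace_iff, End.mem_eigenspace_iff,
    h.hamiltonian_apply hN hh hm hω, energy_eq hN, Complex.ofReal_add, add_smul, add_left_inj,
    Complex.ofReal_mul (hbar * ω) (2 - q), mul_smul, (smul_right_injective W hc).eq_iff]
  push_cast
  rfl

/-- The multiplicities of the multiplets of angular momentum `j` on the level `q`. The parameter `c`
stands for the natural number `(N ^ 3 - N) / 3`; it enters by the equation `3 * c + N = N ^ 3`, and
this avoids division in `ℕ`. -/
def multiplicity (N c : ℕ) : ℕ → ℕ → ℕ
  | 0, 1 => N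
  | 1, 0 => N ^ 2
  | 1, 1 => N ^ 2
  | 1, 2 => N ^ 2
  | 2, 0 => c
  | 2, 1 => N ^ 3
  | 2, 2 => 2 * c + N
  | 2, 3 => c
  | _, _ => 0

theorem multiplicity_eq_zero (c q j : ℕ) (h : 3 ≤ q ∨ 4 ≤ j) : multiplicity N c q j = 0 := by
  unfold multiplicity
  split <;> first | rfl | omega

/-- The multiplicity of `j` is the difference of the dimensions of the weight spaces for the weights
`j` and `j + 1`. -/
theorem IsModel.hasAngularContent [FiniteDimensional ℂ W] (hζ : ζ ^ 2 + ζ + 1 = 0)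
    (h : IsModel ρ ζ Φ) {c : ℕ} (hc : 3 * c + N = N ^ 3) (q : ℕ) :
    HasAngularContent (fun j => blockOp ρ (spinMats j)) (levelSpace ρ q) (multiplicity N c q) := by
  -- the weights on the three levels are at most `3`, and there are no further levels
  refine h.isAngular.hasAngularContent _ ?_ _ (if q < 3 then 4 else 0) ?_ ?_ ?_
  · intro k u hu
    rw [levelSpace, End.mem_eigenspace_iff] at hu ⊢
    rw [h.blockOp_e_zero, hu, map_smul]
  · intro j hj
    apply multiplicity_eq_zero
    split_ifs at hj <;> omega
  · intro j hj
    split_ifs at hj with hq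
    · rw [h.finrank_weight, h.finrank_weight]
      have h1 := finrank_levelSpin_values (N := N) hζ ⟨q, hq⟩ ⟨j, by omega⟩
      have h2 := finrank_levelSpin_values (N := N) hζ ⟨q, hq⟩ ⟨j + 1, by omega⟩
      simp only at h1 h2
      generalize finrank ℂ (twistedOn (ι := Fin N × Fin 3) ζ (IsLevelSpin q ((j : ℕ) : ℤ))) = d
        at h1 ⊢
      generalize finrank ℂ (twistedOn (ι := Fin N × Fin 3) ζ (IsLevelSpin q ((j + 1 : ℕ) : ℤ))) = d'
        at h2 ⊢
      interval_cases q <;> interval_cases j <;> simp [multiplicity] at h1 h2 ⊢ <;> omega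
    · omega
  · rw [h.finrank_levelSpace]
    obtain ⟨h0, h1, h2⟩ := finrank_level_values (N := N) hζ
    split_ifs with hq
    · interval_cases q
      · simp [Finset.sum_range_succ, multiplicity, h0]
        ring
      · simp [Finset.sum_range_succ, multiplicity, h1]
        ring
      · simp [Finset.sum_range_succ, multiplicity]
        omega
    · have hbot : twistedOn (ι := Fin N × Fin 3) ζ (IsLevel q) = ⊥ := by
        rw [eq_bot_iff]
        intro f hf
        refine (Submodule.mem_bot ℂ).mpr (funext fun x => hf.2 x fun hx => ?_)
        have : evens x + q = 2 := hx
        omega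
      simp [hbot]

theorem hasSum_multiplicity {c : ℕ} (hc : 3 * c + N = N ^ 3) (Q J : ℂ) :
    HasSum (fun p : ℕ × ℕ => (multiplicity N c p.1 p.2 : ℂ) * Q ^ p.1 * J ^ p.2)
      ((N : ℂ) * J + (N : ℂ) ^ 2 * (1 + J + J ^ 2) * Q +
        ((N : ℂ) * ((N : ℂ) ^ 2 - 1) / 3 + (N : ℂ) ^ 3 * J +
          (N : ℂ) * (2 * (N : ℂ) ^ 2 + 1) / 3 * J ^ 2 +
          (N : ℂ) * ((N : ℂ) ^ 2 - 1) / 3 * J ^ 3) * Q ^ 2) := by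
  have hc' : (c : ℂ) = ((N : ℂ) ^ 3 - N) / 3 := by
    have : (3 * c + N : ℂ) = (N : ℂ) ^ 3 := by exact_mod_cast hc
    rw [← this]
    ring
  have hs : HasSum (fun p : ℕ × ℕ => (multiplicity N c p.1 p.2 : ℂ) * Q ^ p.1 * J ^ p.2)
      (∑ p ∈ Finset.range 3 ×ˢ Finset.range 4,
        (multiplicity N c p.1 p.2 : ℂ) * Q ^ p.1 * J ^ p.2) :=
    hasSum_sum_of_ne_finset_zero (by
      intro p hp
      rw [Finset.mem_product, Finset.mem_range, Finset.mem_range, not_and_or, not_lt,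
        not_lt] at hp
      rw [multiplicity_eq_zero c _ _ hp]
      simp)
  convert hs using 1
  simp only [Finset.sum_product, Finset.sum_range_succ, Finset.sum_range_zero, multiplicity]
  push_cast
  rw [hc']
  ring

theorem mem_spectrum_iff_exists_eigenvector [FiniteDimensional ℂ W] {T : End ℂ W} {μ : ℂ} :
    μ ∈ spectrum ℂ T ↔ ∃ w, w ≠ 0 ∧ T w = μ • w := by
  rw [← End.hasEigenvalue_iff_mem_spectrum]
  constructor
  · intro h
    obtain ⟨w, hw⟩ := h.exists_hasEigenvector
    exact ⟨w, hw.2, hw.apply_eq_smul⟩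
  · rintro ⟨w, hw, h⟩
    exact End.hasEigenvalue_of_hasEigenvector ⟨End.mem_eigenspace_iff.mpr h, hw⟩

/-- The eigenvalues of `e 0 0` are the roots `0`, `1`, `2` of the cubic polynomial that annihilates
it, and all of them occur. -/
theorem IsModel.spectrum_hamiltonian [FiniteDimensional ℂ W] (hζ : ζ ^ 2 + ζ + 1 = 0)
    (h : IsModel ρ ζ Φ) (hN : 1 ≤ N) (hh : 0 < hbar) (hm : 0 < m) (hω : 0 < ω) :
    spectrum ℂ (hamiltonian ρ hbar m ω) =
      {(energy N hbar ω 0 : ℂ), (energy N hbar ω 1 : ℂ), (energy N hbar ω 2 : ℂ)} := by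
  have hc : ((hbar * ω : ℝ) : ℂ) ≠ 0 := by exact_mod_cast (mul_pos hh hω).ne'
  have hE : ∀ q : ℕ, (energy N hbar ω q : ℂ) = ((hbar * ω : ℝ) : ℂ) * (2 - q) +
      ((hbar * ω * (3 / (3 * (N : ℝ) - 1)) : ℝ) : ℂ) := by
    intro q
    rw [energy_eq hN]
    push_cast
    ring
  ext μ
  rw [mem_spectrum_iff_exists_eigenvector]
  constructor
  · rintro ⟨w, hw, hμ⟩
    rw [h.hamiltonian_apply hN hh hm hω] at hμ
    set a : ℂ := ((hbar * ω : ℝ) : ℂ) with ha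
    set b : ℂ := ((hbar * ω * (3 / (3 * (N : ℝ) - 1)) : ℝ) : ℂ) with hb
    have he : ρ.e 0 0 w = ((μ - b) / a) • w := by
      rw [div_eq_inv_mul, mul_smul, sub_smul, ← hμ, add_sub_cancel_right, smul_smul,
        inv_mul_cancel₀ hc, one_smul]
    set lam := (μ - b) / a with hlam
    have h3 := h.e_zero_cubic hζ w
    simp only [he, map_smul, smul_smul] at h3
    rw [← sub_smul, ← sub_eq_zero, ← sub_smul] at h3
    have h4 := (smul_eq_zero.mp h3).resolve_right hw
    have h5 : lam * ((lam - 1) * (lam - 2)) = 0 := by linear_combination h4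
    have hμ' : μ = a * lam + b := by
      rw [hlam]
      field_simp
      ring
    simp only [Set.mem_insert_iff, Set.mem_singleton_iff, hE]
    rcases mul_eq_zero.mp h5 with h6 | h6
    · right; right
      rw [hμ', h6]
      push_cast
      ring
    · rcases mul_eq_zero.mp h6 with h7 | h7
      · right; left
        rw [hμ', sub_eq_zero.mp h7]
        push_cast
        ring
      · left
        rw [hμ', sub_eq_zero.mp h7]
        push_cast
        ring
  · have key : ∀ q : Fin 3, ∃ w, w ≠ 0 ∧
        hamiltonian ρ hbar m ω w = (energy N hbar ω (q : ℕ) : ℂ) • w := by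
      intro q
      have hne : ∃ r, r ∈ (![{2, 3}, {1, 2, 3}, {0, 1, 2}] : Fin 3 → Set ℕ) q := by
        fin_cases q
        · exact ⟨2, by simp⟩
        · exact ⟨2, by simp⟩
        · exact ⟨2, by simp⟩
      obtain ⟨r, hr⟩ := hne
      obtain ⟨w, hw, hw0, -⟩ := (h.exists_eigenvector_iff hζ ⟨0, hN⟩ 0 q r).mpr ⟨r, hr, rfl⟩
      rw [← h.eigenspace_hamiltonian hN hh hm hω] at hw
      exact ⟨w, hw0, End.mem_eigenspace_iff.mp hw⟩
    rintro (rfl | rfl | rfl)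
    · exact key 0
    · exact key 1
    · exact key 2

/-- The squared position component is a multiple of `e j j + e 0 0`, so its spectrum on a level
consists of the corresponding multiples of the admissible counts. -/
theorem IsModel.spectrum_pos_sq [FiniteDimensional ℂ W] (hζ : ζ ^ 2 + ζ + 1 = 0)
    (h : IsModel ρ ζ Φ) (hN : 1 ≤ N) (hh : 0 < hbar) (hm : 0 < m) (hω : 0 < ω) (α : Fin N)
    (i : Fin 3) (q : Fin 3) :
    ∃ h' : ∀ v ∈ levelSpace ρ (q : ℕ), (pos ρ hbar m ω α i ^ 2) v ∈ levelSpace ρ (q : ℕ),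
      spectrum ℂ (LinearMap.restrict (pos ρ hbar m ω α i ^ 2) h') =
        (fun r : ℕ => ((hbar * r / ((3 * (N : ℝ) - 1) * m * ω) : ℝ) : ℂ)) ''
          ((![{2, 3}, {1, 2, 3}, {0, 1, 2}] : Fin 3 → Set ℕ) q) := by
  have hd := three_mul_sub_one_pos hN
  have hC0 : ((hbar / ((3 * (N : ℝ) - 1) * m * ω) : ℝ) : ℂ) ≠ 0 := by
    have : 0 < hbar / ((3 * (N : ℝ) - 1) * m * ω) := by positivity
    exact_mod_cast this.ne'
  have hpos : pos ρ hbar m ω α i ^ 2 = ((hbar / ((3 * (N : ℝ) - 1) * m * ω) : ℝ) : ℂ) •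
      (ρ.e (label α i) (label α i) + ρ.e 0 0) := pos_sq ρ hN hh hm hω α i
  have hinv : ∀ v ∈ levelSpace ρ (q : ℕ),
      (pos ρ hbar m ω α i ^ 2) v ∈ levelSpace ρ (q : ℕ) := by
    intro v hv
    rw [hpos, LinearMap.smul_apply]
    refine Submodule.smul_mem _ _ ?_
    rw [h.mem_levelSpace_iff] at hv ⊢
    intro x hx
    obtain ⟨a, b, c⟩ := x
    rw [LinearMap.add_apply, map_add, h.map_e_label, h.map_e_zero, Pi.add_apply, unitOp_diag,
      unitOp_none, hv _ hx]
    ring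
  refine ⟨hinv, ?_⟩
  set C : ℂ := ((hbar / ((3 * (N : ℝ) - 1) * m * ω) : ℝ) : ℂ) with hC
  have hval : ∀ r : ℕ, ((hbar * r / ((3 * (N : ℝ) - 1) * m * ω) : ℝ) : ℂ) = C * r := by
    intro r
    rw [hC]
    push_cast
    ring
  ext μ
  rw [mem_spectrum_iff_exists_eigenvector]
  have h1 := h.exists_eigenvector_iff hζ α i q (μ / C)
  simp only [Set.mem_image, hval]
  have h2 : (∃ w : levelSpace ρ (q : ℕ), w ≠ 0 ∧
      LinearMap.restrict (pos ρ hbar m ω α i ^ 2) hinv w = μ • w) ↔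
      ∃ w ∈ levelSpace ρ (q : ℕ), w ≠ 0 ∧
        (ρ.e (label α i) (label α i) + ρ.e 0 0) w = (μ / C) • w := by
    have h3 : ∀ w : W, (pos ρ hbar m ω α i ^ 2) w = μ • w ↔
        (ρ.e (label α i) (label α i) + ρ.e 0 0) w = (μ / C) • w := by
      intro w
      rw [hpos, LinearMap.smul_apply, div_eq_inv_mul, mul_smul, eq_inv_smul_iff₀ hC0]
    constructor
    · rintro ⟨w, hw0, hw⟩
      exact ⟨w, w.2, fun h0 => hw0 (Subtype.ext h0), (h3 _).mp (congrArg Subtype.val hw)⟩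
    · rintro ⟨w, hwl, hw0, hw⟩
      exact ⟨⟨w, hwl⟩, fun h0 => hw0 (congrArg Subtype.val h0), Subtype.ext ((h3 _).mpr hw)⟩
  rw [h2, h1]
  refine exists_congr fun r => and_congr_right fun _ => ?_
  rw [eq_div_iff hC0, mul_comm]

end Final

end WQO

theorem mainTheorem8 (N : ℕ) (hN : 1 ≤ N) (hbar m ω : ℝ) (hbar_pos : 0 < hbar) (m_pos : 0 < m)
    (ω_pos : 0 < ω) :
    -- the finite-dimensional simple module of highest weight `2 ε + δ_1` exists
    (∃ (W : Type) (_ : AddCommGroup W) (_ : Module ℂ W) (_ : FiniteDimensional ℂ W)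
      (ρ : WQO.GLModule (3 * N) W),
      ρ.IsSimple ∧ ρ.HasHighestWeight (WQO.weight21 (3 * N))) ∧
    -- and in every such module the following hold
    ∀ (W : Type*) [AddCommGroup W] [Module ℂ W] [FiniteDimensional ℂ W]
      (ρ : WQO.GLModule (3 * N) W),
      ρ.IsSimple → ρ.HasHighestWeight (WQO.weight21 (3 * N)) →
      -- the energy levels
      (WQO.energy N hbar ω 0 = hbar * ω * ((6 * (N : ℝ) + 1) / (3 * (N : ℝ) - 1)) ∧
        WQO.energy N hbar ω 1 = hbar * ω * ((3 * (N : ℝ) + 2) / (3 * (N : ℝ) - 1)) ∧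
        WQO.energy N hbar ω 2 = hbar * ω * (3 / (3 * (N : ℝ) - 1)) ∧
        Function.Injective (WQO.energy N hbar ω) ∧
        spectrum ℂ (WQO.hamiltonian ρ hbar m ω) =
          {(WQO.energy N hbar ω 0 : ℂ), (WQO.energy N hbar ω 1 : ℂ),
            (WQO.energy N hbar ω 2 : ℂ)} ∧
        (⨆ q : Fin 3, (WQO.hamiltonian ρ hbar m ω).eigenspace (WQO.energy N hbar ω q : ℂ)) = ⊤) ∧
      -- their degeneracies
      (Module.finrank ℂ
          ((WQO.hamiltonian ρ hbar m ω).eigenspace (WQO.energy N hbar ω 0 : ℂ)) = 3 * N ∧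
        Module.finrank ℂ
          ((WQO.hamiltonian ρ hbar m ω).eigenspace (WQO.energy N hbar ω 1 : ℂ)) = 9 * N ^ 2 ∧
        Module.finrank ℂ
          ((WQO.hamiltonian ρ hbar m ω).eigenspace (WQO.energy N hbar ω 2 : ℂ)) =
            N * (9 * N ^ 2 - 1)) ∧
      -- the spectrum of the squared position components on each level
      (∀ (α : Fin N) (i : Fin 3) (q : Fin 3),
        ∃ h : ∀ v ∈ (WQO.hamiltonian ρ hbar m ω).eigenspace (WQO.energy N hbar ω q : ℂ),
          ((WQO.pos ρ hbar m ω α i) ^ 2) v ∈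
            (WQO.hamiltonian ρ hbar m ω).eigenspace (WQO.energy N hbar ω q : ℂ),
          spectrum ℂ (LinearMap.restrict ((WQO.pos ρ hbar m ω α i) ^ 2) h) =
            (fun r : ℕ => ((hbar * r / ((3 * (N : ℝ) - 1) * m * ω) : ℝ) : ℂ)) ''
              ((![{2, 3}, {1, 2, 3}, {0, 1, 2}] : Fin 3 → Set ℕ) q)) ∧
      -- the angular momentum content of each level and its generating function
      ∃ mult : ℕ → ℕ → ℕ,
        (∀ q : ℕ, WQO.HasAngularContent (WQO.angMom ρ hbar m ω)
          ((WQO.hamiltonian ρ hbar m ω).eigenspace (WQO.energy N hbar ω q : ℂ)) (mult q)) ∧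
        (∀ Q J : ℂ, HasSum (fun p : ℕ × ℕ => (mult p.1 p.2 : ℂ) * Q ^ p.1 * J ^ p.2)
          ((N : ℂ) * J + (N : ℂ) ^ 2 * (1 + J + J ^ 2) * Q +
            ((N : ℂ) * ((N : ℂ) ^ 2 - 1) / 3 + (N : ℂ) ^ 3 * J +
              (N : ℂ) * (2 * (N : ℂ) ^ 2 + 1) / 3 * J ^ 2 +
              (N : ℂ) * ((N : ℂ) ^ 2 - 1) / 3 * J ^ 3) * Q ^ 2)) ∧
        (N = 1 → ∀ J : ℂ, HasSum (fun p : ℕ × ℕ => (mult p.1 p.2 : ℂ) * 1 ^ p.1 * J ^ p.2)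
          (1 + 3 * J + 2 * J ^ 2)) ∧
        (N = 2 → ∀ J : ℂ, HasSum (fun p : ℕ × ℕ => (mult p.1 p.2 : ℂ) * 1 ^ p.1 * J ^ p.2)
          (6 + 14 * J + 10 * J ^ 2 + 2 * J ^ 3)) := by
  obtain ⟨ζ, hζ⟩ := WQO.exists_cube_root
  have hn : 1 ≤ 3 * N := by omega
  refine ⟨⟨WQO.twisted (Fin N × Fin 3) ζ, inferInstance, inferInstance, inferInstance,
    WQO.twistedModule (WQO.labelEquiv N) WQO.labelEquiv_zero ζ,
    WQO.twistedModule_isSimple WQO.labelEquiv_zero hζ hn,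
    WQO.twistedModule_hasHighestWeight WQO.labelEquiv_zero hζ hn⟩, ?_⟩
  intro W _ _ _ ρ hs hw
  obtain ⟨Φ, h⟩ := WQO.exists_isModel hN hζ hs hw
  have hH := h.eigenspace_hamiltonian hN hbar_pos m_pos ω_pos
  have hd := WQO.three_mul_sub_one_pos hN
  obtain ⟨hd0, hd1, hd2⟩ := WQO.finrank_level_values (N := N) hζ
  refine ⟨⟨?_, ?_, ?_, ?_, ?_, ?_⟩, ⟨?_, ?_, ?_⟩, ?_, ?_⟩
  · simp [WQO.energy]
  · rw [WQO.energy]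
    congr 1
    rw [eq_div_iff hd.ne', sub_mul, div_mul_cancel₀ _ hd.ne']
    push_cast
    ring
  · rw [WQO.energy]
    congr 1
    rw [eq_div_iff hd.ne', sub_mul, div_mul_cancel₀ _ hd.ne']
    push_cast
    ring
  · intro q q' hq
    have h1 := mul_left_cancel₀ (mul_pos hbar_pos ω_pos).ne' hq
    have h2 : (q : ℝ) = q' := by linarith
    exact_mod_cast h2
  · exact h.spectrum_hamiltonian hζ hN hbar_pos m_pos ω_pos
  · simp only [hH]
    exact h.iSup_levelSpace hζ
  · rw [hH, h.finrank_levelSpace, hd0]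
  · rw [hH, h.finrank_levelSpace, hd1]
  · rw [hH, h.finrank_levelSpace, Nat.mul_sub, mul_one]
    have : N * (9 * N ^ 2) = 9 * N ^ 3 := by ring
    omega
  · intro α i q
    rw [hH]
    exact h.spectrum_pos_sq hζ hN hbar_pos m_pos ω_pos α i q
  · -- `c` is the dimension of the weight space of the largest weight `3` on the level `q = 2`
    obtain ⟨c, hc⟩ : ∃ c : ℕ, 3 * c + N = N ^ 3 := by
      have h1 := WQO.finrank_levelSpin_values (N := N) hζ 2 3
      exact ⟨_, by simpa using h1⟩
    have hsum := WQO.hasSum_multiplicity hc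
    refine ⟨WQO.multiplicity N c, fun q => ?_, hsum, ?_, ?_⟩
    · rw [hH, show WQO.angMom ρ hbar m ω = fun j => WQO.blockOp ρ (WQO.spinMats j) from
        funext fun j => WQO.angMom_eq ρ hN hbar_pos m_pos ω_pos j]
      exact h.hasAngularContent hζ hc q
    · rintro rfl J
      convert hsum 1 J using 1
      push_cast
      ring
    · rintro rfl J
      convert hsum 1 J using 1
      push_cast
      ring
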